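/- **Conventions.** Graphs are finite, connected, undirected, without loops or multiple edges. An $H$-graph is a graph $\Gamma$ with a subgroup $H\le \mathrm{Aut}(\Gamma)$; $H_z$ is the stabilizer in $H$ of a vertex $z$, $\Gamma(z)$ the set of neighbours of $z$, and $H_z^{[1]}$ the kernel of the action of $H_z$ on $\Gamma(z)$. An $s$-arc is a sequence $(y_0,\dots,y_s)$ of vertices with $y_{i-1}$ adjacent to $y_i$ and $y_{i-1}\ne y_{i+1}$. $\Gamma$ is *locally $s$-arc transitive* if, for each vertex $z$, $H_z$ is transitive on the $s$-arcs with $y_0=z$. It is of *pushing up type* with respect to the $1$-arc $(x_1,x_2)$ and the prime $p$ if $C_{H_z}(O_p(H_z^{[1]}))\le O_p(H_z^{[1]})$ for all vertices $z$, and $O_p(H_{x_1}^{[1]})\le O_p(H_{x_2}^{[1]})$. The *vertex stabilizer amalgam* is $(H_1,H_2;H_{1,2})$ with $H_i=H_{x_i}$ and $H_{1,2}=H_1\cap H_2$. Let $T_i$ be the largest subgroup of $H_{1,2}$ that is normal in $H_i$. Let $B$ be the least subgroup of $H_{1,2}$ with $T_1T_2\le B$ and $B=H_{1,2}\cap\langle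 B^{H_i}\rangle$ for $i=1,2$, and put $H_i^*=\langle B^{H_i}\rangle$; the amalgam $(H_1^*,H_2^*;B)$ is the *core*. $E_n$ is the elementary abelian group of order $n$. $\mathrm{ASL}_2(q)$ and $\mathrm{AGL}_n(q)$ are the semidirect products of $\mathrm{SL}_2(q)$, $\mathrm{GL}_n(q)$ with the natural module. $N\rtimes X$ denotes a semidirect product for some action of $X$ on $N$. For $S\in\mathrm{Syl}_3(\mathrm{ASL}_2(q))$ let $\mathrm{ASL}_2(q,S)=N_{\mathrm{ASL}_2(q)}(S)$, and let $K_2(q,S)$ be the kernel of the action of $N_{\mathrm{AGL}_2(q)}(S)$ by conjugation on the set of elementary abelian subgroups of $S$ of order $q^2$. $X^{(d)}$ denotes the unique normal subgroup of index $d$ of $X$, for $X$ one of $\mathrm{GL}_1(9)$, $\mathrm{GL}_2(9)$, $\mathrm{AGL}_2(9)$, $K_2(9,S)$ and the $d$ used below. **Theorem.** There exists a locally $5$-arc transitive $H$-graph $\Gamma$ with a $1$-arc $(x_1,x_2)$ such that $|\Gamma(x_1)|=10$ and $|\Gamma(x_2)|=9$, of pushing up type with respect to $(x_1,x_2)$ and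 the prime $3$, such that, with $L_1=\langle O_3(H_u^{[1]})\mid u\in\Gamma(x_1)\rangle\,O_3(H_{x_1}^{[1]})$, the following hold for every $S\in \mathrm{Syl}_3(\mathrm{ASL}_2(9))$: 1. $L_1\cong E_3\times \mathrm{ASL}_2(9)$, $Z(L_1)\cong E_3$, and $O_3(B)=O_3(L_1\cap B)=O_3(T_2)\in\mathrm{Syl}_3(L_1)$; 2. $B=(L_1\cap B)T_2$, with $L_1\cap B\cong E_3\times\mathrm{ASL}_2(9,S)$ and $T_2/Z(L_1)\cong K_2(9,S)^{(2)}$; 3. $H_1^*\cong E_{3^5}\rtimes \mathrm{GL}_2(9)^{(2)}$ and $C_{H_1^*}(Z(L_1))\cong E_3\times\mathrm{AGL}_2(9)^{(4)}$; 4. $H_2^*\cong O_3(T_2)\rtimes(\mathrm{GL}_1(9)^{(2)}\times\mathrm{AGL}_1(9))$ and $C_{H_2^*}(Z(O_3(T_2)))\cong E_3\times K_2(9,S)^{(4)}$; 5. $|H_{x_1}:H_1^*|=|H_{x_2}:H_2^*|=|H_{x_1,x_2}:B|=2$ and $H_{x_1}/L_1\cong Q_8$. Moreover, the amalgam $(H_1,H_2;H_{1,2})$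 is isomorphic to a subamalgam of index $3$ of the amalgam $(R_1,R_2;R_1\cap R_2)$ defined as follows, and the coset graph of $\langle R_1,R_2\rangle$ on $R_1$ and $R_2$ is a cover of the coset graph of $\langle G_1,G_2\rangle$ on $G_1$ and $G_2$. Here a coset of one subgroup is adjacent to a coset of the other if they meet, and a cover is a surjective graph morphism that is bijective on the neighbours of each vertex. All four groups consist of permutations of $\mathbb F_9^3$. Put - $\alpha_{(u,v,w)}:(a,b,c)\mapsto(a+u,b+v,c+w)$, - $\beta_{\lambda,\mu}:(a,b,c)\mapsto(\lambda a,\mu b,(\lambda\mu)^6c)$, - $\gamma_e:(a,b,c)\mapsto(a+eb,b,c)$, - $\delta:(a,b,c)\mapsto(b,-a,c)$, - $\tau_d:(a,b,c)\mapsto(a+db^2+d^3c,b,c)$, - $\sigma:(a,b,c)\mapsto(a^3,b^3,c^3)$, with $u,v,w,d,e\in\mathbb F_9$ and $\lambda,\mu\in\mathbb F_9^*$. Let $A$ be the group of all $\alpha_{(u,v,w)}$, $V$ that of all $\alpha_{(u,v,0)}$, $F$ that of all $\alpha_{(0,0,w)}$, $C$ that of all $\gamma_e$, $E$ that of all $\tau_d$,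 $S_0$ that of all $\beta_{\mu^2,\mu}$, $T$ that of all $\beta_{\mu,\mu^{-1}}$; let $\Sigma=\langle\sigma\rangle$, $M=\langle C,\delta,T\rangle$, and let $J\cong Q_8$ be generated by the $\beta_{\mu^2,\mu}$ with $\mu$ a square and the $\beta_{\mu^2,\mu}\sigma$ with $\mu$ a non-square. Then $G_1=\langle A,M,S_0,\Sigma\rangle$, $G_2=\langle A,C,S_0,E,T,\Sigma\rangle$, $R_1=\langle V,M,F,J\rangle$ and $R_2=\langle V,C,E,T,F,J\rangle$. -/

import Mathlib

open scoped Pointwise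

/-! ### Finite group theory inside an ambient group -/

/-- `N` is a normal subgroup of the subgroup `P`. -/
def IsNormalIn {G : Type*} [Group G] (N P : Subgroup G) : Prop :=
  N ≤ P ∧ ∀ g ∈ P, ∀ x ∈ N, g * x * g⁻¹ ∈ N

/-- `O_p(P)`, the largest normal `p`-subgroup of `P`, for a finite group `P`. -/
def pCore {G : Type*} [Group G] (p : ℕ) (P : Subgroup G) : Subgroup G :=
  sSup {N | IsNormalIn N P ∧ IsPGroup p N}

/-- The centre of the subgroup `P`, as a subgroup of the ambient group. -/
def centerOf {G : Type*} [Group G] (P : Subgroup G) : Subgroup G :=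
  P ⊓ Subgroup.centralizer (P : Set G)

/-- The subgroup `⟨B ^ P⟩` generated by all `P`-conjugates of `B`. -/
def conjClosure {G : Type*} [Group G] (B P : Subgroup G) : Subgroup G :=
  Subgroup.closure {x | ∃ g ∈ P, ∃ b ∈ B, x = g⁻¹ * b * g}

/-- `N` is a normal subgroup of `P`, and the quotient group `P / N` is isomorphic to `Q`. -/
def QuotientIso {G : Type*} [Group G] (P N : Subgroup G) (Q : Type*) [Group Q] : Prop :=
  N ≤ P ∧ ∃ _ : (N.subgroupOf P).Normal, Nonempty (P ⧸ N.subgroupOf P ≃* Q)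

/-- `N` is the unique normal subgroup of index `d` of `G`, written `G^(d)`. -/
def IsTheNormalSubgroup {G : Type*} [Group G] (N : Subgroup G) (d : ℕ) : Prop :=
  N.Normal ∧ N.index = d ∧ ∀ N' : Subgroup G, N'.Normal → N'.index = d → N' = N

/-- The elementary abelian group of order `p ^ k`. -/
abbrev ElemAb (p k : ℕ) : Type := Multiplicative (Fin k → ZMod p)

/-! ### Linear and affine groups -/

/-- The natural action of `GL_n(K)` on the (multiplicatively written) space `K ^ n`. -/
def natAction (n : ℕ) (K : Type) [Field K] :
    GL (Fin n) K →* MulAut (Multiplicative (Fin n → K)) where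
  toFun g :=
    { toFun := fun v => Multiplicative.ofAdd ((g : Matrix (Fin n) (Fin n) K).mulVec v.toAdd)
      invFun := fun v =>
        Multiplicative.ofAdd (((g⁻¹ : GL (Fin n) K) : Matrix (Fin n) (Fin n) K).mulVec v.toAdd)
      left_inv := fun v => by
        simp only [toAdd_ofAdd]
        rw [Matrix.mulVec_mulVec, ← Units.val_mul, inv_mul_cancel, Units.val_one,
          Matrix.one_mulVec, ofAdd_toAdd]
      right_inv := fun v => by
        simp only [toAdd_ofAdd]
        rw [Matrix.mulVec_mulVec, ← Units.val_mul, mul_inv_cancel, Units.val_one,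
          Matrix.one_mulVec, ofAdd_toAdd]
      map_mul' := fun v w => by
        rw [toAdd_mul, Matrix.mulVec_add, ofAdd_add] }
  map_one' := by
    refine MulEquiv.ext fun v => ?_
    change Multiplicative.ofAdd (((1 : GL (Fin n) K) : Matrix (Fin n) (Fin n) K).mulVec v.toAdd) = v
    rw [Units.val_one, Matrix.one_mulVec, ofAdd_toAdd]
  map_mul' g h := by
    refine MulEquiv.ext fun v => ?_
    change Multiplicative.ofAdd (((g * h : GL (Fin n) K) : Matrix (Fin n) (Fin n) K).mulVec v.toAdd)
      = Multiplicative.ofAdd ((g : Matrix (Fin n) (Fin n) K).mulVec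
          ((h : Matrix (Fin n) (Fin n) K).mulVec v.toAdd))
    rw [Units.val_mul, Matrix.mulVec_mulVec]

/-- `AGL_n(K)`. -/
abbrev AGL (n : ℕ) (K : Type) [Field K] : Type :=
  Multiplicative (Fin n → K) ⋊[natAction n K] GL (Fin n) K

/-- `ASL_n(K)`. -/
abbrev ASL (n : ℕ) (K : Type) [Field K] : Type :=
  Multiplicative (Fin n → K)
    ⋊[(natAction n K).comp Matrix.SpecialLinearGroup.toGL] Matrix.SpecialLinearGroup (Fin n) K

/-- The inclusion of `ASL_n(K)` in `AGL_n(K)`. -/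
def aslToAgl (n : ℕ) (K : Type) [Field K] : ASL n K →* AGL n K :=
  SemidirectProduct.map (MonoidHom.id _) Matrix.SpecialLinearGroup.toGL (fun _ => rfl)

/-- The elementary abelian `p`-subgroups of order `q ^ 2` of `S ≤ AGL_2(K)`, `q = |K|`. -/
def elemAbSubgroups (p : ℕ) {K : Type} [Field K] (S : Subgroup (AGL 2 K)) :
    Set (Subgroup (AGL 2 K)) :=
  {A | A ≤ S ∧ (∀ a ∈ A, ∀ b ∈ A, a * b = b * a) ∧ (∀ a ∈ A, a ^ p = 1) ∧
    Nat.card A = Nat.card K ^ 2}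

/-- `K_2(q, S)`: the kernel of the conjugation action of `AGL_2(q, S) = N_{AGL_2(q)}(S)` on the set
of elementary abelian subgroups of order `q ^ 2` of `S ∈ Syl_p(ASL_2(q))`. -/
def kernelK2 (p : ℕ) {K : Type} [Field K] (S : Subgroup (ASL 2 K)) : Subgroup (AGL 2 K) :=
  Subgroup.normalizer (S.map (aslToAgl 2 K) : Set (AGL 2 K)) ⊓
    ⨅ A ∈ elemAbSubgroups p (S.map (aslToAgl 2 K)), Subgroup.normalizer (A : Set (AGL 2 K))

/-! ### Graphs with a group of automorphisms -/

section Graph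

variable {V : Type} {Γ : SimpleGraph V}

/-- The stabilizer `H_z` of the vertex `z`. -/
def vertexStab (H : Subgroup (Γ ≃g Γ)) (z : V) : Subgroup (Γ ≃g Γ) :=
  H ⊓ MulAction.stabilizer (Γ ≃g Γ) z

/-- `H_z^[1]`: the kernel of the action of `H_z` on the set of neighbours of `z`. -/
def localKernel (H : Subgroup (Γ ≃g Γ)) (z : V) : Subgroup (Γ ≃g Γ) :=
  vertexStab H z ⊓ ⨅ u ∈ Γ.neighborSet z, MulAction.stabilizer (Γ ≃g Γ) u

/-- `(x 0, …, x s)` is an `s`-arc: consecutive vertices are adjacent, and vertices two steps apart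
are distinct. -/
def IsSArc (Γ : SimpleGraph V) (s : ℕ) (x : Fin (s + 1) → V) : Prop :=
  (∀ i : Fin s, Γ.Adj (x i.castSucc) (x i.succ)) ∧
    ∀ i j : Fin (s + 1), (i : ℕ) + 2 = j → x i ≠ x j

/-- Each `H_z` is transitive on the `s`-arcs that originate at `z`. -/
def LocallyArcTransitive (H : Subgroup (Γ ≃g Γ)) (s : ℕ) : Prop :=
  ∀ z : V, ∀ x y : Fin (s + 1) → V, IsSArc Γ s x → IsSArc Γ s y → x 0 = z → y 0 = z →
    ∃ h ∈ vertexStab H z, ∀ i, h (x i) = y i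

/-- Local characteristic `p`. -/
def LocalChar (H : Subgroup (Γ ≃g Γ)) (p : ℕ) : Prop :=
  ∀ z : V, vertexStab H z ⊓ Subgroup.centralizer (pCore p (localKernel H z) : Set (Γ ≃g Γ)) ≤
    pCore p (localKernel H z)

/-- Pushing up type with respect to the `1`-arc `(x₁, x₂)` and the prime `p`. -/
def PushingUpType (H : Subgroup (Γ ≃g Γ)) (p : ℕ) (x₁ x₂ : V) : Prop :=
  p.Prime ∧ Γ.Adj x₁ x₂ ∧ LocalChar H p ∧
    pCore p (localKernel H x₁) ≤ pCore p (localKernel H x₂)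

/-- `L₁ = ⟨O_p(H_u^[1]) | u a neighbour of x₁⟩ O_p(H_{x₁}^[1])`. -/
def groupL (H : Subgroup (Γ ≃g Γ)) (p : ℕ) (x₁ : V) : Subgroup (Γ ≃g Γ) :=
  (⨆ u ∈ Γ.neighborSet x₁, pCore p (localKernel H u)) ⊔ pCore p (localKernel H x₁)

end Graph

/-! ### Amalgams

An amalgam is given by two subgroups `P₁`, `P₂` of a group; the amalgamated subgroup is
`P₁ ⊓ P₂`. -/

/-- The largest subgroup of `D` that is normal in `P`. -/
def largestNormal {G : Type*} [Group G] (D P : Subgroup G) : Subgroup G :=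
  sSup {N | N ≤ D ∧ IsNormalIn N P}

/-- The conditions `T₁ T₂ ≤ B` and `B = P₁₂ ∩ ⟨B ^ Pᵢ⟩`, `i = 1, 2`, on a subgroup `B` of
`P₁₂ = P₁ ⊓ P₂`. -/
def CoreCondition {G : Type*} [Group G] (P₁ P₂ B : Subgroup G) : Prop :=
  B ≤ P₁ ⊓ P₂ ∧
    largestNormal (P₁ ⊓ P₂) P₁ ⊔ largestNormal (P₁ ⊓ P₂) P₂ ≤ B ∧
    B = (P₁ ⊓ P₂) ⊓ conjClosure B P₁ ∧ B = (P₁ ⊓ P₂) ⊓ conjClosure B P₂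

/-- `B` is the least subgroup subject to the core condition. The core of the amalgam is then
`(⟨B ^ P₁⟩, ⟨B ^ P₂⟩; B)`. -/
def IsCoreBase {G : Type*} [Group G] (P₁ P₂ B : Subgroup G) : Prop :=
  IsLeast {B' | CoreCondition P₁ P₂ B'} B

/-- The amalgam `(P₁, P₂; P₁ ⊓ P₂)` is isomorphic to a subamalgam of index `n` of the amalgam
`(R₁, R₂; R₁ ⊓ R₂)`. -/
def IsSubamalgamOfIndex {G X : Type*} [Group G] [Group X] (n : ℕ) (P₁ P₂ : Subgroup G)
    (R₁ R₂ : Subgroup X) : Prop :=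
  ∃ (f₁ : P₁ →* X) (f₂ : P₂ →* X) (D : Subgroup X),
    Function.Injective f₁ ∧ Function.Injective f₂ ∧
    (∀ (g : G) (h₁ : g ∈ P₁) (h₂ : g ∈ P₂), f₁ ⟨g, h₁⟩ = f₂ ⟨g, h₂⟩) ∧
    D = ((P₁ ⊓ P₂).subgroupOf P₁).map f₁ ∧
    f₁.range ≤ R₁ ∧ f₂.range ≤ R₂ ∧
    f₁.range ⊓ (R₁ ⊓ R₂) = D ∧ f₂.range ⊓ (R₁ ⊓ R₂) = D ∧
    f₁.range.relIndex R₁ = n ∧ f₂.range.relIndex R₂ = n ∧ D.relIndex (R₁ ⊓ R₂) = n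

/-- The coset graph of the group `⟨R₁, R₂⟩` on the cosets of `R₁` and `R₂`: a coset of `R₁` and a
coset of `R₂` are adjacent if they meet. -/
def cosetGraph {X : Type*} [Group X] (R₁ R₂ : Subgroup X) :
    SimpleGraph ((↥(R₁ ⊔ R₂) ⧸ R₁.subgroupOf (R₁ ⊔ R₂)) ⊕
      (↥(R₁ ⊔ R₂) ⧸ R₂.subgroupOf (R₁ ⊔ R₂))) :=
  SimpleGraph.fromRel fun a b => ∃ g : ↥(R₁ ⊔ R₂),
    a = Sum.inl (QuotientGroup.mk g) ∧ b = Sum.inr (QuotientGroup.mk g)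

/-- `Γ'` is a cover of `Γ`: there is a surjective graph morphism that is bijective on the
neighbours of each vertex. -/
def IsCoverOf {V' V : Type*} (Γ' : SimpleGraph V') (Γ : SimpleGraph V) : Prop :=
  ∃ π : Γ' →g Γ, Function.Surjective π ∧
    ∀ v, Set.BijOn π (Γ'.neighborSet v) (Γ.neighborSet (π v))

/-! ### Permutations of `K ^ 3`, for a finite field `K` of order `q`, a power of `3`

`Equiv.Perm` composes from right to left, so that left cosets below are the cosets `{p g}` in the
convention where permutations act from the right. -/

namespace PermK

variable (K : Type) [Field K] [Finite K] [CharP K 3]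

/-- The exponent `ε = q / 3`. -/
noncomputable def eps : ℕ := Nat.card K / 3

variable {K}

/-- `(a, b, c) ↦ (a + u, b + v, c + w)`. -/
def α (u v w : K) : Equiv.Perm (K × K × K) where
  toFun x := (x.1 + u, x.2.1 + v, x.2.2 + w)
  invFun x := (x.1 - u, x.2.1 - v, x.2.2 - w)
  left_inv x := by simp
  right_inv x := by simp

/-- `(a, b, c) ↦ (l a, m b, (l m) ^ (2 ε) c)`. -/
noncomputable def β (l m : Kˣ) : Equiv.Perm (K × K × K) where
  toFun x := (↑l * x.1, ↑m * x.2.1, ↑((l * m) ^ (2 * eps K)) * x.2.2)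
  invFun x := (↑l⁻¹ * x.1, ↑m⁻¹ * x.2.1, ↑((l * m) ^ (2 * eps K))⁻¹ * x.2.2)
  left_inv x := by simp only [Units.inv_mul_cancel_left]
  right_inv x := by simp only [Units.mul_inv_cancel_left]

/-- `(a, b, c) ↦ (a + e b, b, c)`. -/
def γ (e : K) : Equiv.Perm (K × K × K) where
  toFun x := (x.1 + e * x.2.1, x.2.1, x.2.2)
  invFun x := (x.1 - e * x.2.1, x.2.1, x.2.2)
  left_inv x := by simp
  right_inv x := by simp

variable (K) in
/-- `(a, b, c) ↦ (b, -a, c)`. -/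
def δ : Equiv.Perm (K × K × K) where
  toFun x := (x.2.1, -x.1, x.2.2)
  invFun x := (-x.2.1, x.1, x.2.2)
  left_inv x := by simp
  right_inv x := by simp

/-- `(a, b, c) ↦ (a + d b ^ 2 + d ^ ε c, b, c)`. -/
noncomputable def τ (d : K) : Equiv.Perm (K × K × K) where
  toFun x := (x.1 + (d * x.2.1 ^ 2 + d ^ eps K * x.2.2), x.2.1, x.2.2)
  invFun x := (x.1 - (d * x.2.1 ^ 2 + d ^ eps K * x.2.2), x.2.1, x.2.2)
  left_inv x := by simp
  right_inv x := by simp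

variable (K)

/-- `(a, b, c) ↦ (a ^ 3, b ^ 3, c ^ 3)`. -/
noncomputable def σ : Equiv.Perm (K × K × K) :=
  (frobeniusEquiv K 3).toEquiv.prodCongr
    ((frobeniusEquiv K 3).toEquiv.prodCongr (frobeniusEquiv K 3).toEquiv)

def grpA : Subgroup (Equiv.Perm (K × K × K)) := Subgroup.closure {g | ∃ u v w : K, g = α u v w}

def grpV : Subgroup (Equiv.Perm (K × K × K)) := Subgroup.closure {g | ∃ u v : K, g = α u v 0}

def grpF : Subgroup (Equiv.Perm (K × K × K)) := Subgroup.closure {g | ∃ w : K, g = α 0 0 w}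

def grpC : Subgroup (Equiv.Perm (K × K × K)) := Subgroup.closure {g | ∃ e : K, g = γ e}

def grpD : Subgroup (Equiv.Perm (K × K × K)) := Subgroup.closure {δ K}

noncomputable def grpE : Subgroup (Equiv.Perm (K × K × K)) :=
  Subgroup.closure {g | ∃ d : K, g = τ d}

noncomputable def grpS : Subgroup (Equiv.Perm (K × K × K)) :=
  Subgroup.closure {g | ∃ m : Kˣ, g = β (m ^ 2) m}

noncomputable def grpT : Subgroup (Equiv.Perm (K × K × K)) :=
  Subgroup.closure {g | ∃ m : Kˣ, g = β m m⁻¹}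

noncomputable def grpSigma : Subgroup (Equiv.Perm (K × K × K)) := Subgroup.closure {σ K}

noncomputable def grpM : Subgroup (Equiv.Perm (K × K × K)) := grpC K ⊔ grpD K ⊔ grpT K

/-- `G₁ = A M S Σ`. -/
noncomputable def G₁ : Subgroup (Equiv.Perm (K × K × K)) :=
  grpA K ⊔ grpM K ⊔ grpS K ⊔ grpSigma K

/-- `G₂ = A C S E T Σ`. -/
noncomputable def G₂ : Subgroup (Equiv.Perm (K × K × K)) :=
  grpA K ⊔ grpC K ⊔ grpS K ⊔ grpE K ⊔ grpT K ⊔ grpSigma K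

/-- The subgroup of `S Σ` generated by the `β_{m², m}` with `m` a square, and by the
`β_{m², m} σ` with `m` a non-square. -/
noncomputable def grpJ : Subgroup (Equiv.Perm (K × K × K)) :=
  Subgroup.closure ({g | ∃ m : Kˣ, IsSquare m ∧ g = β (m ^ 2) m} ∪
    {g | ∃ m : Kˣ, ¬ IsSquare m ∧ g = σ K * β (m ^ 2) m})

/-- `V M F J`. -/
noncomputable def G₁J : Subgroup (Equiv.Perm (K × K × K)) :=
  grpV K ⊔ grpM K ⊔ grpF K ⊔ grpJ K

/-- `V C E T F J`. -/
noncomputable def G₂J : Subgroup (Equiv.Perm (K × K × K)) :=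
  grpV K ⊔ grpC K ⊔ grpE K ⊔ grpT K ⊔ grpF K ⊔ grpJ K

end PermK

/-! Let K = F_9, let ω be a primitive eighth root of unity in K, and let χ send the squares of K* to
the identity and the non-squares to the Frobenius. H_1 (`stab₁`) consists of the maps (a,b,c) ↦
(M(φa,φb)+t, det(M)⁶φc+w) with φ = χ(det M). H_2 (`stab₂`) consists of the maps with triangular
linear part, diagonal (l,m), φ = χ(lm), and the extra term d(φb)² + d³l⁶φc in the first coordinate.
In both, w runs over W = {0, ±ω}. Allowing all w ∈ K gives R_1 and R_2 (`G₁J_eq`, `G₂J_eq`), whence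
the index 3. The twist makes this possible: x acts on the third coordinate by w ↦ x⁶χ(x)(w).
Untwisted, a non-square x would multiply by an element x⁶ of order 4 and preserve no subgroup of
order 3; twisted, every x acts on W as ±1 (`twistThree`).

Γ is the coset graph of H_1 and H_2 in the subgroup of Sym(K³) that they generate. It is finite and
connected, and the action is faithful: an element whose conjugates all lie in H_1 ∩ H_2 is a
translation, and conjugation by τ_1 and by the quarter turn δ annihilates its coordinates one at a
time (`stab_core`). Graph notions become subgroup computations: the vertex stabilizers are
conjugates of H_1 and H_2, and the kernel on the neighbours of x_i is T_i.

For transitivity on 5-arcs, move an edge to the base edge and then correct one further vertex at a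
time by elements of H_1 ∩ H_2 that fix what is already in place (`FiveArcData`). The corrections are
diag(ν,ν⁻¹), a shear γ_e, a twisted diag(μ²,μ), and a translation of the first coordinate
(`fiveArcData`). Since 5 is odd, reversal handles arcs that start at the other kind of vertex.

T_1 has the scalar matrices as linear parts. An element of T_2 has to be compatible with every τ_d,
which forces diagonal (m²,m) with m a square (`largestNormal_stab₂`). The 3-cores are the
translation group Q_1 of order 3⁵ and Q_2 = Q_1C of order 3⁷. They satisfy Q_1 ≤ Q_2 and contain
their centralizers in H_1 and H_2; for H_2 the term d³c is what excludes τ_d.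

The core is given by determinant a square. A candidate for B contains T_2, hence Q_2; the
H_1-conjugates of Q_2 generate the determinant-one part L_1 (`conjClosure_borel_bot`), so the
candidate contains L_1 ∩ H_1 ∩ H_2, and this together with T_2 is everything with square determinant
(`borel_diagSq_eq_mul`, `isCoreBase_borel`). The isomorphism types come from explicit complements
(`IsSplit`); Q_8 appears because units multiply under the twist by x·χ(x)(y) (`quatUnit_mul`). The
subgroups X^(d) are inverse images of d-th powers under a determinant: a normal subgroup of index
prime to 3 contains all elements of order 3, and in the non-abelian cases these generate the kernel
of the determinant. K_2(9,S) is the group with diagonals (m²,m), because it must preserve every line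
of S/Z(S) (`mem_kernelK2_unipAsl`).

Finally G_i = R_iΣ with Σ ≤ G_1 ∩ G_2 normalizing both R_i, while R_1 ∩ G_2 and R_2 ∩ G_1 are no
larger than R_1 ∩ R_2. The natural map of coset graphs is therefore bijective on neighbours
(`isCoverOf_cosetGraph`). -/

set_option linter.unusedSectionVars false

/-! ### Transport along injective homomorphisms -/

section Transport

variable {G G' : Type*} [Group G] [Group G'] {f : G →* G'}

theorem IsNormalIn.map {N P : Subgroup G} (f : G →* G') (h : IsNormalIn N P) :
    IsNormalIn (N.map f) (P.map f) := by
  refine ⟨Subgroup.map_mono h.1, ?_⟩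
  rintro _ ⟨g, hg, rfl⟩ _ ⟨x, hx, rfl⟩
  exact ⟨g * x * g⁻¹, h.2 g hg x hx, by simp⟩

theorem IsNormalIn.comap {N : Subgroup G'} {P : Subgroup G} (hf : Function.Injective f)
    (h : IsNormalIn N (P.map f)) : IsNormalIn (N.comap f) P := by
  refine ⟨fun x hx => ?_, fun g hg x hx => ?_⟩
  · obtain ⟨y, hy, hxy⟩ := h.1 hx
    rwa [← hf hxy]
  · have := h.2 (f g) ⟨g, hg, rfl⟩ (f x) hx
    simpa using this

theorem map_comap_of_le_map {N : Subgroup G'} {P : Subgroup G} (h : N ≤ P.map f) :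
    (N.comap f).map f = N :=
  Subgroup.map_comap_eq_self (h.trans (Subgroup.map_le_range f P))

/-- A subgroup of `P.map f` is the image of its preimage, so the families whose suprema are taken
correspond under `f`. The same scheme serves `largestNormal` and the core condition. -/
theorem pCore_map (hf : Function.Injective f) (p : ℕ) (P : Subgroup G) :
    pCore p (P.map f) = (pCore p P).map f := by
  apply le_antisymm
  · refine sSup_le fun N hN => ?_
    rw [← map_comap_of_le_map hN.1.1]
    exact Subgroup.map_mono (le_sSup ⟨hN.1.comap hf, hN.2.comap_of_injective f hf⟩)
  · rw [Subgroup.map_le_iff_le_comap]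
    refine sSup_le fun N hN => ?_
    rw [← Subgroup.map_le_iff_le_comap]
    exact le_sSup ⟨hN.1.map f, hN.2.map f⟩

theorem largestNormal_map (hf : Function.Injective f) (D P : Subgroup G) :
    largestNormal (D.map f) (P.map f) = (largestNormal D P).map f := by
  apply le_antisymm
  · refine sSup_le fun N hN => ?_
    rw [← map_comap_of_le_map hN.1]
    refine Subgroup.map_mono (le_sSup ⟨?_, hN.2.comap hf⟩)
    rw [← Subgroup.comap_map_eq_self_of_injective hf D]
    exact Subgroup.comap_mono hN.1
  · rw [Subgroup.map_le_iff_le_comap]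
    refine sSup_le fun N hN => ?_
    rw [← Subgroup.map_le_iff_le_comap]
    exact le_sSup ⟨Subgroup.map_mono hN.1, hN.2.map f⟩

/-- The intersection with the image of `P` is essential: the full centralizer in `G'` need not lie
in the range of `f`. -/
theorem map_inf_centralizer (hf : Function.Injective f) (P S : Subgroup G) :
    P.map f ⊓ Subgroup.centralizer (S.map f : Set G') =
      (P ⊓ Subgroup.centralizer (S : Set G)).map f := by
  ext x
  constructor
  · rintro ⟨⟨y, hy, rfl⟩, hx⟩
    refine ⟨y, ⟨hy, ?_⟩, rfl⟩
    refine Subgroup.mem_centralizer_iff.2 fun s hs => hf ?_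
    simpa using Subgroup.mem_centralizer_iff.1 hx (f s) ⟨s, hs, rfl⟩
  · rintro ⟨y, ⟨hy, hx⟩, rfl⟩
    refine ⟨⟨y, hy, rfl⟩, Subgroup.mem_centralizer_iff.2 ?_⟩
    rintro _ ⟨s, hs, rfl⟩
    simpa using congrArg f (Subgroup.mem_centralizer_iff.1 hx s hs)

theorem conjClosure_map (B P : Subgroup G) (f : G →* G') :
    conjClosure (B.map f) (P.map f) = (conjClosure B P).map f := by
  unfold conjClosure
  rw [MonoidHom.map_closure]
  congr 1
  ext x
  constructor
  · rintro ⟨_, ⟨g, hg, rfl⟩, _, ⟨b, hb, rfl⟩, rfl⟩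
    exact ⟨_, ⟨g, hg, b, hb, rfl⟩, by simp⟩
  · rintro ⟨_, ⟨g, hg, b, hb, rfl⟩, rfl⟩
    exact ⟨f g, ⟨g, hg, rfl⟩, f b, ⟨b, hb, rfl⟩, by simp⟩

theorem coreCondition_map (hf : Function.Injective f) (P₁ P₂ B : Subgroup G) :
    CoreCondition (P₁.map f) (P₂.map f) (B.map f) ↔ CoreCondition P₁ P₂ B := by
  have hinj := Subgroup.map_injective hf
  simp only [CoreCondition, ← Subgroup.map_inf _ _ f hf, largestNormal_map hf, conjClosure_map,
    ← Subgroup.map_sup, Subgroup.map_le_map_iff_of_injective hf, hinj.eq_iff]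

theorem isCoreBase_map (hf : Function.Injective f) (P₁ P₂ B : Subgroup G) :
    IsCoreBase (P₁.map f) (P₂.map f) (B.map f) ↔ IsCoreBase P₁ P₂ B := by
  constructor
  · rintro ⟨h1, h2⟩
    refine ⟨(coreCondition_map hf _ _ _).1 h1, fun C hC => ?_⟩
    exact (Subgroup.map_le_map_iff_of_injective hf).1 (h2 ((coreCondition_map hf _ _ _).2 hC))
  · rintro ⟨h1, h2⟩
    refine ⟨(coreCondition_map hf _ _ _).2 h1, fun C hC => ?_⟩
    have hle : C ≤ P₁.map f := hC.1.trans inf_le_left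
    have hC' : CoreCondition (P₁.map f) (P₂.map f) C := hC
    rw [← map_comap_of_le_map hle] at hC' ⊢
    exact Subgroup.map_mono (h2 ((coreCondition_map hf _ _ _).1 hC'))

/-- Together with `QuotientIso.exists_hom`, this trades the dependent quotient type for a surjection
with prescribed kernel, which is easy to transport. -/
theorem quotientIso_of_hom {P N : Subgroup G} {Q : Type*} [Group Q] (hN : N ≤ P) (g : P →* Q)
    (hg : Function.Surjective g) (hker : ∀ x : P, g x = 1 ↔ (x : G) ∈ N) : QuotientIso P N Q := by
  have h : N.subgroupOf P = g.ker := by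
    ext x
    rw [MonoidHom.mem_ker, hker]; rfl
  refine ⟨hN, ?_⟩
  rw [h]
  exact ⟨inferInstance, ⟨QuotientGroup.quotientKerEquivOfSurjective g hg⟩⟩

theorem QuotientIso.exists_hom {P N : Subgroup G} {Q : Type*} [Group Q] (h : QuotientIso P N Q) :
    ∃ g : P →* Q, Function.Surjective g ∧ ∀ x : P, g x = 1 ↔ (x : G) ∈ N := by
  obtain ⟨-, hn, ⟨e⟩⟩ := h
  refine ⟨e.toMonoidHom.comp (QuotientGroup.mk' _), ?_, fun x => ?_⟩
  · exact e.surjective.comp (QuotientGroup.mk'_surjective _)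
  · simp [Subgroup.mem_subgroupOf]

end Transport

/-- The image in `G'` of a subgroup of `X` contained in `P`, along a homomorphism defined
on `P`. -/
def partialMap {X G' : Type*} [Group X] [Group G'] {P : Subgroup X} (f : P →* G')
    (S : Subgroup X) : Subgroup G' :=
  (S.subgroupOf P).map f

namespace partialMap

variable {X G' : Type*} [Group X] [Group G'] {P : Subgroup X} {f : P →* G'}

theorem mem {S : Subgroup X} {y : G'} :
    y ∈ partialMap f S ↔ ∃ (x : X) (hx : x ∈ P), x ∈ S ∧ f ⟨x, hx⟩ = y := by
  constructor
  · rintro ⟨⟨x, hx⟩, hxS, rfl⟩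
    exact ⟨x, hx, hxS, rfl⟩
  · rintro ⟨x, hx, hxS, rfl⟩
    exact ⟨⟨x, hx⟩, hxS, rfl⟩

theorem mono {S T : Subgroup X} (h : S ≤ T) : partialMap f S ≤ partialMap f T :=
  Subgroup.map_mono (Subgroup.comap_mono h)

/-- Recognizes a subgroup of `P` by its image in `X`. The lemmas below can then use each transport
statement twice, once for `f` and once for the inclusion of `P`. -/
theorem subgroupOf_eq_of_map {S : Subgroup X} {T : Subgroup P} (h : T.map P.subtype = S) :
    S.subgroupOf P = T := by
  rw [← h]
  exact Subgroup.comap_map_eq_self_of_injective P.subtype_injective T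

theorem inf (hf : Function.Injective f) (S T : Subgroup X) :
    partialMap f (S ⊓ T) = partialMap f S ⊓ partialMap f T := by
  unfold partialMap
  rw [← Subgroup.map_inf _ _ _ hf]
  rfl

theorem pCore (hf : Function.Injective f) (p : ℕ) {S : Subgroup X} (hS : S ≤ P) :
    pCore p (partialMap f S) = partialMap f (_root_.pCore p S) := by
  unfold partialMap
  rw [pCore_map hf]
  congr 1
  refine (subgroupOf_eq_of_map ?_).symm
  rw [← pCore_map P.subtype_injective, Subgroup.map_subgroupOf_eq_of_le hS]

theorem largestNormal (hf : Function.Injective f) {S T : Subgroup X} (hS : S ≤ P) (hT : T ≤ P) :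
    largestNormal (partialMap f S) (partialMap f T) =
      partialMap f (_root_.largestNormal S T) := by
  unfold partialMap
  rw [largestNormal_map hf]
  congr 1
  refine (subgroupOf_eq_of_map ?_).symm
  rw [← largestNormal_map P.subtype_injective, Subgroup.map_subgroupOf_eq_of_le hS,
    Subgroup.map_subgroupOf_eq_of_le hT]

theorem inf_centralizer (hf : Function.Injective f) {S T : Subgroup X} (hS : S ≤ P) (hT : T ≤ P) :
    partialMap f S ⊓ Subgroup.centralizer (partialMap f T : Set G') =
      partialMap f (S ⊓ Subgroup.centralizer (T : Set X)) := by
  unfold partialMap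
  rw [map_inf_centralizer hf]
  congr 1
  refine (subgroupOf_eq_of_map ?_).symm
  rw [← map_inf_centralizer P.subtype_injective, Subgroup.map_subgroupOf_eq_of_le hS,
    Subgroup.map_subgroupOf_eq_of_le hT]

theorem centerOf (hf : Function.Injective f) {S : Subgroup X} (hS : S ≤ P) :
    centerOf (partialMap f S) = partialMap f (_root_.centerOf S) :=
  inf_centralizer hf hS hS

theorem conjClosure {S T : Subgroup X} (hS : S ≤ P) (hT : T ≤ P) :
    conjClosure (partialMap f S) (partialMap f T) =
      partialMap f (_root_.conjClosure S T) := by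
  unfold partialMap
  rw [conjClosure_map]
  congr 1
  refine (subgroupOf_eq_of_map ?_).symm
  rw [← conjClosure_map _ _ P.subtype, Subgroup.map_subgroupOf_eq_of_le hS,
    Subgroup.map_subgroupOf_eq_of_le hT]

theorem isCoreBase (hf : Function.Injective f) {P₁ P₂ B : Subgroup X} (h₁ : P₁ ≤ P) (h₂ : P₂ ≤ P)
    (h : IsCoreBase P₁ P₂ B) :
    IsCoreBase (partialMap f P₁) (partialMap f P₂) (partialMap f B) := by
  have hB : B ≤ P := (h.1.1.trans inf_le_left).trans h₁
  unfold partialMap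
  rw [isCoreBase_map hf, ← isCoreBase_map P.subtype_injective, Subgroup.map_subgroupOf_eq_of_le h₁,
    Subgroup.map_subgroupOf_eq_of_le h₂, Subgroup.map_subgroupOf_eq_of_le hB]
  exact h

theorem relIndex (hf : Function.Injective f) {S T : Subgroup X} (hS : S ≤ P) (hT : T ≤ P) :
    (partialMap f S).relIndex (partialMap f T) = S.relIndex T := by
  unfold partialMap
  rw [Subgroup.relIndex_map_map_of_injective _ _ hf,
    ← Subgroup.relIndex_map_map_of_injective _ _ P.subtype_injective,
    Subgroup.map_subgroupOf_eq_of_le hS, Subgroup.map_subgroupOf_eq_of_le hT]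

/-- A subgroup of `P` is isomorphic to its image. -/
noncomputable def equiv (hf : Function.Injective f) {S : Subgroup X} (hS : S ≤ P) :
    S ≃* partialMap f S :=
  (Subgroup.subgroupOfEquivOfLe hS).symm.trans (Subgroup.equivMapOfInjective _ f hf)

theorem equiv_apply (hf : Function.Injective f) {S : Subgroup X} (hS : S ≤ P) (x : S) :
    (equiv hf hS x : G') = f ⟨x, hS x.2⟩ := rfl

theorem apply_mem_iff (hf : Function.Injective f) {S : Subgroup X} {x : X} (hx : x ∈ P) :
    f ⟨x, hx⟩ ∈ partialMap f S ↔ x ∈ S := by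
  rw [mem]
  constructor
  · rintro ⟨y, hy, hyS, h⟩
    have := hf h
    rw [Subtype.mk.injEq] at this
    rwa [← this]
  · exact fun h => ⟨x, hx, h, rfl⟩

theorem quotientIso (hf : Function.Injective f) {S N : Subgroup X} (hS : S ≤ P)
    {Q : Type*} [Group Q] (h : QuotientIso S N Q) :
    QuotientIso (partialMap f S) (partialMap f N) Q := by
  obtain ⟨g, hg, hker⟩ := h.exists_hom
  refine quotientIso_of_hom (mono h.1) (g.comp (equiv hf hS).symm.toMonoidHom)
    (hg.comp (equiv hf hS).symm.surjective) fun x => ?_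
  obtain ⟨x, rfl⟩ := (equiv hf hS).surjective x
  rw [equiv_apply, apply_mem_iff hf, ← hker]
  simp

theorem coe_mul {S T : Subgroup X} (hS : S ≤ P) (hT : T ≤ P) {B : Subgroup X}
    (h : (B : Set X) = (S : Set X) * (T : Set X)) :
    (partialMap f B : Set G') = (partialMap f S : Set G') * (partialMap f T : Set G') := by
  ext y
  constructor
  · intro hy
    obtain ⟨x, hx, hxB, rfl⟩ := mem.1 hy
    have hxB' : x ∈ (B : Set X) := hxB
    rw [h] at hxB'
    obtain ⟨s, hs, t, ht, rfl⟩ := hxB'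
    exact ⟨f ⟨s, hS hs⟩, mem.2 ⟨s, hS hs, hs, rfl⟩, f ⟨t, hT ht⟩, mem.2 ⟨t, hT ht, ht, rfl⟩,
      (f.map_mul ⟨s, hS hs⟩ ⟨t, hT ht⟩).symm⟩
  · rintro ⟨_, hs', _, ht', rfl⟩
    obtain ⟨s, hs, hsS, rfl⟩ := mem.1 hs'
    obtain ⟨t, ht, htT, rfl⟩ := mem.1 ht'
    refine mem.2 ⟨s * t, P.mul_mem hs ht, ?_, f.map_mul ⟨s, hs⟩ ⟨t, ht⟩⟩
    have : s * t ∈ (B : Set X) := h ▸ Set.mul_mem_mul hsS htT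
    exact this

end partialMap

/-! ### Recognition lemmas -/

/-- An element of a normal p-subgroup has p-power order, so it is a power of its own k-th power
whenever k is prime to p. Hence it lies in N. -/
theorem pCore_eq_of_pow_mem {G : Type*} [Group G] {p : ℕ} {P N : Subgroup G} (hN : IsNormalIn N P)
    (hp : IsPGroup p N) (h : ∀ g ∈ P, ∃ k : ℕ, k.Coprime p ∧ g ^ k ∈ N) : pCore p P = N := by
  refine le_antisymm (sSup_le fun M hM g hg => ?_) (le_sSup ⟨hN, hp⟩)
  obtain ⟨k, hk, hkN⟩ := h g (hM.1.1 hg)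
  obtain ⟨n, hn⟩ := hM.2 ⟨g, hg⟩
  have hn' : g ^ p ^ n = 1 := congrArg Subtype.val hn
  have hcop : k.Coprime (orderOf g) :=
    (Nat.Coprime.pow_right n hk).coprime_dvd_right (orderOf_dvd_of_pow_eq_one hn')
  obtain ⟨m, hm⟩ := exists_pow_eq_self_of_coprime hcop
  rw [← hm]
  exact N.pow_mem hkN m

/-- Such a group is a vector space over `ZMod p`, and its order determines the dimension. -/
theorem nonempty_mulEquiv_elemAb {G : Type*} [Group G] {p k : ℕ} [hp : Fact p.Prime]
    (hcomm : ∀ a b : G, a * b = b * a) (hexp : ∀ a : G, a ^ p = 1) (hcard : Nat.card G = p ^ k) :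
    Nonempty (G ≃* ElemAb p k) := by
  let : CommGroup G := { mul_comm := hcomm }
  let : Module (ZMod p) (Additive G) := AddCommGroup.zmodModule (n := p) fun x => hexp x.toMul
  have hfin : Finite (Additive G) := by
    apply Nat.finite_of_card_ne_zero
    change Nat.card G ≠ 0
    rw [hcard]; exact pow_ne_zero _ hp.out.ne_zero
  have hrank : Module.finrank (ZMod p) (Additive G) = k := by
    have h := Module.natCard_eq_pow_finrank (K := ZMod p) (V := Additive G)
    have h' : Nat.card (Additive G) = p ^ k := hcard
    rw [h', Nat.card_zmod] at h
    exact (Nat.pow_right_injective hp.out.two_le h).symm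
  have e : Additive G ≃ₗ[ZMod p] (Fin k → ZMod p) :=
    LinearEquiv.ofFinrankEq _ _ (by simp [hrank])
  exact ⟨(AddEquiv.toMultiplicative e.toAddEquiv :
    Multiplicative (Additive G) ≃* Multiplicative (Fin k → ZMod p))⟩

/-! ### Internal semidirect products -/

section InternalProduct

variable {X A : Type*} [Group X] [Group A] (Z P : Subgroup X) (F : A →* X)

/-- `P` is the internal semidirect product of its normal subgroup `Z` and of the image of the
homomorphism `F`, which is injective. -/
structure IsSplit : Prop where
  le : Z ≤ P
  range_le : ∀ a, F a ∈ P
  conj_mem : ∀ a, ∀ z ∈ Z, F a * z * (F a)⁻¹ ∈ Z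
  disjoint : ∀ a, F a ∈ Z → a = 1
  exists_mul : ∀ x ∈ P, ∃ z ∈ Z, ∃ a, x = z * F a

variable {Z P F}

namespace IsSplit

/-- The conjugation action of the complement. -/
def conjAct (h : IsSplit Z P F) : A →* MulAut Z where
  toFun a :=
    { toFun := fun z => ⟨F a * z * (F a)⁻¹, h.conj_mem a z z.2⟩
      invFun := fun z => ⟨F a⁻¹ * z * (F a⁻¹)⁻¹, h.conj_mem a⁻¹ z z.2⟩
      left_inv := fun z => by ext; simp [mul_assoc]
      right_inv := fun z => by ext; simp [mul_assoc]
      map_mul' := fun z w => by ext; simp [mul_assoc] }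
  map_one' := by ext; simp
  map_mul' a b := by ext; simp [mul_assoc]

theorem conjAct_apply (h : IsSplit Z P F) (a : A) (z : Z) :
    (h.conjAct a z : X) = F a * z * (F a)⁻¹ := rfl

/-- The homomorphism from the external to the internal product. -/
def toHom (h : IsSplit Z P F) : Z ⋊[h.conjAct] A →* P where
  toFun x := ⟨x.left * F x.right, P.mul_mem (h.le x.left.2) (h.range_le _)⟩
  map_one' := by ext; simp
  map_mul' x y := by
    ext
    simp [conjAct_apply, mul_assoc]

theorem toHom_bijective (h : IsSplit Z P F) : Function.Bijective h.toHom := by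
  constructor
  · rw [injective_iff_map_eq_one]
    intro x hx
    have hx' : (x.left : X) * F x.right = 1 := congrArg Subtype.val hx
    have h1 : x.right = 1 := by
      apply h.disjoint
      have : F x.right = ((x.left)⁻¹ : Z) := by
        rw [Subgroup.coe_inv]; exact eq_inv_of_mul_eq_one_right hx'
      rw [this]; exact Subtype.property _
    ext
    · simpa [h1] using hx'
    · exact h1
  · rintro ⟨x, hx⟩
    obtain ⟨z, hz, a, rfl⟩ := h.exists_mul x hx
    exact ⟨⟨⟨z, hz⟩, a⟩, rfl⟩

/-- `P` is isomorphic to the semidirect product. -/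
noncomputable def mulEquiv (h : IsSplit Z P F) : Z ⋊[h.conjAct] A ≃* P :=
  MulEquiv.ofBijective h.toHom h.toHom_bijective

theorem nonempty_semidirect_of_equiv (h : IsSplit Z P F) {Z' : Type*} [Group Z'] (e : Z ≃* Z') :
    ∃ φ : A →* MulAut Z', Nonempty (P ≃* Z' ⋊[φ] A) := by
  refine ⟨(MulAut.congr e).toMonoidHom.comp h.conjAct, ⟨h.mulEquiv.symm.trans
    (SemidirectProduct.congr e (MulEquiv.refl A) ?_)⟩⟩
  intro a
  ext z
  simp [MulAut.congr]

theorem nonempty_prod (h : IsSplit Z P F) (hc : ∀ a, ∀ z ∈ Z, F a * z = z * F a) {Z' : Type*}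
    [Group Z'] (e : Z ≃* Z') : Nonempty (P ≃* Z' × A) := by
  have h1 : h.conjAct = 1 := by
    ext a z
    simp [conjAct_apply, hc a z z.2]
  have e1 : Z ⋊[h.conjAct] A ≃* Z × A := by
    rw [h1]; exact SemidirectProduct.mulEquivProd
  exact ⟨h.mulEquiv.symm.trans (e1.trans (e.prodCongr (MulEquiv.refl A)))⟩

theorem quotientIso (h : IsSplit Z P F) : QuotientIso P Z A := by
  refine quotientIso_of_hom h.le
    (SemidirectProduct.rightHom.comp h.mulEquiv.symm.toMonoidHom)
    (SemidirectProduct.rightHom_surjective.comp h.mulEquiv.symm.surjective) fun x => ?_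
  obtain ⟨x, rfl⟩ := h.mulEquiv.surjective x
  have : (h.mulEquiv x : X) = x.left * F x.right := rfl
  rw [this, Subgroup.mul_mem_cancel_left _ x.left.2]
  simp only [MonoidHom.comp_apply, MulEquiv.coe_toMonoidHom, MulEquiv.symm_apply_apply,
    SemidirectProduct.rightHom_eq_right]
  exact ⟨fun h' => by rw [h', map_one]; exact Z.one_mem, h.disjoint _⟩

end IsSplit

end InternalProduct

/-! ### Unique normal subgroups -/

/-- The power of g to the index lies in N, and g is a power of it since the index is prime to the
order of g. -/
theorem mem_of_pow_three_eq_one {G : Type*} [Group G] {N : Subgroup G} (hN : N.Normal)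
    (hd : N.index.Coprime 3) {g : G} (hg : g ^ 3 = 1) : g ∈ N := by
  have hcop : N.index.Coprime (orderOf g) :=
    hd.coprime_dvd_right (orderOf_dvd_of_pow_eq_one hg)
  obtain ⟨m, hm⟩ := exists_pow_eq_self_of_coprime hcop
  rw [← hm]
  exact N.pow_mem (N.pow_index_mem g) m

/-- Once every normal subgroup of index d contains the kernel, these subgroups correspond to
subgroups of index d in a cyclic group, where there is only one. -/
theorem isTheNormalSubgroup_comap_pow {G C : Type*} [Group G] [CommGroup C] [IsCyclic C] [Finite C]
    (f : G →* C) (hf : Function.Surjective f) {d : ℕ} (hd : d ∣ Nat.card C)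
    (h : ∀ N : Subgroup G, N.Normal → N.index = d → f.ker ≤ N) :
    IsTheNormalSubgroup ((powMonoidHom d : C →* C).range.comap f) d := by
  have hidx : (powMonoidHom d : C →* C).range.index = d := by
    rw [Subgroup.index_range, IsCyclic.card_powMonoidHom_ker, Nat.gcd_eq_right hd]
  have hpos : d ≠ 0 := by
    rintro rfl
    exact Nat.card_pos.ne' (zero_dvd_iff.1 hd)
  refine ⟨inferInstance, by rw [Subgroup.index_comap_of_surjective _ hf, hidx], ?_⟩
  intro N hN hNd
  have hker := h N hN hNd
  have hcm : (N.map f).comap f = N := by rw [Subgroup.comap_map_eq, sup_eq_left.2 hker]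
  have hi : (N.map f).index = d := by
    rw [← Subgroup.index_comap_of_surjective _ hf, hcm, hNd]
  rw [← hcm]
  congr 1
  -- A subgroup of index d contains all d-th powers; equality then follows by comparing orders.
  have hle : (powMonoidHom d : C →* C).range ≤ N.map f := by
    rintro _ ⟨x, rfl⟩
    have := (N.map f).pow_index_mem x
    rwa [hi] at this
  refine (Subgroup.eq_of_le_of_card_ge hle ?_).symm
  have h1 := Subgroup.card_mul_index (N.map f)
  have h2 := Subgroup.card_mul_index (powMonoidHom d : C →* C).range
  rw [hi] at h1
  rw [hidx, ← h1] at h2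
  exact (Nat.eq_of_mul_eq_mul_right (Nat.pos_of_ne_zero hpos) h2).ge

theorem IsTheNormalSubgroup.map_equiv {G G' : Type*} [Group G] [Group G'] {N : Subgroup G} {d : ℕ}
    (h : IsTheNormalSubgroup N d) (e : G ≃* G') :
    IsTheNormalSubgroup (N.map e.toMonoidHom) d := by
  obtain ⟨h1, h2, h3⟩ := h
  refine ⟨h1.map _ e.surjective, ?_, fun N' hN' hd => ?_⟩
  · rw [← h2]; exact Subgroup.index_map_equiv N e
  · have := h3 (N'.comap e.toMonoidHom) (hN'.comap _)
      (by rw [Subgroup.index_comap_of_surjective _ e.surjective, hd])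
    rw [← this, Subgroup.map_comap_eq_self_of_surjective e.surjective]

/-! ### Coset graphs -/

section CosetGraph

variable {G : Type} [Group G] (Q₁ Q₂ : Subgroup G)

/-- The bipartite graph on the cosets of `Q₁` and `Q₂`, adjacent if they meet. -/
def bicosetGraph : SimpleGraph ((G ⧸ Q₁) ⊕ (G ⧸ Q₂)) :=
  SimpleGraph.fromRel fun a b => ∃ g : G,
    a = Sum.inl (QuotientGroup.mk g) ∧ b = Sum.inr (QuotientGroup.mk g)

variable {Q₁ Q₂}

namespace bicosetGraph

theorem adj_mk (g : G) : (bicosetGraph Q₁ Q₂).Adj (Sum.inl g) (Sum.inr g) := by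
  simp only [bicosetGraph, SimpleGraph.fromRel_adj]
  exact ⟨by simp, Or.inl ⟨g, rfl, rfl⟩⟩

theorem exists_of_adj_inl {g : G} {y} (h : (bicosetGraph Q₁ Q₂).Adj (Sum.inl g) y) :
    ∃ q ∈ Q₁, y = Sum.inr ((g * q : G) : G ⧸ Q₂) := by
  simp only [bicosetGraph, SimpleGraph.fromRel_adj] at h
  rcases h with ⟨-, ⟨k, hk, rfl⟩ | ⟨k, -, hk⟩⟩
  · refine ⟨g⁻¹ * k, QuotientGroup.eq.1 (Sum.inl.inj hk), by simp⟩
  · cases hk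

theorem exists_of_adj_inr {g : G} {y} (h : (bicosetGraph Q₁ Q₂).Adj (Sum.inr g) y) :
    ∃ q ∈ Q₂, y = Sum.inl ((g * q : G) : G ⧸ Q₁) := by
  simp only [bicosetGraph, SimpleGraph.fromRel_adj] at h
  rcases h with ⟨-, ⟨k, hk, -⟩ | ⟨k, rfl, hk⟩⟩
  · cases hk
  · refine ⟨g⁻¹ * k, QuotientGroup.eq.1 (Sum.inr.inj hk), by simp⟩

theorem adj_mk_mul_right (g : G) {q : G} (hq : q ∈ Q₁) :
    (bicosetGraph Q₁ Q₂).Adj (Sum.inl g) (Sum.inr ((g * q : G) : G ⧸ Q₂)) := by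
  have : (g : G ⧸ Q₁) = ((g * q : G) : G ⧸ Q₁) := QuotientGroup.eq.2 (by simpa using hq)
  rw [this]
  exact adj_mk _

theorem adj_mk_mul_left (g : G) {q : G} (hq : q ∈ Q₂) :
    (bicosetGraph Q₁ Q₂).Adj (Sum.inr g) (Sum.inl ((g * q : G) : G ⧸ Q₁)) := by
  have : (g : G ⧸ Q₂) = ((g * q : G) : G ⧸ Q₂) := QuotientGroup.eq.2 (by simpa using hq)
  rw [this]
  exact (adj_mk _).symm

variable (Q₁ Q₂) in
/-- The action of the group on the coset graph. -/
def act : G →* (bicosetGraph Q₁ Q₂ ≃g bicosetGraph Q₁ Q₂) where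
  toFun g :=
    { toEquiv := Equiv.sumCongr (MulAction.toPerm g) (MulAction.toPerm g)
      map_rel_iff' := by
        have key : ∀ (g : G) (a b), (bicosetGraph Q₁ Q₂).Adj a b → (bicosetGraph Q₁ Q₂).Adj
            (Equiv.sumCongr (MulAction.toPerm g) (MulAction.toPerm g) a)
            (Equiv.sumCongr (MulAction.toPerm g) (MulAction.toPerm g) b) := by
          intro g a b h
          rcases a with a | a <;> obtain ⟨a, rfl⟩ := QuotientGroup.mk_surjective a
          · obtain ⟨q, hq, rfl⟩ := exists_of_adj_inl h
            have := adj_mk_mul_right (Q₂ := Q₂) (g * a) hq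
            rw [mul_assoc] at this
            exact this
          · obtain ⟨q, hq, rfl⟩ := exists_of_adj_inr h
            have := adj_mk_mul_left (Q₁ := Q₁) (g * a) hq
            rw [mul_assoc] at this
            exact this
        intro a b
        refine ⟨fun h => ?_, key g a b⟩
        have := key g⁻¹ _ _ h
        rcases a with a | a <;> rcases b with b | b <;> simpa using this }
  map_one' := by
    ext a
    rcases a with a | a
    · exact congrArg Sum.inl (one_smul G a)
    · exact congrArg Sum.inr (one_smul G a)
  map_mul' g h := by
    ext a
    rcases a with a | a
    · exact congrArg Sum.inl (mul_smul g h a)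
    · exact congrArg Sum.inr (mul_smul g h a)

theorem act_inl (g h : G) :
    act Q₁ Q₂ g (Sum.inl (h : G ⧸ Q₁)) = Sum.inl ((g * h : G) : G ⧸ Q₁) := rfl

theorem act_inr (g h : G) :
    act Q₁ Q₂ g (Sum.inr (h : G ⧸ Q₂)) = Sum.inr ((g * h : G) : G ⧸ Q₂) := rfl

/-- The kernel of the action is the intersection of all conjugates of the two subgroups. -/
theorem act_injective (hcore : ∀ g : G, (∀ h, h⁻¹ * g * h ∈ Q₁ ⊓ Q₂) → g = 1) :
    Function.Injective (act Q₁ Q₂) := by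
  rw [injective_iff_map_eq_one]
  intro g hg
  refine hcore g fun h => ⟨?_, ?_⟩
  · have h1 : act Q₁ Q₂ g (Sum.inl (h : G ⧸ Q₁)) = Sum.inl (h : G ⧸ Q₁) := by rw [hg]; rfl
    rw [act_inl, Sum.inl.injEq, eq_comm, QuotientGroup.eq] at h1
    rwa [mul_assoc]
  · have h1 : act Q₁ Q₂ g (Sum.inr (h : G ⧸ Q₂)) = Sum.inr (h : G ⧸ Q₂) := by rw [hg]; rfl
    rw [act_inr, Sum.inr.injEq, eq_comm, QuotientGroup.eq] at h1
    rwa [mul_assoc]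

theorem reachable_act (a b) (g : G) (h : (bicosetGraph Q₁ Q₂).Reachable a b) :
    (bicosetGraph Q₁ Q₂).Reachable (act Q₁ Q₂ g a) (act Q₁ Q₂ g b) :=
  h.map (act Q₁ Q₂ g).toHom

/-- A generator from `Q₁` fixes the base coset of `Q₁`, and one from `Q₂` moves it to a coset with a
common neighbour. Translating such walks handles products and inverses. -/
theorem connected (htop : Q₁ ⊔ Q₂ = ⊤) : (bicosetGraph Q₁ Q₂).Connected := by
  have key : ∀ g : G, (bicosetGraph Q₁ Q₂).Reachable (Sum.inl ((1 : G) : G ⧸ Q₁))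
      (Sum.inl (g : G ⧸ Q₁)) := by
    intro g
    have hg : g ∈ Q₁ ⊔ Q₂ := htop ▸ Subgroup.mem_top g
    rw [Subgroup.sup_eq_closure] at hg
    induction hg using Subgroup.closure_induction with
    | mem x hx =>
      rcases hx with hx | hx
      · have : (x : G ⧸ Q₁) = ((1 : G) : G ⧸ Q₁) := QuotientGroup.eq.2 (by simpa using hx)
        rw [this]
      · refine (adj_mk (1 : G)).reachable.trans ?_
        simpa using (adj_mk_mul_left (Q₁ := Q₁) (1 : G) hx).reachable
    | one => exact SimpleGraph.Reachable.refl _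
    | mul x y _ _ hx hy =>
      refine hx.trans ?_
      simpa [act_inl] using reachable_act _ _ x hy
    | inv x _ hx =>
      have := (reachable_act _ _ x⁻¹ hx).symm
      rwa [act_inl, act_inl, inv_mul_cancel, mul_one] at this
  rw [SimpleGraph.connected_iff_exists_forall_reachable]
  refine ⟨Sum.inl ((1 : G) : G ⧸ Q₁), fun w => ?_⟩
  rcases w with w | w <;> obtain ⟨w, rfl⟩ := QuotientGroup.mk_surjective w
  · exact key w
  · exact (key w).trans (adj_mk w).reachable

theorem vertexStab_inl :
    vertexStab (act Q₁ Q₂).range (Sum.inl ((1 : G) : G ⧸ Q₁)) = Q₁.map (act Q₁ Q₂) := by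
  ext x
  constructor
  · rintro ⟨⟨g, rfl⟩, hg⟩
    refine ⟨g, ?_, rfl⟩
    have h1 : act Q₁ Q₂ g (Sum.inl ((1 : G) : G ⧸ Q₁)) = Sum.inl ((1 : G) : G ⧸ Q₁) := hg
    rw [act_inl, Sum.inl.injEq, eq_comm, QuotientGroup.eq] at h1
    simpa using h1
  · rintro ⟨g, hg, rfl⟩
    refine ⟨⟨g, rfl⟩, ?_⟩
    change act Q₁ Q₂ g (Sum.inl ((1 : G) : G ⧸ Q₁)) = Sum.inl ((1 : G) : G ⧸ Q₁)
    rw [act_inl, Sum.inl.injEq, eq_comm, QuotientGroup.eq]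
    simpa using hg

theorem vertexStab_inr :
    vertexStab (act Q₁ Q₂).range (Sum.inr ((1 : G) : G ⧸ Q₂)) = Q₂.map (act Q₁ Q₂) := by
  ext x
  constructor
  · rintro ⟨⟨g, rfl⟩, hg⟩
    refine ⟨g, ?_, rfl⟩
    have h1 : act Q₁ Q₂ g (Sum.inr ((1 : G) : G ⧸ Q₂)) = Sum.inr ((1 : G) : G ⧸ Q₂) := hg
    rw [act_inr, Sum.inr.injEq, eq_comm, QuotientGroup.eq] at h1
    simpa using h1
  · rintro ⟨g, hg, rfl⟩
    refine ⟨⟨g, rfl⟩, ?_⟩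
    change act Q₁ Q₂ g (Sum.inr ((1 : G) : G ⧸ Q₂)) = Sum.inr ((1 : G) : G ⧸ Q₂)
    rw [act_inr, Sum.inr.injEq, eq_comm, QuotientGroup.eq]
    simpa using hg

theorem neighborSet_inl : (bicosetGraph Q₁ Q₂).neighborSet (Sum.inl ((1 : G) : G ⧸ Q₁)) =
    {y | ∃ q ∈ Q₁, y = Sum.inr (q : G ⧸ Q₂)} := by
  ext y
  constructor
  · intro h
    obtain ⟨q, hq, rfl⟩ := exists_of_adj_inl h
    exact ⟨q, hq, by rw [one_mul]⟩
  · rintro ⟨q, hq, rfl⟩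
    simpa using adj_mk_mul_right (Q₂ := Q₂) (1 : G) hq

theorem neighborSet_inr : (bicosetGraph Q₁ Q₂).neighborSet (Sum.inr ((1 : G) : G ⧸ Q₂)) =
    {y | ∃ q ∈ Q₂, y = Sum.inl (q : G ⧸ Q₁)} := by
  ext y
  constructor
  · intro h
    obtain ⟨q, hq, rfl⟩ := exists_of_adj_inr h
    exact ⟨q, hq, by rw [one_mul]⟩
  · rintro ⟨q, hq, rfl⟩
    simpa using adj_mk_mul_left (Q₁ := Q₁) (1 : G) hq

theorem ncard_orbit_quotient (P Q : Subgroup G) :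
    {y : G ⧸ Q | ∃ q ∈ P, y = (q : G ⧸ Q)}.ncard = Q.relIndex P := by
  have h := MulAction.index_stabilizer P ((1 : G) : G ⧸ Q)
  have h1 : MulAction.stabilizer P ((1 : G) : G ⧸ Q) = Q.subgroupOf P := by
    ext ⟨x, hx⟩
    rw [MulAction.mem_stabilizer_iff, Subgroup.mem_subgroupOf]
    change ((x * 1 : G) : G ⧸ Q) = ((1 : G) : G ⧸ Q) ↔ x ∈ Q
    rw [eq_comm, QuotientGroup.eq]
    simp
  rw [h1] at h
  rw [Subgroup.relIndex, h]
  congr 1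
  ext y
  constructor
  · rintro ⟨q, hq, rfl⟩
    exact ⟨⟨q, hq⟩, congrArg QuotientGroup.mk (mul_one q)⟩
  · rintro ⟨⟨q, hq⟩, rfl⟩
    exact ⟨q, hq, congrArg QuotientGroup.mk (mul_one q)⟩

theorem ncard_neighborSet_inl :
    ((bicosetGraph Q₁ Q₂).neighborSet (Sum.inl ((1 : G) : G ⧸ Q₁))).ncard = Q₂.relIndex Q₁ := by
  rw [neighborSet_inl, ← ncard_orbit_quotient Q₁ Q₂]
  refine Eq.trans ?_ (Set.ncard_image_of_injective _ (Sum.inr_injective (α := G ⧸ Q₁)))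
  refine congrArg Set.ncard (Set.ext fun y => ?_)
  constructor
  · rintro ⟨q, hq, rfl⟩
    exact ⟨q, ⟨q, hq, rfl⟩, rfl⟩
  · rintro ⟨_, ⟨q, hq, rfl⟩, rfl⟩
    exact ⟨q, hq, rfl⟩

theorem ncard_neighborSet_inr :
    ((bicosetGraph Q₁ Q₂).neighborSet (Sum.inr ((1 : G) : G ⧸ Q₂))).ncard = Q₁.relIndex Q₂ := by
  rw [neighborSet_inr, ← ncard_orbit_quotient Q₂ Q₁]
  refine Eq.trans ?_ (Set.ncard_image_of_injective _ (Sum.inl_injective (β := G ⧸ Q₂)))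
  refine congrArg Set.ncard (Set.ext fun y => ?_)
  constructor
  · rintro ⟨q, hq, rfl⟩
    exact ⟨q, ⟨q, hq, rfl⟩, rfl⟩
  · rintro ⟨_, ⟨q, hq, rfl⟩, rfl⟩
    exact ⟨q, hq, rfl⟩

/-- The elements on the right form a subgroup normal in P, namely the intersection of P with the
P-conjugates of D. Membership can thus be tested on well-chosen single conjugates. -/
theorem mem_largestNormal_iff {D P : Subgroup G} {g : G} :
    g ∈ largestNormal D P ↔ g ∈ P ∧ ∀ q ∈ P, q⁻¹ * g * q ∈ D := by
  let N : Subgroup G :=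
    { carrier := {g | g ∈ P ∧ ∀ q ∈ P, q⁻¹ * g * q ∈ D}
      one_mem' := ⟨P.one_mem, fun q _ => by simp [D.one_mem]⟩
      mul_mem' := by
        rintro a b ⟨ha, ha'⟩ ⟨hb, hb'⟩
        refine ⟨P.mul_mem ha hb, fun q hq => ?_⟩
        have := D.mul_mem (ha' q hq) (hb' q hq)
        simpa [mul_assoc] using this
      inv_mem' := by
        rintro a ⟨ha, ha'⟩
        refine ⟨P.inv_mem ha, fun q hq => ?_⟩
        have := D.inv_mem (ha' q hq)
        simpa [mul_assoc] using this }
  have hND : N ≤ D := fun x hx => by simpa using hx.2 1 P.one_mem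
  have hN : N ≤ D ∧ IsNormalIn N P := by
    refine ⟨hND, fun x hx => hx.1, fun h hh x hx => ⟨?_, fun q hq => ?_⟩⟩
    · exact P.mul_mem (P.mul_mem hh hx.1) (P.inv_mem hh)
    · have := hx.2 (h⁻¹ * q) (P.mul_mem (P.inv_mem hh) hq)
      simpa [mul_assoc] using this
  have heq : largestNormal D P = N := by
    refine le_antisymm (sSup_le fun M hM x hx => ⟨hM.2.1 hx, fun q hq => ?_⟩) (le_sSup hN)
    have := hM.2.2 q⁻¹ (P.inv_mem hq) x hx
    rw [inv_inv] at this
    exact hM.1 this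
  rw [heq]
  rfl

/-- An element fixes every neighbour qQ₂ with q ∈ Q₁ exactly when all its Q₁-conjugates lie in Q₂.
-/
theorem localKernel_inl : localKernel (act Q₁ Q₂).range (Sum.inl ((1 : G) : G ⧸ Q₁)) =
    (largestNormal (Q₁ ⊓ Q₂) Q₁).map (act Q₁ Q₂) := by
  ext x
  unfold localKernel
  rw [vertexStab_inl, neighborSet_inl]
  simp only [Subgroup.mem_inf, Subgroup.mem_iInf, Subgroup.mem_map,
    mem_largestNormal_iff, Set.mem_ofPred_eq]
  constructor
  · rintro ⟨⟨g, hg, rfl⟩, h⟩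
    refine ⟨g, ⟨hg, fun q hq => ⟨Q₁.mul_mem (Q₁.mul_mem (Q₁.inv_mem hq) hg) hq, ?_⟩⟩, rfl⟩
    have h1 : act Q₁ Q₂ g (Sum.inr (q : G ⧸ Q₂)) = Sum.inr (q : G ⧸ Q₂) := h _ ⟨q, hq, rfl⟩
    rw [act_inr, Sum.inr.injEq, eq_comm, QuotientGroup.eq] at h1
    rwa [mul_assoc]
  · rintro ⟨g, ⟨hg, h⟩, rfl⟩
    refine ⟨⟨g, hg, rfl⟩, ?_⟩
    rintro _ ⟨q, hq, rfl⟩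
    change act Q₁ Q₂ g (Sum.inr (q : G ⧸ Q₂)) = Sum.inr (q : G ⧸ Q₂)
    rw [act_inr, Sum.inr.injEq, eq_comm, QuotientGroup.eq, ← mul_assoc]
    exact (h q hq).2

theorem localKernel_inr : localKernel (act Q₁ Q₂).range (Sum.inr ((1 : G) : G ⧸ Q₂)) =
    (largestNormal (Q₁ ⊓ Q₂) Q₂).map (act Q₁ Q₂) := by
  ext x
  unfold localKernel
  rw [vertexStab_inr, neighborSet_inr]
  simp only [Subgroup.mem_inf, Subgroup.mem_iInf, Subgroup.mem_map,
    mem_largestNormal_iff, Set.mem_ofPred_eq]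
  constructor
  · rintro ⟨⟨g, hg, rfl⟩, h⟩
    refine ⟨g, ⟨hg, fun q hq => ⟨?_, Q₂.mul_mem (Q₂.mul_mem (Q₂.inv_mem hq) hg) hq⟩⟩, rfl⟩
    have h1 : act Q₁ Q₂ g (Sum.inl (q : G ⧸ Q₁)) = Sum.inl (q : G ⧸ Q₁) := h _ ⟨q, hq, rfl⟩
    rw [act_inl, Sum.inl.injEq, eq_comm, QuotientGroup.eq] at h1
    rwa [mul_assoc]
  · rintro ⟨g, ⟨hg, h⟩, rfl⟩
    refine ⟨⟨g, hg, rfl⟩, ?_⟩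
    rintro _ ⟨q, hq, rfl⟩
    change act Q₁ Q₂ g (Sum.inl (q : G ⧸ Q₁)) = Sum.inl (q : G ⧸ Q₁)
    rw [act_inl, Sum.inl.injEq, eq_comm, QuotientGroup.eq, ← mul_assoc]
    exact (h q hq).1

end bicosetGraph

end CosetGraph

/-! ### Conjugate vertices -/

section Conjugate

variable {V : Type} {Γ : SimpleGraph V} {H : Subgroup (Γ ≃g Γ)}

theorem vertexStab_apply {h : Γ ≃g Γ} (hh : h ∈ H) (z : V) :
    vertexStab H (h z) = (vertexStab H z).map (MulAut.conj h).toMonoidHom := by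
  ext x
  constructor
  · rintro ⟨hx, hxz⟩
    refine ⟨h⁻¹ * x * h, ⟨H.mul_mem (H.mul_mem (H.inv_mem hh) hx) hh, ?_⟩, by simp [mul_assoc]⟩
    have h1 : x (h z) = h z := hxz
    change h⁻¹ (x (h z)) = z
    rw [h1]
    exact h.symm_apply_apply z
  · rintro ⟨y, ⟨hy, hyz⟩, rfl⟩
    refine ⟨H.mul_mem (H.mul_mem hh hy) (H.inv_mem hh), ?_⟩
    have h1 : y z = z := hyz
    change h (y (h.symm (h z))) = h z
    rw [h.symm_apply_apply, h1]

theorem localKernel_apply {h : Γ ≃g Γ} (hh : h ∈ H) (z : V) :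
    localKernel H (h z) = (localKernel H z).map (MulAut.conj h).toMonoidHom := by
  ext x
  unfold localKernel
  rw [vertexStab_apply hh]
  simp only [Subgroup.mem_inf, Subgroup.mem_iInf, Subgroup.mem_map]
  constructor
  · rintro ⟨⟨y, hy, rfl⟩, hx⟩
    refine ⟨y, ⟨hy, fun u hu => ?_⟩, rfl⟩
    have h1 : h (y (h.symm (h u))) = h u := hx (h u) (h.map_adj_iff.2 hu)
    rw [h.symm_apply_apply] at h1
    exact h.injective h1
  · rintro ⟨y, ⟨hy, hx⟩, rfl⟩
    refine ⟨⟨y, hy, rfl⟩, fun u hu => ?_⟩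
    have h1 : y (h.symm u) = h.symm u := hx (h.symm u) (by
      rw [SimpleGraph.mem_neighborSet] at hu ⊢
      rw [← h.map_adj_iff]
      simpa using hu)
    change h (y (h.symm u)) = u
    rw [h1, h.apply_symm_apply]

/-- Reduces local characteristic p to one vertex from each orbit of H. -/
theorem localChar_apply {p : ℕ} {h : Γ ≃g Γ} (hh : h ∈ H) (z : V)
    (hz : vertexStab H z ⊓ Subgroup.centralizer (pCore p (localKernel H z) : Set (Γ ≃g Γ)) ≤
      pCore p (localKernel H z)) :
    vertexStab H (h z) ⊓ Subgroup.centralizer (pCore p (localKernel H (h z)) : Set (Γ ≃g Γ)) ≤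
      pCore p (localKernel H (h z)) := by
  have hinj : Function.Injective (MulAut.conj h).toMonoidHom := (MulAut.conj h).injective
  rw [localKernel_apply hh, vertexStab_apply hh, pCore_map hinj, map_inf_centralizer hinj]
  exact Subgroup.map_mono hz

end Conjugate

/-! ### Local characteristic and arcs in coset graphs -/

namespace bicosetGraph

variable {G : Type} [Group G] {Q₁ Q₂ : Subgroup G}

theorem localChar {p : ℕ} (hinj : Function.Injective (act Q₁ Q₂))
    (h₁ : Q₁ ⊓ Subgroup.centralizer (pCore p (largestNormal (Q₁ ⊓ Q₂) Q₁) : Set G) ≤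
      pCore p (largestNormal (Q₁ ⊓ Q₂) Q₁))
    (h₂ : Q₂ ⊓ Subgroup.centralizer (pCore p (largestNormal (Q₁ ⊓ Q₂) Q₂) : Set G) ≤
      pCore p (largestNormal (Q₁ ⊓ Q₂) Q₂)) :
    LocalChar (act Q₁ Q₂).range p := by
  intro z
  rcases z with g | g <;> obtain ⟨g, rfl⟩ := QuotientGroup.mk_surjective g
  · have : (Sum.inl (g : G ⧸ Q₁) : (G ⧸ Q₁) ⊕ (G ⧸ Q₂)) =
        act Q₁ Q₂ g (Sum.inl ((1 : G) : G ⧸ Q₁)) := by rw [act_inl, mul_one]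
    rw [this]
    refine localChar_apply (MonoidHom.mem_range.2 ⟨g, rfl⟩) _ ?_
    rw [vertexStab_inl, localKernel_inl, pCore_map hinj, map_inf_centralizer hinj]
    exact Subgroup.map_mono h₁
  · have : (Sum.inr (g : G ⧸ Q₂) : (G ⧸ Q₁) ⊕ (G ⧸ Q₂)) =
        act Q₁ Q₂ g (Sum.inr ((1 : G) : G ⧸ Q₂)) := by rw [act_inr, mul_one]
    rw [this]
    refine localChar_apply (MonoidHom.mem_range.2 ⟨g, rfl⟩) _ ?_
    rw [vertexStab_inr, localKernel_inr, pCore_map hinj, map_inf_centralizer hinj]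
    exact Subgroup.map_mono h₂

/-- The neighbours of the base coset are the qQ₂ with q ∈ Q₁, and the p-core of the kernel at qQ₂ is
the q-conjugate of the one at Q₂. -/
theorem groupL_inl (hinj : Function.Injective (act Q₁ Q₂)) (p : ℕ) :
    groupL (act Q₁ Q₂).range p (Sum.inl ((1 : G) : G ⧸ Q₁)) =
      (conjClosure (pCore p (largestNormal (Q₁ ⊓ Q₂) Q₂)) Q₁ ⊔
        pCore p (largestNormal (Q₁ ⊓ Q₂) Q₁)).map (act Q₁ Q₂) := by
  unfold groupL
  rw [localKernel_inl, pCore_map hinj, Subgroup.map_sup]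
  congr 1
  have hk : ∀ q : G, pCore p (localKernel (act Q₁ Q₂).range (Sum.inr (q : G ⧸ Q₂))) =
      ((pCore p (largestNormal (Q₁ ⊓ Q₂) Q₂)).map (act Q₁ Q₂)).map
        (MulAut.conj (act Q₁ Q₂ q)).toMonoidHom := by
    intro q
    have : (Sum.inr (q : G ⧸ Q₂) : (G ⧸ Q₁) ⊕ (G ⧸ Q₂)) =
        act Q₁ Q₂ q (Sum.inr ((1 : G) : G ⧸ Q₂)) := by rw [act_inr, mul_one]
    rw [this, localKernel_apply (MonoidHom.mem_range.2 ⟨q, rfl⟩), pCore_map (MulAut.conj (act Q₁ Q₂ q)).injective,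
      localKernel_inr, pCore_map hinj]
  rw [neighborSet_inl]
  apply le_antisymm
  · refine iSup₂_le ?_
    rintro _ ⟨q, hq, rfl⟩
    rw [hk]
    rintro _ ⟨_, ⟨x, hx, rfl⟩, rfl⟩
    refine ⟨q * x * q⁻¹, Subgroup.subset_closure ⟨q⁻¹, Q₁.inv_mem hq, x, hx, by simp⟩, by simp⟩
  · unfold conjClosure
    rw [MonoidHom.map_closure, Subgroup.closure_le]
    rintro _ ⟨_, ⟨q, hq, x, hx, rfl⟩, rfl⟩
    have : act Q₁ Q₂ (q⁻¹ * x * q) ∈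
        pCore p (localKernel (act Q₁ Q₂).range (Sum.inr ((q⁻¹ : G) : G ⧸ Q₂))) := by
      rw [hk]
      exact ⟨_, ⟨x, hx, rfl⟩, by simp⟩
    exact Subgroup.mem_iSup_of_mem _ (Subgroup.mem_iSup_of_mem ⟨q⁻¹, Q₁.inv_mem hq, rfl⟩ this)

/-- Elements witnessing that the arcs with six vertices are permuted transitively. -/
structure FiveArcData (Q₁ Q₂ : Subgroup G) (s t : G) : Prop where
  s_mem : s ∈ Q₁
  t_mem : t ∈ Q₂
  move₀ : ∀ h ∈ Q₂, h ∉ Q₁ → ∃ k ∈ Q₁ ⊓ Q₂, t⁻¹ * (k * h) ∈ Q₁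
  move₃ : ∀ h ∈ Q₁, h ∉ Q₂ → ∃ k ∈ Q₁ ⊓ Q₂, t⁻¹ * (k * t) ∈ Q₁ ∧ s⁻¹ * (k * h) ∈ Q₂
  move₄ : ∀ h ∈ Q₂, h ∉ Q₁ → ∃ k ∈ Q₁ ⊓ Q₂, t⁻¹ * (k * t) ∈ Q₁ ∧ s⁻¹ * (k * s) ∈ Q₂ ∧
    (s * t)⁻¹ * (k * (s * h)) ∈ Q₁
  move₅ : ∀ h ∈ Q₁, h ∉ Q₂ → ∃ k ∈ Q₁ ⊓ Q₂, t⁻¹ * (k * t) ∈ Q₁ ∧ s⁻¹ * (k * s) ∈ Q₂ ∧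
    (s * t)⁻¹ * (k * (s * t)) ∈ Q₁ ∧ (s * t * s)⁻¹ * (k * (s * t * h)) ∈ Q₂

theorem mk_eq_of_mul_eq {Q : Subgroup G} {a b : G} (h : a⁻¹ * b ∈ Q) : (b : G ⧸ Q) = a :=
  (QuotientGroup.eq.2 h).symm

/-- The inner edge x₁x₂ is moved to the base edge first. Then x₀, x₃, x₄, x₅ are corrected in this
order, each by an element of Q₁ ∩ Q₂ fixing the vertices already in place. -/
theorem FiveArcData.exists_act {s t : G} (hd : FiveArcData Q₁ Q₂ s t)
    {x : Fin 6 → (G ⧸ Q₁) ⊕ (G ⧸ Q₂)} (hx : IsSArc (bicosetGraph Q₁ Q₂) 5 x) {a : G ⧸ Q₁}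
    (ha : x 0 = Sum.inl a) :
    ∃ g : G, ∀ i, act Q₁ Q₂ g (x i) = (![Sum.inl (t : G ⧸ Q₁), Sum.inr ((1 : G) : G ⧸ Q₂),
      Sum.inl ((1 : G) : G ⧸ Q₁), Sum.inr (s : G ⧸ Q₂), Sum.inl ((s * t : G) : G ⧸ Q₁),
      Sum.inr ((s * t * s : G) : G ⧸ Q₂)] : Fin 6 → (G ⧸ Q₁) ⊕ (G ⧸ Q₂)) i := by
  obtain ⟨hadj, hne⟩ := hx
  have a01 : (bicosetGraph Q₁ Q₂).Adj (x 0) (x 1) := hadj 0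
  have a12 : (bicosetGraph Q₁ Q₂).Adj (x 1) (x 2) := hadj 1
  have a23 : (bicosetGraph Q₁ Q₂).Adj (x 2) (x 3) := hadj 2
  have a34 : (bicosetGraph Q₁ Q₂).Adj (x 3) (x 4) := hadj 3
  have a45 : (bicosetGraph Q₁ Q₂).Adj (x 4) (x 5) := hadj 4
  have n02 : x 0 ≠ x 2 := hne 0 2 rfl
  have n13 : x 1 ≠ x 3 := hne 1 3 rfl
  have n24 : x 2 ≠ x 4 := hne 2 4 rfl
  have n35 : x 3 ≠ x 5 := hne 3 5 rfl
  obtain ⟨a, rfl⟩ := QuotientGroup.mk_surjective a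
  rw [ha] at a01
  obtain ⟨q, hq, h1⟩ := exists_of_adj_inl a01
  rw [h1] at a12
  obtain ⟨q', hq', h2⟩ := exists_of_adj_inr a12
  -- g carries the base edge (Q₂, Q₁) to the edge (x₁, x₂).
  obtain ⟨g, hg⟩ : ∃ g, g = a * q * q' := ⟨_, rfl⟩
  rw [← hg] at h2
  have h1' : x 1 = Sum.inr (g : G ⧸ Q₂) := by
    rw [h1, hg]; exact congrArg _ (mk_eq_of_mul_eq (by simpa [mul_assoc] using hq')).symm
  obtain ⟨k, hk, h0⟩ := exists_of_adj_inr (h1' ▸ (ha ▸ a01 : (bicosetGraph Q₁ Q₂).Adj (x 0) (x 1)).symm)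
  rw [h2] at a23
  obtain ⟨h₃, hh₃, e3⟩ := exists_of_adj_inl a23
  rw [e3] at a34
  obtain ⟨h₄, hh₄, e4⟩ := exists_of_adj_inr a34
  rw [e4] at a45
  obtain ⟨h₅, hh₅, e5⟩ := exists_of_adj_inl a45
  have hk' : k ∉ Q₁ := fun h => n02 (by
    rw [h0, h2]; exact congrArg _ (mk_eq_of_mul_eq (by simpa using h)))
  have hh₃' : h₃ ∉ Q₂ := fun h => n13 (by
    rw [h1', e3]; exact congrArg _ (mk_eq_of_mul_eq (by simpa using h)).symm)
  have hh₄' : h₄ ∉ Q₁ := fun h => n24 (by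
    rw [h2, e4]; exact congrArg _ (mk_eq_of_mul_eq (by
      simpa [mul_assoc] using Q₁.mul_mem hh₃ h)).symm)
  have hh₅' : h₅ ∉ Q₂ := fun h => n35 (by
    rw [e3, e5]; exact congrArg _ (mk_eq_of_mul_eq (by
      simpa [mul_assoc] using Q₂.mul_mem hh₄ h)).symm)
  obtain ⟨k₀, hk₀, m0⟩ := hd.move₀ k hk hk'
  obtain ⟨k₁, hk₁, m10, m13⟩ := hd.move₃ (k₀ * h₃) (Q₁.mul_mem hk₀.1 hh₃)
    (fun h => hh₃' ((Q₂.mul_mem_cancel_left hk₀.2).1 h))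
  -- The fourth vertex has reached sQ₂; q₂ is the discrepancy between its representative and s, and
  -- it is absorbed into the next step of the arc.
  obtain ⟨q₂, hq₂, eq₂⟩ : ∃ q₂ ∈ Q₂, k₁ * k₀ * h₃ = s * q₂ := ⟨_, m13, by group⟩
  have hq₂' : q₂ ∈ Q₂ := hq₂
  obtain ⟨k₂, hk₂, m20, m23, m24⟩ := hd.move₄ (q₂ * h₄) (Q₂.mul_mem hq₂ hh₄) (fun h => by
    refine hh₄' ?_
    have hs : s * (q₂ * h₄) ∈ Q₁ := Q₁.mul_mem hd.s_mem h
    rw [← mul_assoc, ← eq₂] at hs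
    exact (Q₁.mul_mem_cancel_left (Q₁.mul_mem (Q₁.mul_mem hk₁.1 hk₀.1) hh₃)).1 hs)
  obtain ⟨q₁, hq₁, eq₁⟩ : ∃ q₁ ∈ Q₁, k₂ * (s * (q₂ * h₄)) = s * t * q₁ := ⟨_, m24, by group⟩
  obtain ⟨k₃, hk₃, m30, m33, m34, m35⟩ := hd.move₅ (q₁ * h₅) (Q₁.mul_mem hq₁ hh₅) (fun h => by
    refine hh₅' ?_
    have h6 : s⁻¹ * (k₂ * s) * (q₂ * h₄) = t * q₁ := by
      rw [mul_assoc, mul_assoc, eq₁]; group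
    have h7 : t * (q₁ * h₅) ∈ Q₂ := Q₂.mul_mem hd.t_mem h
    rw [← mul_assoc, ← h6] at h7
    exact (Q₂.mul_mem_cancel_left (Q₂.mul_mem m23 (Q₂.mul_mem hq₂ hh₄))).1 h7)
  -- An element b that fixes the coset yQ keeps there every element already moved into it.
  have conj3 : ∀ {y b : G} {Q : Subgroup G}, y⁻¹ * (b * y) ∈ Q → ∀ c, y⁻¹ * c ∈ Q →
      y⁻¹ * (b * c) ∈ Q := by
    intro y b Q h1 c h2
    have := Q.mul_mem h1 h2
    simpa [mul_assoc] using this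
  refine ⟨k₃ * k₂ * k₁ * k₀ * g⁻¹, fun i => ?_⟩
  fin_cases i
  · change act Q₁ Q₂ _ (x 0) = Sum.inl (t : G ⧸ Q₁)
    rw [h0, act_inl]
    refine congrArg _ (mk_eq_of_mul_eq ?_)
    have := conj3 m30 _ (conj3 m20 _ (conj3 m10 _ m0))
    simpa [mul_assoc] using this
  · change act Q₁ Q₂ _ (x 1) = Sum.inr ((1 : G) : G ⧸ Q₂)
    rw [h1', act_inr]
    refine congrArg _ (mk_eq_of_mul_eq ?_)
    have := Q₂.mul_mem (Q₂.mul_mem (Q₂.mul_mem hk₃.2 hk₂.2) hk₁.2) hk₀.2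
    simpa [mul_assoc] using this
  · change act Q₁ Q₂ _ (x 2) = Sum.inl ((1 : G) : G ⧸ Q₁)
    rw [h2, act_inl]
    refine congrArg _ (mk_eq_of_mul_eq ?_)
    have := Q₁.mul_mem (Q₁.mul_mem (Q₁.mul_mem hk₃.1 hk₂.1) hk₁.1) hk₀.1
    simpa [mul_assoc] using this
  · change act Q₁ Q₂ _ (x 3) = Sum.inr (s : G ⧸ Q₂)
    rw [e3, act_inr]
    refine congrArg _ (mk_eq_of_mul_eq ?_)
    have := conj3 m33 _ (conj3 m23 _ m13)
    simpa [mul_assoc] using this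
  · change act Q₁ Q₂ _ (x 4) = Sum.inl ((s * t : G) : G ⧸ Q₁)
    rw [e4, act_inl]
    refine congrArg _ (mk_eq_of_mul_eq ?_)
    have := conj3 m34 _ m24
    rw [← mul_assoc s, ← eq₂] at this
    simpa [mul_assoc] using this
  · change act Q₁ Q₂ _ (x 5) = Sum.inr ((s * t * s : G) : G ⧸ Q₂)
    rw [e5, act_inr]
    refine congrArg _ (mk_eq_of_mul_eq ?_)
    rw [← mul_assoc (s * t), ← eq₁, ← mul_assoc s, ← eq₂] at m35
    simpa [mul_assoc] using m35

theorem isSArc_rev {V : Type} {Γ : SimpleGraph V} {n : ℕ} {x : Fin (n + 1) → V}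
    (hx : IsSArc Γ n x) : IsSArc Γ n (x ∘ Fin.rev) := by
  refine ⟨fun i => ?_, fun i j hij => ?_⟩
  · have := (hx.1 i.rev).symm
    simpa [Fin.rev_castSucc, Fin.rev_succ] using this
  · refine (hx.2 j.rev i.rev ?_).symm
    rw [Fin.val_rev, Fin.val_rev]
    omega

/-- Arcs that start at a coset of Q₁ are all moved to the standard one. The graph is bipartite and 5
is odd, so an arc that starts at a coset of Q₂ becomes of this kind on reversal. -/
theorem FiveArcData.locallyArcTransitive {s t : G} (hd : FiveArcData Q₁ Q₂ s t) :
    LocallyArcTransitive (act Q₁ Q₂).range 5 := by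
  have key : ∀ x y : Fin 6 → (G ⧸ Q₁) ⊕ (G ⧸ Q₂), IsSArc (bicosetGraph Q₁ Q₂) 5 x →
      IsSArc (bicosetGraph Q₁ Q₂) 5 y → ∀ a b, x 0 = Sum.inl a → y 0 = Sum.inl b →
      ∃ h ∈ (act Q₁ Q₂).range, ∀ i, h (x i) = y i := by
    intro x y hx hy a b ha hb
    obtain ⟨g, hg⟩ := hd.exists_act hx ha
    obtain ⟨g', hg'⟩ := hd.exists_act hy hb
    refine ⟨(act Q₁ Q₂ g')⁻¹ * act Q₁ Q₂ g, ⟨g'⁻¹ * g, by simp⟩, fun i => ?_⟩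
    change (act Q₁ Q₂ g').symm (act Q₁ Q₂ g (x i)) = y i
    rw [hg, ← hg', RelIso.symm_apply_apply]
  have parity : ∀ x : Fin 6 → (G ⧸ Q₁) ⊕ (G ⧸ Q₂), IsSArc (bicosetGraph Q₁ Q₂) 5 x → ∀ b,
      x 0 = Sum.inr b → ∃ a, x 5 = Sum.inl a := by
    intro x hx b hb
    have step1 : ∀ u v, (bicosetGraph Q₁ Q₂).Adj u v → ∀ b, u = Sum.inr b → ∃ a, v = Sum.inl a := by
      rintro u v h b rfl
      obtain ⟨b, rfl⟩ := QuotientGroup.mk_surjective b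
      obtain ⟨q, -, rfl⟩ := exists_of_adj_inr h
      exact ⟨_, rfl⟩
    have step2 : ∀ u v, (bicosetGraph Q₁ Q₂).Adj u v → ∀ b, u = Sum.inl b → ∃ a, v = Sum.inr a := by
      rintro u v h b rfl
      obtain ⟨b, rfl⟩ := QuotientGroup.mk_surjective b
      obtain ⟨q, -, rfl⟩ := exists_of_adj_inl h
      exact ⟨_, rfl⟩
    obtain ⟨_, h1⟩ := step1 _ _ (hx.1 0) _ hb
    obtain ⟨_, h2⟩ := step2 _ _ (hx.1 1) _ h1
    obtain ⟨_, h3⟩ := step1 _ _ (hx.1 2) _ h2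
    obtain ⟨_, h4⟩ := step2 _ _ (hx.1 3) _ h3
    exact step1 _ _ (hx.1 4) _ h4
  intro z x y hx hy hxz hyz
  obtain ⟨h, hh, hhx⟩ : ∃ h ∈ (act Q₁ Q₂).range, ∀ i, h (x i) = y i := by
    rcases z with a | b
    · exact key x y hx hy a a hxz hyz
    · obtain ⟨a, ha⟩ := parity x hx b hxz
      obtain ⟨a', ha'⟩ := parity y hy b hyz
      obtain ⟨h, hh, hhx⟩ := key _ _ (isSArc_rev hx) (isSArc_rev hy) a a' ha ha'
      exact ⟨h, hh, fun i => by simpa using hhx i.rev⟩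
  refine ⟨h, ⟨hh, ?_⟩, hhx⟩
  change h z = z
  have := hhx 0
  rwa [hxz, hyz] at this

end bicosetGraph

/-! ### The field with nine elements -/

namespace PermK

section Units

variable {K : Type} [Field K]

/-- The action of a field automorphism on units. -/
abbrev umap (φ : RingAut K) (x : Kˣ) : Kˣ := Units.map (φ : K →* K) x

theorem coe_umap (φ : RingAut K) (x : Kˣ) : (umap φ x : K) = φ x := rfl

end Units

section FieldFacts

variable {K : Type} [Field K] [Finite K] [CharP K 3] [hK : Fact (Nat.card K = 9)]

theorem three_eq_zero : (3 : K) = 0 := by exact_mod_cast CharP.cast_eq_zero K 3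

theorem add_cube (x y : K) : (x + y) ^ 3 = x ^ 3 + y ^ 3 := by
  linear_combination (x ^ 2 * y + x * y ^ 2) * three_eq_zero (K := K)

theorem neg_one_ne_one : (-1 : K) ≠ 1 := by
  intro h
  have : (1 : K) = 0 := by linear_combination three_eq_zero (K := K) + h
  exact one_ne_zero this

theorem pow_nine (x : K) : x ^ 9 = x := by
  cases nonempty_fintype K
  have := FiniteField.pow_card x
  rwa [← Nat.card_eq_fintype_card, hK.out] at this

theorem card_units_eq : Nat.card Kˣ = 8 := by
  rw [Nat.card_units, hK.out]

theorem unit_pow_eight (x : Kˣ) : x ^ 8 = 1 := by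
  rw [← card_units_eq (K := K)]; exact pow_card_eq_one'

theorem unit_pow_four (x : Kˣ) : x ^ 4 = 1 ∨ x ^ 4 = -1 := by
  have h : ((x : K) ^ 4 - 1) * ((x : K) ^ 4 + 1) = 0 := by
    have := congrArg Units.val (unit_pow_eight x)
    push_cast at this
    linear_combination this
  rcases mul_eq_zero.1 h with h | h
  · left; ext; push_cast; linear_combination h
  · right; ext; push_cast; linear_combination h

theorem unit_neg_one_ne_one : (-1 : Kˣ) ≠ 1 := fun h => by
  have := congrArg Units.val h
  exact neg_one_ne_one (by simpa using this)

theorem exists_pow_four_eq_neg_one : ∃ x : Kˣ, x ^ 4 = -1 := by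
  obtain ⟨g, hg⟩ := IsCyclic.exists_ofOrder_eq_natCard (α := Kˣ)
  rw [card_units_eq] at hg
  refine ⟨g, (unit_pow_four g).resolve_left fun h => ?_⟩
  have := orderOf_dvd_of_pow_eq_one h
  rw [hg] at this
  omega

variable (K) in
/-- A primitive eighth root of unity. -/
noncomputable def om : Kˣ := (exists_pow_four_eq_neg_one (K := K)).choose

theorem om_pow_four : om K ^ 4 = -1 := (exists_pow_four_eq_neg_one (K := K)).choose_spec

theorem om_pow_four' : (om K : K) ^ 4 = -1 := by
  have := congrArg Units.val (om_pow_four (K := K))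
  simpa using this

theorem exists_eq_om_pow (x : Kˣ) : ∃ n : ℕ, x = om K ^ n := by
  have h8 : orderOf (om K) = 2 ^ (2 + 1) := by
    apply orderOf_eq_prime_pow
    · norm_num [om_pow_four, unit_neg_one_ne_one]
    · norm_num [unit_pow_eight]
  have hx : x ∈ Subgroup.zpowers (om K) := by
    rw [show Subgroup.zpowers (om K) = ⊤ from ?_]
    · trivial
    · apply Subgroup.eq_top_of_card_eq
      rw [Nat.card_zpowers, h8, card_units_eq]; norm_num
  rw [← mem_powers_iff_mem_zpowers] at hx
  obtain ⟨n, hn⟩ := hx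
  exact ⟨n, hn.symm⟩

theorem isSquare_iff (x : Kˣ) : IsSquare x ↔ x ^ 4 = 1 := by
  constructor
  · rintro ⟨y, rfl⟩
    rw [← pow_two, ← pow_mul]; exact unit_pow_eight y
  · intro h
    obtain ⟨n, rfl⟩ := exists_eq_om_pow x
    rw [← pow_mul, mul_comm, pow_mul, om_pow_four] at h
    rcases Nat.even_or_odd n with hn | hn
    · exact hn.isSquare_pow _
    · rw [hn.neg_one_pow] at h
      exact absurd h unit_neg_one_ne_one

variable (K) in
/-- The Frobenius automorphism. -/
noncomputable def frob : RingAut K := frobeniusEquiv K 3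

theorem frob_apply (x : K) : frob K x = x ^ 3 := rfl

theorem frob_mul_frob : frob K * frob K = 1 := by
  ext x
  change (x ^ 3) ^ 3 = x
  rw [← pow_mul]; exact pow_nine x

theorem frob_ne_one : frob K ≠ 1 := by
  intro h
  have h1 : (om K : K) ^ 3 = om K := by
    rw [← frob_apply, h]; rfl
  have h2 := om_pow_four' (K := K)
  have h3 : (om K : K) ^ 2 = -1 := by linear_combination h2 - (om K : K) * h1
  have h4 : (1 : K) = -1 := by linear_combination h2 - ((om K : K) ^ 2 - 1) * h3
  exact neg_one_ne_one h4.symm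

/-! ### The quadratic character with values in the Galois group, and its invariant subgroups -/

open Classical in
/-- The automorphism attached to a unit: trivial for squares, the Frobenius for non-squares. -/
noncomputable def chi : Kˣ →* RingAut K where
  toFun x := if x ^ 4 = 1 then 1 else frob K
  map_one' := by simp
  map_mul' x y := by
    have hne := unit_neg_one_ne_one (K := K)
    rw [mul_pow]
    rcases unit_pow_four x with hx | hx <;> rcases unit_pow_four y with hy | hy <;>
      simp [hx, hy, hne, frob_mul_frob]

theorem chi_of_eq_one {x : Kˣ} (h : x ^ 4 = 1) : chi x = 1 := by
  simp [chi, h]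

theorem chi_of_ne_one {x : Kˣ} (h : x ^ 4 ≠ 1) : chi x = frob K := by
  simp [chi, h]

theorem chi_eq_one_iff {x : Kˣ} : chi x = 1 ↔ x ^ 4 = 1 := by
  refine ⟨fun h => ?_, chi_of_eq_one⟩
  by_contra hx
  rw [chi_of_ne_one hx] at h
  exact frob_ne_one h

/-- Field automorphisms preserve squareness. This is why tying the twist to the determinant is
consistent with composition. -/
theorem chi_umap (φ : RingAut K) (x : Kˣ) : chi (umap φ x) = chi x := by
  have h : (umap φ x) ^ 4 = 1 ↔ x ^ 4 = 1 := by
    rw [← map_pow]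
    constructor
    · intro h
      ext
      have := congrArg Units.val h
      apply φ.injective
      simpa using this
    · intro h; rw [h, map_one]
  by_cases hx : x ^ 4 = 1
  · rw [chi_of_eq_one hx, chi_of_eq_one (h.2 hx)]
  · rw [chi_of_ne_one hx, chi_of_ne_one (fun h' => hx (h.1 h'))]

theorem chi_apply_cases (x : Kˣ) : (chi x = 1 ∧ (x : K) ^ 4 = 1) ∨
    (chi x = frob K ∧ (x : K) ^ 4 = -1) := by
  rcases unit_pow_four x with hx | hx
  · exact Or.inl ⟨chi_of_eq_one hx, by have := congrArg Units.val hx; simpa using this⟩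
  · refine Or.inr ⟨chi_of_ne_one (by rw [hx]; exact unit_neg_one_ne_one), ?_⟩
    have := congrArg Units.val hx; simpa using this

/-- The additive subgroups of `K` that are invariant under the twisted action `x ^ 6 χ(x)`. -/
structure TwistInv (K : Type) [Field K] [Finite K] [CharP K 3] [Fact (Nat.card K = 9)] where
  grp : AddSubgroup K
  inv : ∀ x : Kˣ, ∀ w ∈ grp, (x : K) ^ 6 * chi x w ∈ grp

variable (K) in
/-- All of `K`. -/
noncomputable def twistTop : TwistInv K := ⟨⊤, fun _ _ _ => trivial⟩

variable (K) in
/-- The subgroup of order three generated by `om K`. -/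
noncomputable def twistThree : TwistInv K where
  grp :=
    { carrier := {w | w ^ 3 = (om K : K) ^ 2 * w}
      zero_mem' := by simp
      add_mem' := by
        intro a b ha hb
        change a ^ 3 = _ at ha
        change b ^ 3 = _ at hb
        change (a + b) ^ 3 = _
        rw [add_cube, ha, hb]; ring
      neg_mem' := by
        intro a ha
        change a ^ 3 = _ at ha
        change (-a) ^ 3 = _
        linear_combination -ha }
  inv := by
    intro x w hw
    change w ^ 3 = _ at hw
    change (_ : K) ^ 3 = _
    -- For a square x, x⁶ = ±1. For a non-square x, the Frobenius multiplies elements of this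
    -- subgroup by ω², and x⁶ω² = ±1 because x is an odd power of ω. The computations use only x⁴ =
    -- ±1 and ω⁴ = -1.
    rcases chi_apply_cases x with ⟨h, hx⟩ | ⟨h, hx⟩
    · rw [h]
      change ((x : K) ^ 6 * w) ^ 3 = (om K : K) ^ 2 * ((x : K) ^ 6 * w)
      linear_combination (x : K) ^ 18 * hw + (om K : K) ^ 2 * w * ((x : K) ^ 14 +
        (x : K) ^ 10 + (x : K) ^ 6) * hx
    · rw [h, frob_apply, hw]
      have h4 := om_pow_four' (K := K)
      linear_combination ((x : K) ^ 18 * (om K : K) ^ 6) * hw +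
        (x : K) ^ 18 * (om K : K) ^ 4 * w * h4 - (x : K) ^ 6 * w * h4 +
        (x : K) ^ 18 * w * (-1) * h4 + w * (x ^ 14 - x ^ 10 + x ^ 6) * hx

theorem mem_twistThree {w : K} : w ∈ (twistThree K).grp ↔ w = 0 ∨ w = om K ∨ w = -om K := by
  have : w ∈ (twistThree K).grp ↔ w ^ 3 = (om K : K) ^ 2 * w := Iff.rfl
  rw [this, ← sub_eq_zero]
  have h2 : w ^ 3 - (om K : K) ^ 2 * w = w * ((w - om K) * (w + om K)) := by ring
  rw [h2, mul_eq_zero, mul_eq_zero, sub_eq_zero, add_eq_zero_iff_eq_neg]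

theorem card_twistThree : Nat.card (twistThree K).grp = 3 := by
  have h0 : (om K : K) ≠ 0 := (om K).ne_zero
  have h1 : (om K : K) ≠ -om K := by
    intro h
    apply h0
    linear_combination three_eq_zero (K := K) * om K - h
  have : ((twistThree K).grp : Set K) = {0, (om K : K), -(om K : K)} := by
    ext w
    exact mem_twistThree
  have hc : Nat.card (twistThree K).grp = ((twistThree K).grp : Set K).ncard := rfl
  rw [hc, this, Set.ncard_eq_three]
  exact ⟨_, _, _, h0.symm, by simp, h1, rfl⟩

end FieldFacts

/-! ### Semilinear and quadratic permutations -/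

section Perms

open Matrix

variable {K : Type} [Field K]

/-- The action of a field automorphism on matrices. -/
abbrev gmap (φ : RingAut K) (M : GL (Fin 2) K) : GL (Fin 2) K :=
  GeneralLinearGroup.map (φ : K →+* K) M

theorem coe_gmap (φ : RingAut K) (M : GL (Fin 2) K) (i j) : (gmap φ M).1 i j = φ (M.1 i j) := rfl

theorem det_gmap (φ : RingAut K) (M : GL (Fin 2) K) :
    GeneralLinearGroup.det (gmap φ M) = umap φ (GeneralLinearGroup.det M) :=
  GeneralLinearGroup.map_det _ _

theorem coe_det (M : GL (Fin 2) K) : (GeneralLinearGroup.det M : K) =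
    M.1 0 0 * M.1 1 1 - M.1 0 1 * M.1 1 0 := by
  rw [GeneralLinearGroup.val_det_apply, Matrix.det_fin_two]

/-- The upper triangular matrix with diagonal `(l, m)` and corner `e`. -/
noncomputable def tri (l m : Kˣ) (e : K) : GL (Fin 2) K :=
  GeneralLinearGroup.mk' !![(l : K), e; 0, (m : K)]
    (by rw [Matrix.det_fin_two_of, mul_zero, sub_zero]
        exact invertibleOfNonzero (mul_ne_zero l.ne_zero m.ne_zero))

theorem coe_tri (l m : Kˣ) (e : K) : (tri l m e).1 = !![(l : K), e; 0, (m : K)] := rfl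

theorem det_tri (l m : Kˣ) (e : K) : GeneralLinearGroup.det (tri l m e) = l * m := by
  ext
  rw [coe_det, coe_tri]
  simp

theorem eq_tri {M : GL (Fin 2) K} (h : M.1 1 0 = 0) : ∃ l m : Kˣ, ∃ e, M = tri l m e := by
  have hd := (GeneralLinearGroup.det M).ne_zero
  rw [coe_det, h, mul_zero, sub_zero] at hd
  refine ⟨Units.mk0 _ (left_ne_zero_of_mul hd), Units.mk0 _ (right_ne_zero_of_mul hd),
    M.1 0 1, ?_⟩
  ext i j
  fin_cases i <;> fin_cases j <;> simp [coe_tri, h]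

variable [Finite K]

/-- The permutation `(a, b, c) ↦ (M (φ a, φ b) + t, det(M) ^ 6 φ c + w)`. -/
noncomputable def affPerm (M : GL (Fin 2) K) (φ : RingAut K) (t : Fin 2 → K) (w : K) :
    Equiv.Perm (K × K × K) :=
  Equiv.ofBijective (fun x => (M.1 0 0 * φ x.1 + M.1 0 1 * φ x.2.1 + t 0,
      M.1 1 0 * φ x.1 + M.1 1 1 * φ x.2.1 + t 1,
      (GeneralLinearGroup.det M : K) ^ 6 * φ x.2.2 + w)) <| by
    apply Function.Injective.bijective_of_finite
    rintro ⟨a, b, c⟩ ⟨a', b', c'⟩ h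
    simp only [Prod.mk.injEq] at h
    obtain ⟨h1, h2, h3⟩ := h
    have hd := (GeneralLinearGroup.det M).ne_zero
    have h3' := mul_left_cancel₀ (pow_ne_zero 6 hd) (add_right_cancel h3)
    rw [coe_det] at hd
    have ha : φ a = φ a' := by
      apply mul_left_cancel₀ hd
      linear_combination M.1 1 1 * h1 - M.1 0 1 * h2
    have hb : φ b = φ b' := by
      apply mul_left_cancel₀ hd
      linear_combination M.1 0 0 * h2 - M.1 1 0 * h1
    rw [φ.injective ha, φ.injective hb, φ.injective h3']

theorem affPerm_apply (M : GL (Fin 2) K) (φ : RingAut K) (t : Fin 2 → K) (w a b c : K) :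
    affPerm M φ t w (a, b, c) = (M.1 0 0 * φ a + M.1 0 1 * φ b + t 0,
      M.1 1 0 * φ a + M.1 1 1 * φ b + t 1, (GeneralLinearGroup.det M : K) ^ 6 * φ c + w) := rfl

/-- The image of the origin gives t and w, the unit vectors of the plane give M, and the third
coordinate then gives φ. -/
theorem affPerm_inj {M M' : GL (Fin 2) K} {φ φ' : RingAut K} {t t' : Fin 2 → K} {w w' : K}
    (h : affPerm M φ t w = affPerm M' φ' t' w') : M = M' ∧ φ = φ' ∧ t = t' ∧ w = w' := by
  have key := fun a b c => congrArg (fun f : Equiv.Perm (K × K × K) => f (a, b, c)) h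
  simp only [affPerm_apply, Prod.mk.injEq] at key
  have h0 := key 0 0 0
  simp only [map_zero, mul_zero, zero_add] at h0
  obtain ⟨h1, h2, h3⟩ := h0
  have ht : t = t' := by ext i; fin_cases i <;> assumption
  subst ht h3
  have ha := key 1 0 0
  have hb := key 0 1 0
  simp only [map_zero, map_one, mul_zero, mul_one, zero_add, add_zero, add_left_inj] at ha hb
  have hM : M = M' := by
    ext i j
    fin_cases i <;> fin_cases j
    exacts [ha.1, hb.1, ha.2.1, hb.2.1]
  subst hM
  refine ⟨rfl, ?_, rfl, rfl⟩
  ext c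
  have := (key 0 0 c).2.2
  rw [add_left_inj] at this
  exact mul_left_cancel₀ (pow_ne_zero 6 (GeneralLinearGroup.det M).ne_zero) this

theorem affPerm_mul (M M' : GL (Fin 2) K) (φ φ' : RingAut K) (t t' : Fin 2 → K) (w w' : K) :
    affPerm M φ t w * affPerm M' φ' t' w' = affPerm (M * gmap φ M') (φ * φ')
      (fun i => M.1 i 0 * φ (t' 0) + M.1 i 1 * φ (t' 1) + t i)
      ((GeneralLinearGroup.det M : K) ^ 6 * φ w' + w) := by
  ext1 ⟨a, b, c⟩
  rw [Equiv.Perm.mul_apply]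
  simp only [affPerm_apply, map_add, map_mul, map_pow, RingAut.mul_apply, Units.val_mul,
    Matrix.mul_apply, Fin.sum_univ_two, coe_gmap, det_gmap, coe_umap, Prod.mk.injEq]
  exact ⟨by ring, by ring, by ring⟩

theorem affPerm_one : affPerm (1 : GL (Fin 2) K) 1 0 0 = 1 := by
  ext1 ⟨a, b, c⟩
  simp [affPerm_apply]

/-- The permutation
`(a, b, c) ↦ (l φ a + e φ b + d φ b ^ 2 + d ^ 3 l ^ 6 φ c + u, m φ b + v, (l m) ^ 6 φ c + w)`. -/
noncomputable def quadPerm (l m : Kˣ) (φ : RingAut K) (d e u v w : K) :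
    Equiv.Perm (K × K × K) :=
  Equiv.ofBijective (fun x => ((l : K) * φ x.1 + e * φ x.2.1 + d * φ x.2.1 ^ 2 +
      d ^ 3 * (l : K) ^ 6 * φ x.2.2 + u, (m : K) * φ x.2.1 + v,
      ((l : K) * m) ^ 6 * φ x.2.2 + w)) <| by
    apply Function.Injective.bijective_of_finite
    rintro ⟨a, b, c⟩ ⟨a', b', c'⟩ h
    simp only [Prod.mk.injEq] at h
    obtain ⟨h1, h2, h3⟩ := h
    have hc := φ.injective (mul_left_cancel₀ (pow_ne_zero 6 (mul_ne_zero l.ne_zero m.ne_zero))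
      (add_right_cancel h3))
    have hb := φ.injective (mul_left_cancel₀ m.ne_zero (add_right_cancel h2))
    subst hc hb
    simp only [add_left_inj] at h1
    rw [φ.injective (mul_left_cancel₀ l.ne_zero h1)]

theorem quadPerm_apply (l m : Kˣ) (φ : RingAut K) (d e u v w a b c : K) :
    quadPerm l m φ d e u v w (a, b, c) = ((l : K) * φ a + e * φ b + d * φ b ^ 2 +
      d ^ 3 * (l : K) ^ 6 * φ c + u, (m : K) * φ b + v, ((l : K) * m) ^ 6 * φ c + w) := rfl

theorem quadPerm_one : quadPerm (1 : Kˣ) 1 1 0 0 0 0 0 = 1 := by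
  ext1 ⟨a, b, c⟩
  simp [quadPerm_apply]

theorem quadPerm_zero (l m : Kˣ) (φ : RingAut K) (e u v w : K) :
    quadPerm l m φ 0 e u v w = affPerm (tri l m e) φ ![u, v] w := by
  ext1 ⟨a, b, c⟩
  simp [quadPerm_apply, affPerm_apply, coe_tri, det_tri]

variable [CharP K 3] [hK : Fact (Nat.card K = 9)]

/-- The values at b = 1 and b = -1 separate the linear coefficient e from the quadratic coefficient
d, as the characteristic is not 2. -/
theorem quadPerm_inj {l m l' m' : Kˣ} {φ φ' : RingAut K} {d e u v w d' e' u' v' w' : K}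
    (h : quadPerm l m φ d e u v w = quadPerm l' m' φ' d' e' u' v' w') :
    l = l' ∧ m = m' ∧ φ = φ' ∧ d = d' ∧ e = e' ∧ u = u' ∧ v = v' ∧ w = w' := by
  have key := fun a b c => congrArg (fun f : Equiv.Perm (K × K × K) => f (a, b, c)) h
  simp only [quadPerm_apply, Prod.mk.injEq] at key
  have h0 := key 0 0 0
  simp only [map_zero, mul_zero, zero_add, zero_pow two_ne_zero] at h0
  obtain ⟨rfl, rfl, rfl⟩ := h0
  have hl := (key 1 0 0).1
  have hb := key 0 1 0
  have hb' := key 0 (-1) 0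
  simp only [map_zero, map_one, mul_zero, mul_one, zero_add, add_zero, add_left_inj,
    zero_pow two_ne_zero, one_pow, map_neg] at hl hb hb'
  have hl' : l = l' := Units.ext hl
  have hm' : m = m' := Units.ext hb.2.1
  subst hl' hm'
  have he : e = e' := by linear_combination (-1 : K) * hb.1 + hb'.1 + three_eq_zero (K := K) * (e - e')
  subst he
  have hd : d = d' := by linear_combination hb.1
  subst hd
  refine ⟨rfl, rfl, ?_, rfl, rfl, rfl, rfl, rfl⟩
  ext c
  have := (key 0 0 c).2.2
  rw [add_left_inj] at this
  exact mul_left_cancel₀ (pow_ne_zero 6 (mul_ne_zero l.ne_zero m.ne_zero)) this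

/-- The coefficient of c is not a free parameter but d³l⁶. That this shape survives composition
rests on additivity of the cube and on l⁹ = l. -/
theorem quadPerm_mul (l m l' m' : Kˣ) (φ φ' : RingAut K) (d e u v w d' e' u' v' w' : K) :
    quadPerm l m φ d e u v w * quadPerm l' m' φ' d' e' u' v' w' =
      quadPerm (l * umap φ l') (m * umap φ m') (φ * φ') (l * φ d' + d * φ m' ^ 2)
        (l * φ e' + e * φ m' + 2 * d * φ m' * φ v')
        (l * φ u' + e * φ v' + d * φ v' ^ 2 + d ^ 3 * l ^ 6 * φ w' + u)
        (m * φ v' + v) ((l * m : K) ^ 6 * φ w' + w) := by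
  ext1 ⟨a, b, c⟩
  rw [Equiv.Perm.mul_apply]
  simp only [quadPerm_apply, map_add, map_mul, map_pow, RingAut.mul_apply, Units.val_mul,
    coe_umap, Prod.mk.injEq]
  refine ⟨?_, by ring, by ring⟩
  rw [add_cube]
  linear_combination - φ d' ^ 3 * φ l' ^ 6 * φ (φ' c) * pow_nine (l : K)

end Perms

end PermK

/-- A subset of a finite group that contains `1` and is closed under products, as a subgroup. -/
def subgroupOfMulClosed {G : Type*} [Group G] [Finite G] (S : Set G) (h1 : 1 ∈ S)
    (hmul : ∀ a ∈ S, ∀ b ∈ S, a * b ∈ S) : Subgroup G where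
  carrier := S
  one_mem' := h1
  mul_mem' := fun ha hb => hmul _ ha _ hb
  inv_mem' := by
    intro x hx
    have hpow : ∀ n : ℕ, x ^ n ∈ S := by
      intro n
      induction n with
      | zero => simpa using h1
      | succ n ih => rw [pow_succ]; exact hmul _ ih _ hx
    have : x⁻¹ = x ^ (orderOf x - 1) := by
      rw [inv_eq_iff_mul_eq_one, ← pow_succ', Nat.sub_add_cancel (orderOf_pos x), pow_orderOf_eq_one]
    rw [this]
    exact hpow _

/-! ### Families of semilinear and quadratic permutation groups -/

namespace PermK

open Matrix

variable {K : Type} [Field K] [Finite K] [CharP K 3] [hK : Fact (Nat.card K = 9)]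

/-- χ(y) acts on units as the identity or as cubing, so it preserves every subgroup. -/
theorem umap_chi_mem {D : Subgroup Kˣ} {x : Kˣ} (hx : x ∈ D) (y : Kˣ) : umap (chi y) x ∈ D := by
  rcases chi_apply_cases y with ⟨h, -⟩ | ⟨h, -⟩
  · rw [h]; exact hx
  · rw [h]
    have : umap (frob K) x = x ^ 3 := by ext; rw [coe_umap, frob_apply, Units.val_pow_eq_pow_val]
    rw [this]
    exact D.pow_mem hx 3

theorem umap_chi_mem_prod {Λ : Subgroup (Kˣ × Kˣ)} {x : Kˣ × Kˣ} (hx : x ∈ Λ) (y : Kˣ) :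
    (umap (chi y) x.1, umap (chi y) x.2) ∈ Λ := by
  rcases chi_apply_cases y with ⟨h, -⟩ | ⟨h, -⟩
  · rw [h]; exact hx
  · rw [h]
    have : (umap (frob K) x.1, umap (frob K) x.2) = x ^ 3 := by
      ext <;> simp [frob_apply]
    rw [this]
    exact Λ.pow_mem hx 3

/-- The ideals of a field are 0 and K. They serve below as a uniform way of saying that a
coefficient is zero or arbitrary. -/
theorem map_mem_ideal {I : Ideal K} {x : K} (hx : x ∈ I) (φ : RingAut K) : φ x ∈ I := by
  rcases Ideal.eq_bot_or_top I with rfl | rfl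
  · rw [Ideal.mem_bot] at hx ⊢
    rw [hx, map_zero]
  · trivial

/-- The semilinear permutations with twist given by the determinant, with determinant in `D` and
third translation part in `W`. -/
noncomputable def affSub (D : Subgroup Kˣ) (W : TwistInv K) :
    Subgroup (Equiv.Perm (K × K × K)) :=
  subgroupOfMulClosed {g | ∃ (M : GL (Fin 2) K) (t : Fin 2 → K) (w : K),
      GeneralLinearGroup.det M ∈ D ∧ w ∈ W.grp ∧
        g = affPerm M (chi (GeneralLinearGroup.det M)) t w}
    ⟨1, 0, 0, by simp [D.one_mem], W.grp.zero_mem, by rw [map_one, map_one, affPerm_one]⟩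
    (by
      rintro _ ⟨M, t, w, hM, hw, rfl⟩ _ ⟨M', t', w', hM', hw', rfl⟩
      have hdet : GeneralLinearGroup.det (M * gmap (chi (GeneralLinearGroup.det M)) M') =
          GeneralLinearGroup.det M *
            umap (chi (GeneralLinearGroup.det M)) (GeneralLinearGroup.det M') := by
        rw [map_mul, det_gmap]
      refine ⟨M * gmap (chi (GeneralLinearGroup.det M)) M',
        fun i => M.1 i 0 * chi (GeneralLinearGroup.det M) (t' 0) +
          M.1 i 1 * chi (GeneralLinearGroup.det M) (t' 1) + t i,
        (GeneralLinearGroup.det M : K) ^ 6 * chi (GeneralLinearGroup.det M) w' + w, ?_, ?_, ?_⟩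
      · rw [hdet]
        exact D.mul_mem hM (umap_chi_mem hM' _)
      · exact W.grp.add_mem (W.inv _ _ hw') hw
      · rw [affPerm_mul, hdet, map_mul, chi_umap])

theorem affPerm_mem_affSub {D : Subgroup Kˣ} {W : TwistInv K} {M : GL (Fin 2) K}
    {φ : RingAut K} {t : Fin 2 → K} {w : K} : affPerm M φ t w ∈ affSub D W ↔
      GeneralLinearGroup.det M ∈ D ∧ φ = chi (GeneralLinearGroup.det M) ∧ w ∈ W.grp := by
  constructor
  · rintro ⟨M', t', w', hM, hw, h⟩
    obtain ⟨rfl, rfl, rfl, rfl⟩ := affPerm_inj h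
    exact ⟨hM, rfl, hw⟩
  · rintro ⟨h1, rfl, h2⟩
    exact ⟨M, t, w, h1, h2, rfl⟩

/-- The quadratic permutations with diagonal in `Λ`, quadratic coefficient in `I`, off-diagonal
coefficient in `J`, third translation part in `W`, and twist given by the diagonal. -/
noncomputable def quadSub (Λ : Subgroup (Kˣ × Kˣ)) {I J : Ideal K} (hIJ : I ≤ J) (W : TwistInv K) :
    Subgroup (Equiv.Perm (K × K × K)) :=
  subgroupOfMulClosed {g | ∃ (l m : Kˣ) (d e u v w : K), (l, m) ∈ Λ ∧ d ∈ I ∧ e ∈ J ∧ w ∈ W.grp ∧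
        g = quadPerm l m (chi (l * m)) d e u v w}
    ⟨1, 1, 0, 0, 0, 0, 0, Λ.one_mem, I.zero_mem, J.zero_mem, W.grp.zero_mem, by
      rw [mul_one, map_one, quadPerm_one]⟩
    (by
      rintro _ ⟨l, m, d, e, u, v, w, h, hd, he, hw, rfl⟩
        _ ⟨l', m', d', e', u', v', w', h', hd', he', hw', rfl⟩
      obtain ⟨φ, hφ⟩ : ∃ φ, φ = chi (l * m) := ⟨_, rfl⟩
      have hmul : chi (l * umap φ l' * (m * umap φ m')) = φ * chi (l' * m') := by
        rw [mul_mul_mul_comm, ← map_mul, map_mul, chi_umap, hφ]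
      refine ⟨l * umap φ l', m * umap φ m', l * φ d' + d * φ m' ^ 2,
        l * φ e' + e * φ m' + 2 * d * φ m' * φ v',
        l * φ u' + e * φ v' + d * φ v' ^ 2 + d ^ 3 * l ^ 6 * φ w' + u,
        m * φ v' + v, (l * m : K) ^ 6 * φ w' + w, ?_, ?_, ?_, ?_, ?_⟩
      · rw [hφ]
        exact Λ.mul_mem h (umap_chi_mem_prod h' _)
      · exact I.add_mem (I.mul_mem_left _ (map_mem_ideal hd' _)) (I.mul_mem_right _ hd)
      · refine J.add_mem (J.add_mem (J.mul_mem_left _ (map_mem_ideal he' _))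
          (J.mul_mem_right _ he)) ?_
        exact J.mul_mem_right _ (J.mul_mem_right _ (J.mul_mem_left _ (hIJ hd)))
      · have := W.inv (l * m) w' hw'
        rw [Units.val_mul, ← hφ] at this
        exact W.grp.add_mem this hw
      · rw [← hφ, quadPerm_mul, hmul])

theorem quadPerm_mem_quadSub {Λ : Subgroup (Kˣ × Kˣ)} {I J : Ideal K} {hIJ : I ≤ J}
    {W : TwistInv K} {l m : Kˣ} {φ : RingAut K} {d e u v w : K} :
    quadPerm l m φ d e u v w ∈ quadSub Λ hIJ W ↔
      (l, m) ∈ Λ ∧ φ = chi (l * m) ∧ d ∈ I ∧ e ∈ J ∧ w ∈ W.grp := by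
  constructor
  · rintro ⟨l', m', d', e', u', v', w', h1, h2, h3, h4, h⟩
    obtain ⟨rfl, rfl, rfl, rfl, rfl, rfl, rfl, rfl⟩ := quadPerm_inj h
    exact ⟨h1, rfl, h2, h3, h4⟩
  · rintro ⟨h1, rfl, h2, h3, h4⟩
    exact ⟨l, m, d, e, u, v, w, h1, h2, h3, h4, rfl⟩

theorem quadSub_mono {Λ Λ' : Subgroup (Kˣ × Kˣ)} {I J I' J' : Ideal K} {h : I ≤ J} {h' : I' ≤ J'}
    {W W' : TwistInv K} (hΛ : Λ ≤ Λ') (hI : I ≤ I') (hJ : J ≤ J') (hW : W.grp ≤ W'.grp) :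
    quadSub Λ h W ≤ quadSub Λ' h' W' := by
  rintro _ ⟨l, m, d, e, u, v, w, h1, h2, h3, h4, rfl⟩
  exact ⟨l, m, d, e, u, v, w, hΛ h1, hI h2, hJ h3, hW h4, rfl⟩

theorem affSub_mono {D D' : Subgroup Kˣ} {W W' : TwistInv K} (hD : D ≤ D') (hW : W.grp ≤ W'.grp) :
    affSub D W ≤ affSub D' W' := by
  rintro _ ⟨M, t, w, h1, h2, rfl⟩
  exact ⟨M, t, w, hD h1, hW h2, rfl⟩

/-- The values of the first coordinate at b = 1, 0, -1 have second difference 2d, which vanishes for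
a semilinear map. -/
theorem eq_of_affPerm_eq_quadPerm {M : GL (Fin 2) K} {φ φ' : RingAut K} {t : Fin 2 → K}
    {l m : Kˣ} {d e u v w w' : K} (h : affPerm M φ t w = quadPerm l m φ' d e u v w') :
    d = 0 ∧ M = tri l m e ∧ φ = φ' ∧ t = ![u, v] ∧ w = w' := by
  have key := fun a b c => congrArg (fun f : Equiv.Perm (K × K × K) => (f (a, b, c)).1) h
  simp only [affPerm_apply, quadPerm_apply] at key
  have h0 := key 0 0 0
  have h1 := key 0 1 0
  have h2 := key 0 (-1) 0
  simp only [map_zero, map_one, map_neg, mul_zero, mul_one, zero_add, add_zero,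
    zero_pow two_ne_zero, one_pow] at h0 h1 h2
  have hd : d = 0 := by
    linear_combination h1 + h2 - 2 * h0 + three_eq_zero (K := K) * d
  subst hd
  rw [quadPerm_zero] at h
  exact ⟨rfl, affPerm_inj h⟩

theorem quadPerm_mem_affSub {D : Subgroup Kˣ} {W : TwistInv K} {l m : Kˣ} {φ : RingAut K}
    {d e u v w : K} : quadPerm l m φ d e u v w ∈ affSub D W ↔
      d = 0 ∧ l * m ∈ D ∧ φ = chi (l * m) ∧ w ∈ W.grp := by
  constructor
  · rintro ⟨M, t, w', h1, h2, h⟩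
    obtain ⟨rfl, rfl, rfl, rfl, rfl⟩ := eq_of_affPerm_eq_quadPerm h.symm
    rw [det_tri] at h1 ⊢
    exact ⟨rfl, h1, rfl, h2⟩
  · rintro ⟨rfl, h1, h2, h3⟩
    rw [quadPerm_zero, affPerm_mem_affSub, det_tri]
    exact ⟨h1, h2, h3⟩

theorem affSub_inf_quadSub_le {D : Subgroup Kˣ} {Λ : Subgroup (Kˣ × Kˣ)} {I J : Ideal K}
    {hIJ : I ≤ J} {W W' : TwistInv K} {g} (h1 : g ∈ affSub D W) (h2 : g ∈ quadSub Λ hIJ W') :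
    ∃ (l m : Kˣ) (e u v w : K), (l, m) ∈ Λ ∧ l * m ∈ D ∧ e ∈ J ∧ w ∈ W.grp ∧ w ∈ W'.grp ∧
      g = quadPerm l m (chi (l * m)) 0 e u v w := by
  obtain ⟨l, m, d, e, u, v, w, h3, h4, h5, h6, rfl⟩ := h2
  obtain ⟨rfl, h7, -, h8⟩ := quadPerm_mem_affSub.1 h1
  exact ⟨l, m, e, u, v, w, h3, h7, h5, h8, h6, rfl⟩

/-! ### The subgroups -/

variable (K)

/-- The subgroup of squares. -/
def sqUnits : Subgroup Kˣ := (powMonoidHom 4).ker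

theorem mem_sqUnits {x : Kˣ} : x ∈ sqUnits K ↔ x ^ 4 = 1 := Iff.rfl

/-- Diagonals with square determinant. -/
def diagSq : Subgroup (Kˣ × Kˣ) := (sqUnits K).comap mulMonoidHom

/-- Diagonals with determinant one. -/
def diagOne : Subgroup (Kˣ × Kˣ) := (⊥ : Subgroup Kˣ).comap mulMonoidHom

/-- Diagonals `(m, m)`. -/
def diagScalar : Subgroup (Kˣ × Kˣ) :=
  (MonoidHom.fst Kˣ Kˣ).eqLocus (MonoidHom.snd Kˣ Kˣ)

/-- Diagonals `(m ^ 2, m)` with `m` a square. -/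
def diagKer : Subgroup (Kˣ × Kˣ) :=
  (MonoidHom.fst Kˣ Kˣ).eqLocus ((powMonoidHom 2).comp (MonoidHom.snd Kˣ Kˣ)) ⊓
    (sqUnits K).comap (MonoidHom.snd Kˣ Kˣ)

/-- Diagonals `(1, ± 1)`. -/
def diagSign : Subgroup (Kˣ × Kˣ) :=
  (MonoidHom.fst Kˣ Kˣ).ker ⊓ ((powMonoidHom 2).comp (MonoidHom.snd Kˣ Kˣ)).ker

variable {K}

theorem mem_diagSq {l m : Kˣ} : (l, m) ∈ diagSq K ↔ (l * m) ^ 4 = 1 := Iff.rfl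
theorem mem_diagOne {l m : Kˣ} : (l, m) ∈ diagOne K ↔ l * m = 1 := Iff.rfl
theorem mem_diagKer {l m : Kˣ} : (l, m) ∈ diagKer K ↔ l = m ^ 2 ∧ m ^ 4 = 1 := Iff.rfl
theorem mem_diagSign {l m : Kˣ} : (l, m) ∈ diagSign K ↔ l = 1 ∧ m ^ 2 = 1 := Iff.rfl

variable (K)

/-- The stabilizer of the first vertex. -/
noncomputable def stab₁ := affSub (⊤ : Subgroup Kˣ) (twistThree K)

/-- The stabilizer of the second vertex. -/
noncomputable def stab₂ := quadSub (⊤ : Subgroup (Kˣ × Kˣ)) (le_refl (⊤ : Ideal K)) (twistThree K)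

/-- The subgroup of `stab₁ ⊓ stab₂` with diagonal in `Λ`. -/
noncomputable def borel {K : Type} [Field K] [Finite K] [CharP K 3] [Fact (Nat.card K = 9)]
    (Λ : Subgroup (Kˣ × Kˣ)) :=
  quadSub Λ (bot_le : (⊥ : Ideal K) ≤ ⊤) (twistThree K)

/-- The subgroup of `stab₁ ⊓ stab₂` with scalar linear part in `Λ`. -/
noncomputable def scal {K : Type} [Field K] [Finite K] [CharP K 3] [Fact (Nat.card K = 9)]
    (Λ : Subgroup (Kˣ × Kˣ)) :=
  quadSub Λ (le_refl (⊥ : Ideal K)) (twistThree K)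

/-- The group generated by the `3`-cores of the kernels at the neighbours of the first vertex. -/
noncomputable def slPart := affSub (⊥ : Subgroup Kˣ) (twistThree K)

/-- The first group of the core. -/
noncomputable def core₁ := affSub (sqUnits K) (twistThree K)

/-- The second group of the core. -/
noncomputable def core₂ := quadSub (diagSq K) (le_refl (⊤ : Ideal K)) (twistThree K)

/-- The translations of the third coordinate. -/
noncomputable def thirdTrans : Subgroup (Equiv.Perm (K × K × K)) :=
  subgroupOfMulClosed {g | ∃ w ∈ (twistThree K).grp, g = affPerm 1 1 0 w}
    ⟨0, (twistThree K).grp.zero_mem, affPerm_one.symm⟩ (by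
      rintro _ ⟨w, hw, rfl⟩ _ ⟨w', hw', rfl⟩
      refine ⟨w' + w, (twistThree K).grp.add_mem hw' hw, ?_⟩
      rw [affPerm_mul]
      congr 1
      · simp
      · ext i; simp
      · simp)

variable {K}

theorem stab_inf : stab₁ K ⊓ stab₂ K = borel ⊤ := by
  ext g
  constructor
  · rintro ⟨h1, h2⟩
    obtain ⟨l, m, e, u, v, w, h3, -, h5, h6, -, rfl⟩ := affSub_inf_quadSub_le h1 h2
    exact quadPerm_mem_quadSub.2 ⟨h3, rfl, Ideal.zero_mem _, h5, h6⟩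
  · rintro ⟨l, m, d, e, u, v, w, h1, h2, h3, h4, rfl⟩
    rw [Ideal.mem_bot] at h2
    exact ⟨quadPerm_mem_affSub.2 ⟨h2, trivial, rfl, h4⟩,
      quadPerm_mem_quadSub.2 ⟨trivial, rfl, trivial, trivial, h4⟩⟩

theorem core₁_inf_borel : borel ⊤ ⊓ core₁ K = borel (diagSq K) := by
  ext g
  constructor
  · rintro ⟨h2, h1⟩
    obtain ⟨l, m, e, u, v, w, h3, h4, h5, h6, -, rfl⟩ := affSub_inf_quadSub_le h1 h2
    exact quadPerm_mem_quadSub.2 ⟨h4, rfl, Ideal.zero_mem _, h5, h6⟩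
  · rintro ⟨l, m, d, e, u, v, w, h1, h2, h3, h4, rfl⟩
    exact ⟨quadPerm_mem_quadSub.2 ⟨trivial, rfl, h2, trivial, h4⟩,
      quadPerm_mem_affSub.2 ⟨Ideal.mem_bot.1 h2, h1, rfl, h4⟩⟩

theorem core₂_inf_borel : borel ⊤ ⊓ core₂ K = borel (diagSq K) := by
  ext g
  constructor
  · rintro ⟨⟨l, m, d, e, u, v, w, h1, h2, h3, h4, rfl⟩, h⟩
    exact quadPerm_mem_quadSub.2 ⟨(quadPerm_mem_quadSub.1 h).1, rfl, h2, h3, h4⟩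
  · rintro ⟨l, m, d, e, u, v, w, h1, h2, h3, h4, rfl⟩
    exact ⟨quadPerm_mem_quadSub.2 ⟨trivial, rfl, h2, trivial, h4⟩,
      quadPerm_mem_quadSub.2 ⟨h1, rfl, trivial, h3, h4⟩⟩

theorem slPart_inf_borel : slPart K ⊓ borel (diagSq K) = borel (diagOne K) := by
  ext g
  constructor
  · rintro ⟨h1, h2⟩
    obtain ⟨l, m, e, u, v, w, h3, h4, h5, h6, -, rfl⟩ := affSub_inf_quadSub_le h1 h2
    exact quadPerm_mem_quadSub.2 ⟨h4, rfl, Ideal.zero_mem _, h5, h6⟩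
  · rintro ⟨l, m, d, e, u, v, w, h1, h2, h3, h4, rfl⟩
    have h1' : l * m = 1 := h1
    exact ⟨quadPerm_mem_affSub.2 ⟨Ideal.mem_bot.1 h2, h1, rfl, h4⟩,
      quadPerm_mem_quadSub.2 ⟨mem_diagSq.2 (by rw [h1', one_pow]), rfl, h2, h3, h4⟩⟩

theorem borel_mono {Λ Λ' : Subgroup (Kˣ × Kˣ)} (h : Λ ≤ Λ') : borel Λ ≤ borel Λ' :=
  quadSub_mono h le_rfl le_rfl le_rfl

theorem borel_le_stab₁ (Λ : Subgroup (Kˣ × Kˣ)) : borel Λ ≤ stab₁ K :=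
  (borel_mono le_top).trans (stab_inf.ge.trans inf_le_left)

theorem borel_le_stab₂ (Λ : Subgroup (Kˣ × Kˣ)) : borel Λ ≤ stab₂ K :=
  (borel_mono le_top).trans (stab_inf.ge.trans inf_le_right)

theorem scal_le_borel (Λ : Subgroup (Kˣ × Kˣ)) : scal Λ ≤ borel Λ :=
  quadSub_mono le_rfl le_rfl bot_le le_rfl

theorem slPart_le_stab₁ : slPart K ≤ stab₁ K := affSub_mono le_top le_rfl
theorem core₁_le_stab₁ : core₁ K ≤ stab₁ K := affSub_mono le_top le_rfl
theorem slPart_le_core₁ : slPart K ≤ core₁ K := affSub_mono bot_le le_rfl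
theorem core₂_le_stab₂ : core₂ K ≤ stab₂ K := quadSub_mono le_top le_rfl le_rfl le_rfl

/-! ### Conjugation -/

/-- Read off from gx = yg. In the normality proofs only the twist, the diagonal and the quadratic
coefficient decide membership. -/
theorem quadPerm_conj {l m l' m' l'' m'' : Kˣ} {φ φ' φ'' : RingAut K}
    {d e u v w d' e' u' v' w' d'' e'' u'' v'' w'' : K}
    (h : quadPerm l m φ d e u v w * quadPerm l' m' φ' d' e' u' v' w' *
      (quadPerm l m φ d e u v w)⁻¹ = quadPerm l'' m'' φ'' d'' e'' u'' v'' w'') (hφ : φ' = 1) :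
    φ'' = 1 ∧ l'' = umap φ l' ∧ m'' = umap φ m' ∧ l * φ d' + d * φ m' ^ 2 = l'' * d + d'' * m ^ 2 := by
  subst hφ
  rw [mul_inv_eq_iff_eq_mul, quadPerm_mul, quadPerm_mul] at h
  obtain ⟨h1, h2, h3, h4, -⟩ := quadPerm_inj h
  have hφ'' : φ'' = 1 := by rw [mul_one] at h3; exact right_eq_mul.1 h3
  subst hφ''
  refine ⟨rfl, ?_, ?_, h4⟩
  · have : l * umap φ l' = l'' * l := h1
    rw [mul_comm] at this
    exact (mul_right_cancel this).symm
  · have : m * umap φ m' = m'' * m := h2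
    rw [mul_comm] at this
    exact (mul_right_cancel this).symm

theorem affPerm_conj {M M' M'' : GL (Fin 2) K} {φ φ' φ'' : RingAut K} {t t' t'' : Fin 2 → K}
    {w w' w'' : K} (h : affPerm M φ t w * affPerm M' φ' t' w' * (affPerm M φ t w)⁻¹ =
      affPerm M'' φ'' t'' w'') (hφ : φ' = 1) : φ'' = 1 ∧ M'' = M * gmap φ M' * M⁻¹ := by
  subst hφ
  rw [mul_inv_eq_iff_eq_mul, affPerm_mul, affPerm_mul] at h
  obtain ⟨h1, h2, -⟩ := affPerm_inj h
  have hφ'' : φ'' = 1 := by rw [mul_one] at h2; exact right_eq_mul.1 h2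
  subst hφ''
  refine ⟨rfl, ?_⟩
  have : M * gmap φ M' = M'' * M := h1
  rw [this, mul_inv_cancel_right]

/-- The conjugate is known in advance to lie in P, so it can be put in normal form before parameters
are compared, and no inverse has to be computed. -/
theorem isNormalIn_of_conj_mem {G : Type*} [Group G] {N P : Subgroup G} (h : N ≤ P)
    (hc : ∀ g ∈ P, ∀ x ∈ N, ∀ y ∈ P, g * x * g⁻¹ = y → y ∈ N) : IsNormalIn N P :=
  ⟨h, fun g hg x hx => hc g hg x hx _ (P.mul_mem (P.mul_mem hg (h hx)) (P.inv_mem hg)) rfl⟩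

/-- Square determinants mean no twist; conjugation then changes the determinant only by a power of
the Frobenius. -/
theorem affSub_normal {D : Subgroup Kˣ} (hD : D ≤ sqUnits K) :
    IsNormalIn (affSub D (twistThree K)) (stab₁ K) := by
  refine isNormalIn_of_conj_mem (affSub_mono le_top le_rfl) ?_
  rintro _ ⟨M, t, w, -, hw, rfl⟩ _ ⟨M', t', w', hM', hw', rfl⟩ _ ⟨M'', t'', w'', -, hw'', rfl⟩ h
  obtain ⟨h1, h2⟩ := affPerm_conj h (chi_of_eq_one (hD hM'))
  refine ⟨M'', t'', w'', ?_, hw'', rfl⟩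
  rw [h2, map_mul, map_mul, map_inv, det_gmap, mul_inv_cancel_comm]
  exact umap_chi_mem hM' _

theorem core₂_normal : IsNormalIn (core₂ K) (stab₂ K) := by
  refine isNormalIn_of_conj_mem core₂_le_stab₂ ?_
  rintro _ ⟨l, m, d, e, u, v, w, -, -, -, hw, rfl⟩
    _ ⟨l', m', d', e', u', v', w', h', -, -, hw', rfl⟩
    _ ⟨l'', m'', d'', e'', u'', v'', w'', -, -, -, hw'', rfl⟩ h
  obtain ⟨h1, h2, h3, -⟩ := quadPerm_conj h (chi_of_eq_one h')
  refine ⟨l'', m'', d'', e'', u'', v'', w'', chi_eq_one_iff.1 h1, trivial, trivial, hw'', rfl⟩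

theorem diagKer_le_diagSq : diagKer K ≤ diagSq K := by
  rintro ⟨l, m⟩ ⟨h1, h2⟩
  have h1' : l = m ^ 2 := h1
  have h2' : m ^ 4 = 1 := h2
  rw [mem_diagSq, h1', ← pow_succ, ← pow_mul, mul_comm, pow_mul, h2', one_pow]

theorem diagScalar_le_diagSq : diagScalar K ≤ diagSq K := by
  rintro ⟨l, m⟩ h1
  have h1' : l = m := h1
  rw [mem_diagSq, h1', ← pow_two, ← pow_mul]
  exact unit_pow_eight m

theorem diagOne_le_diagSq : diagOne K ≤ diagSq K := by
  rintro ⟨l, m⟩ h1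
  have h1' : l * m = 1 := h1
  rw [mem_diagSq, h1', one_pow]

/-- The relation l' = m'² is exactly what cancels the quadratic coefficient of the conjugating
element, leaving d''m² = 0. -/
theorem borel_diagKer_normal : IsNormalIn (borel (diagKer K)) (stab₂ K) := by
  refine isNormalIn_of_conj_mem (borel_le_stab₂ _) ?_
  rintro _ ⟨l, m, d, e, u, v, w, -, -, -, hw, rfl⟩
    _ ⟨l', m', d', e', u', v', w', h', hd', -, hw', rfl⟩
    _ ⟨l'', m'', d'', e'', u'', v'', w'', -, -, -, hw'', rfl⟩ h
  have hl' : l' = m' ^ 2 := h'.1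
  obtain ⟨h1, h2, h3, h4⟩ := quadPerm_conj h (chi_of_eq_one (diagKer_le_diagSq h'))
  refine ⟨l'', m'', d'', e'', u'', v'', w'', ?_, ?_, trivial, hw'', rfl⟩
  · rw [h2, h3]
    exact umap_chi_mem_prod h' _
  · rw [Ideal.mem_bot] at hd' ⊢
    rw [h2, hl', hd', coe_umap, Units.val_pow_eq_pow_val, map_pow, map_zero] at h4
    have : d'' * (m : K) ^ 2 = 0 := by linear_combination -h4
    exact (mul_eq_zero.1 this).resolve_right (pow_ne_zero 2 m.ne_zero)

theorem tri_scalar_comm (κ : Kˣ) (M : GL (Fin 2) K) : M * tri κ κ 0 = tri κ κ 0 * M := by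
  ext i j
  fin_cases i <;> fin_cases j <;> simp [Matrix.mul_apply, Fin.sum_univ_two, coe_tri, mul_comm]

theorem gmap_tri (φ : RingAut K) (l m : Kˣ) (e : K) :
    gmap φ (tri l m e) = tri (umap φ l) (umap φ m) (φ e) := by
  ext i j
  rw [coe_gmap, coe_tri, coe_tri]
  fin_cases i <;> fin_cases j <;> simp

theorem tri_inj {l m l' m' : Kˣ} {e e' : K} (h : tri l m e = tri l' m' e') :
    l = l' ∧ m = m' ∧ e = e' := by
  have h' := congrArg Units.val h
  rw [coe_tri, coe_tri] at h'
  have h00 := congrFun (congrFun h' 0) 0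
  have h01 := congrFun (congrFun h' 0) 1
  have h11 := congrFun (congrFun h' 1) 1
  exact ⟨Units.ext (by simpa using h00), Units.ext (by simpa using h11), by simpa using h01⟩

theorem scal_diagScalar_normal : IsNormalIn (scal (diagScalar K)) (stab₁ K) := by
  refine isNormalIn_of_conj_mem ((scal_le_borel _).trans (borel_le_stab₁ _)) ?_
  rintro _ ⟨M, t, w, -, hw, rfl⟩ _ ⟨l', m', d', e', u', v', w', h', hd', he', hw', rfl⟩
    _ ⟨M'', t'', w'', -, hw'', rfl⟩ h
  have hl' : l' = m' := h'
  rw [Ideal.mem_bot] at hd' he'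
  subst hl' hd' he'
  rw [quadPerm_zero] at h
  obtain ⟨h1, h2⟩ := affPerm_conj h (chi_of_eq_one (diagScalar_le_diagSq h'))
  rw [gmap_tri, map_zero, tri_scalar_comm, mul_inv_cancel_right] at h2
  have : t'' = ![t'' 0, t'' 1] := by ext i; fin_cases i <;> rfl
  rw [h1, h2, this, ← quadPerm_zero, scal, quadPerm_mem_quadSub]
  refine ⟨rfl, ?_, Ideal.zero_mem _, Ideal.zero_mem _, hw''⟩
  rw [chi_of_eq_one]
  rw [← pow_two, ← pow_mul]
  exact unit_pow_eight _

end PermK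

namespace PermK

open Matrix

/-! ### Transvections generate the matrices of determinant one -/

section Transvections

variable {K : Type} [Field K]

/-- The lower unitriangular matrix with corner `x`. -/
noncomputable def low (x : K) : GL (Fin 2) K :=
  GeneralLinearGroup.mk' !![1, 0; x, 1]
    (by rw [Matrix.det_fin_two_of, mul_one, zero_mul, sub_zero]; exact invertibleOne)

variable (K) in
/-- The matrix of a quarter turn. -/
noncomputable def turn : GL (Fin 2) K :=
  GeneralLinearGroup.mk' !![0, 1; -1, 0]
    (by rw [Matrix.det_fin_two_of]; simpa using invertibleOne)

theorem coe_low (x : K) : (low x).1 = !![1, 0; x, 1] := rfl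

theorem coe_turn : (turn K).1 = !![0, 1; -1, 0] := rfl

theorem det_low (x : K) : GeneralLinearGroup.det (low x) = 1 := by
  ext
  rw [coe_det, coe_low]
  simp

theorem det_turn : GeneralLinearGroup.det (turn K) = 1 := by
  ext
  rw [coe_det, coe_turn]
  simp

theorem turn_conj_tri (e : K) : turn K * tri 1 1 (-e) * (turn K)⁻¹ = low e := by
  rw [mul_inv_eq_iff_eq_mul]
  ext i j
  fin_cases i <;> fin_cases j <;>
    simp [Matrix.mul_apply, Fin.sum_univ_two, coe_tri, coe_low, coe_turn]

/-- If the lower left entry is non-zero, the matrix is a product upper · lower · upper. Otherwise a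
lower transvection on the left makes it non-zero. -/
theorem mem_of_det_eq_one {S : Subgroup (GL (Fin 2) K)} (hu : ∀ e, tri 1 1 e ∈ S)
    (hl : ∀ x, low x ∈ S) {M : GL (Fin 2) K} (hM : GeneralLinearGroup.det M = 1) : M ∈ S := by
  have main : ∀ M : GL (Fin 2) K, GeneralLinearGroup.det M = 1 → M.1 1 0 ≠ 0 → M ∈ S := by
    intro M hM hz
    have hd : M.1 0 0 * M.1 1 1 - M.1 0 1 * M.1 1 0 = 1 := by rw [← coe_det, hM, Units.val_one]
    have : M = tri 1 1 ((M.1 0 0 - 1) / M.1 1 0) * low (M.1 1 0) *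
        tri 1 1 ((M.1 1 1 - 1) / M.1 1 0) := by
      ext i j
      fin_cases i <;> fin_cases j
      · simp [Matrix.mul_apply, Fin.sum_univ_two, coe_tri, coe_low]
        field_simp; ring
      · simp [Matrix.mul_apply, Fin.sum_univ_two, coe_tri, coe_low]
        field_simp; linear_combination -hd
      · simp [Matrix.mul_apply, Fin.sum_univ_two, coe_tri, coe_low]
      · simp [Matrix.mul_apply, Fin.sum_univ_two, coe_tri, coe_low]
        field_simp; ring
    rw [this]
    exact S.mul_mem (S.mul_mem (hu _) (hl _)) (hu _)
  by_cases hz : M.1 1 0 = 0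
  · have h1 := main (low 1 * M) (by rw [map_mul, det_low, hM, one_mul]) (by
      have hd : M.1 0 0 * M.1 1 1 - M.1 0 1 * M.1 1 0 = 1 := by rw [← coe_det, hM, Units.val_one]
      have : M.1 0 0 ≠ 0 := by
        intro h
        rw [h, hz] at hd
        simp at hd
      simpa [Matrix.mul_apply, Fin.sum_univ_two, coe_low, hz] using this)
    exact (S.mul_mem_cancel_left (hl 1)).1 h1
  · exact main M hM hz

end Transvections

variable {K : Type} [Field K] [Finite K] [CharP K 3] [hK : Fact (Nat.card K = 9)]

variable (K) in
/-- The embedding of `AGL_2(K)`. -/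
noncomputable def aglHom : AGL 2 K →* Equiv.Perm (K × K × K) where
  toFun x := affPerm x.right 1 x.left.toAdd 0
  map_one' := affPerm_one
  map_mul' x y := by
    rw [affPerm_mul]
    have h1 : gmap 1 y.right = y.right := by ext i j; rfl
    rw [h1]
    congr 1
    · ext i
      have : (x * y).left.toAdd = x.left.toAdd + x.right.1.mulVec y.left.toAdd := rfl
      rw [this]
      fin_cases i <;> simp [add_comm]
    · simp

theorem aglHom_inr (M : GL (Fin 2) K) : aglHom K (SemidirectProduct.inr M) = affPerm M 1 0 0 := rfl

theorem aglHom_injective : Function.Injective (aglHom K) := by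
  intro x y h
  obtain ⟨h1, -, h2, -⟩ := affPerm_inj h
  exact SemidirectProduct.ext h2 h1

theorem affPerm_eq_mul (M : GL (Fin 2) K) (t : Fin 2 → K) (w : K) :
    affPerm M 1 t w = affPerm 1 1 t w * affPerm M 1 0 0 := by
  rw [affPerm_mul]
  have h1 : gmap 1 M = M := by ext i j; rfl
  rw [h1, one_mul, one_mul]
  congr 1
  · ext i; simp
  · simp

theorem affPerm_trans_eq (t : Fin 2 → K) (w : K) :
    affPerm 1 1 t w = quadPerm 1 1 1 0 0 (t 0) (t 1) w := by
  rw [quadPerm_zero]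
  congr 1
  · ext i j; fin_cases i <;> fin_cases j <;> simp [coe_tri]
  · ext i; fin_cases i <;> rfl

theorem umap_one_right (φ : RingAut K) : umap φ 1 = 1 := map_one _

theorem umap_one_left (x : Kˣ) : umap 1 x = x := rfl

theorem mem_bot_pair {l m : Kˣ} : (l, m) ∈ (⊥ : Subgroup (Kˣ × Kˣ)) ↔ l = 1 ∧ m = 1 := by
  rw [Subgroup.mem_bot]
  exact Prod.mk_eq_one

/-! ### Largest normal subgroups of the edge stabilizer -/

theorem linear_mem_stab₁ {M : GL (Fin 2) K} (h : GeneralLinearGroup.det M = 1) :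
    affPerm M 1 0 0 ∈ stab₁ K := by
  rw [stab₁, affPerm_mem_affSub]
  exact ⟨trivial, by rw [h, map_one], AddSubgroup.zero_mem _⟩

theorem tau_mem_stab₂ (d : K) : quadPerm 1 1 1 d 0 0 0 0 ∈ stab₂ K := by
  rw [stab₂, quadPerm_mem_quadSub]
  exact ⟨trivial, by rw [mul_one, map_one], trivial, trivial, AddSubgroup.zero_mem _⟩

theorem borel_conj_linear {l m : Kˣ} {φ : RingAut K} {e u v w : K} {M : GL (Fin 2) K}
    (h : (affPerm M 1 0 0)⁻¹ * quadPerm l m φ 0 e u v w * affPerm M 1 0 0 ∈ borel ⊤) :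
    ∃ l' m' : Kˣ, ∃ e', tri l m e * gmap φ M = M * tri l' m' e' := by
  obtain ⟨l', m', d', e', u', v', w', -, hd', -, -, hx⟩ := h
  rw [Ideal.mem_bot] at hd'
  subst hd'
  rw [mul_assoc, inv_mul_eq_iff_eq_mul, quadPerm_zero, quadPerm_zero, affPerm_mul,
    affPerm_mul] at hx
  obtain ⟨h1, -⟩ := affPerm_inj hx
  exact ⟨_, _, _, h1⟩

/-- The linear part has to stay triangular under conjugation by the quarter turn, which kills e, and
by a lower transvection, which forces l = m. -/
theorem largestNormal_stab₁ : largestNormal (borel ⊤) (stab₁ K) = scal (diagScalar K) := by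
  apply le_antisymm
  · intro g hg
    obtain ⟨-, hg⟩ := bicosetGraph.mem_largestNormal_iff.1 hg
    have h0 := hg 1 (Subgroup.one_mem _)
    rw [inv_one, one_mul, mul_one] at h0
    obtain ⟨l, m, d, e, u, v, w, -, hd, -, hw, rfl⟩ := h0
    rw [Ideal.mem_bot] at hd
    subst hd
    obtain ⟨l₁, m₁, e₁, h1⟩ := borel_conj_linear (hg _ (linear_mem_stab₁ det_turn))
    have he : e = 0 := by
      have := congrArg (fun M : GL (Fin 2) K => M.1 0 0) h1
      simpa [Matrix.mul_apply, Fin.sum_univ_two, coe_tri, coe_turn, coe_gmap] using this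
    subst he
    obtain ⟨l₂, m₂, e₂, h2⟩ := borel_conj_linear (hg _ (linear_mem_stab₁ (det_low 1)))
    have hl : (l : K) = l₂ := by
      have := congrArg (fun M : GL (Fin 2) K => M.1 0 0) h2
      simpa [Matrix.mul_apply, Fin.sum_univ_two, coe_tri, coe_low, coe_gmap] using this
    have hm : (m : K) = l₂ := by
      have := congrArg (fun M : GL (Fin 2) K => M.1 1 0) h2
      simpa [Matrix.mul_apply, Fin.sum_univ_two, coe_tri, coe_low, coe_gmap] using this
    have hlm : l = m := Units.ext (hl.trans hm.symm)
    exact quadPerm_mem_quadSub.2 ⟨hlm, rfl, Ideal.zero_mem _, Ideal.zero_mem _, hw⟩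
  · exact le_sSup ⟨(scal_le_borel _).trans (borel_mono le_top), scal_diagScalar_normal⟩

/-- Conjugation by τ_x must not create a quadratic term: l·χ(lm)(x) = x·m² for all x. The case x = 1
gives l = m²; then χ(lm) = 1, so m³ and hence m is a square. -/
theorem largestNormal_stab₂ : largestNormal (borel ⊤) (stab₂ K) = borel (diagKer K) := by
  apply le_antisymm
  · intro g hg
    obtain ⟨-, hg⟩ := bicosetGraph.mem_largestNormal_iff.1 hg
    have h0 := hg 1 (Subgroup.one_mem _)
    rw [inv_one, one_mul, mul_one] at h0
    obtain ⟨l, m, d, e, u, v, w, -, hd, -, hw, rfl⟩ := h0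
    rw [Ideal.mem_bot] at hd
    subst hd
    have key : ∀ x : K, (l : K) * chi (l * m) x = x * (m : K) ^ 2 := by
      intro x
      obtain ⟨l', m', d', e', u', v', w', -, hd', -, -, hx⟩ := hg _ (tau_mem_stab₂ x)
      rw [Ideal.mem_bot] at hd'
      subst hd'
      rw [mul_assoc, inv_mul_eq_iff_eq_mul, quadPerm_mul, quadPerm_mul] at hx
      obtain ⟨-, h2, -, h4, -⟩ := quadPerm_inj hx
      have h2' : m = m' := by
        rwa [umap_one_right, mul_one, one_mul, umap_one_left] at h2
      rw [← h2'] at h4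
      have h5 : (1 : RingAut K) (m : K) = m := rfl
      rw [h5] at h4
      simpa using h4
    have hl : (l : K) = (m : K) ^ 2 := by simpa using key 1
    have hchi : chi (l * m) = 1 := by
      ext x
      have := key x
      rw [hl, mul_comm x] at this
      exact mul_left_cancel₀ (pow_ne_zero 2 m.ne_zero) this
    have hl' : l = m ^ 2 := Units.ext hl
    refine quadPerm_mem_quadSub.2 ⟨⟨hl', ?_⟩, rfl, Ideal.zero_mem _, trivial, hw⟩
    rw [hl', chi_eq_one_iff, ← pow_succ, ← pow_mul] at hchi
    have h8 := unit_pow_eight m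
    change m ^ 4 = 1
    calc m ^ 4 = m ^ ((2 + 1) * 4) := by
          rw [show (2 + 1) * 4 = 8 + 4 by norm_num, pow_add, h8, one_mul]
      _ = 1 := hchi
  · exact le_sSup ⟨borel_mono le_top, borel_diagKer_normal⟩

/-! ### Cores for the prime three -/

theorem unip_pow_three (e u v w : K) : (quadPerm 1 1 1 0 e u v w) ^ 3 = 1 := by
  have h1 : ∀ x : K, (1 : RingAut K) x = x := fun _ => rfl
  have h3 := three_eq_zero (K := K)
  rw [pow_succ, pow_two, quadPerm_mul, quadPerm_mul, ← quadPerm_one]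
  simp only [map_one, h1, one_mul, Units.val_one]
  congr 1
  · ring
  · linear_combination e * h3
  · linear_combination (u + e * v) * h3
  · linear_combination v * h3
  · linear_combination w * h3

theorem borel_pow {l m : Kˣ} {e u v w : K} (n : ℕ) : ∃ e' u' v' w',
    (quadPerm l m 1 0 e u v w) ^ n = quadPerm (l ^ n) (m ^ n) 1 0 e' u' v' w' := by
  induction n with
  | zero => exact ⟨0, 0, 0, 0, by rw [pow_zero, pow_zero, pow_zero, quadPerm_one]⟩
  | succ n ih =>
    obtain ⟨e', u', v', w', h⟩ := ih
    refine ⟨l ^ n * e + e' * m, l ^ n * u + e' * v + u', m ^ n * v + v',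
      (l ^ n * m ^ n : K) ^ 6 * w + w', ?_⟩
    have h1 : ∀ x : K, (1 : RingAut K) x = x := fun _ => rfl
    rw [pow_succ, h, quadPerm_mul, umap_one_left, umap_one_left, ← pow_succ, ← pow_succ, mul_one]
    simp only [h1, mul_zero, zero_mul, add_zero, Units.val_pow_eq_pow_val]
    congr 1
    ring

/-- The part with trivial diagonal is normal of exponent 3, and eighth powers fall into it because
K* has order 8. The assumption on Λ removes the twist. -/
theorem pCore_quadSub {Λ : Subgroup (Kˣ × Kˣ)} (hΛ : Λ ≤ diagSq K) (J : Ideal K) :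
    pCore 3 (quadSub Λ (bot_le : (⊥ : Ideal K) ≤ J) (twistThree K)) =
      quadSub ⊥ (bot_le : (⊥ : Ideal K) ≤ J) (twistThree K) := by
  apply pCore_eq_of_pow_mem
  · refine isNormalIn_of_conj_mem (quadSub_mono bot_le le_rfl le_rfl le_rfl) ?_
    rintro _ ⟨l, m, d, e, u, v, w, -, hd, -, hw, rfl⟩
      _ ⟨l', m', d', e', u', v', w', h', -, -, hw', rfl⟩
      _ ⟨l'', m'', d'', e'', u'', v'', w'', -, hd'', he'', hw'', rfl⟩ h
    have h'' := mem_bot_pair.1 h'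
    obtain ⟨h1, h2, h3, h4⟩ := quadPerm_conj h (by rw [h''.1, h''.2, mul_one, map_one])
    refine ⟨l'', m'', d'', e'', u'', v'', w'', ?_, hd'', he'', hw'', rfl⟩
    rw [h2, h3, h''.1, h''.2, umap_one_right]
    exact Subgroup.one_mem _
  · rintro ⟨_, ⟨l, m, d, e, u, v, w, h', hd, -, hw, rfl⟩⟩
    have h'' := mem_bot_pair.1 h'
    rw [Ideal.mem_bot] at hd
    refine ⟨1, Subtype.ext ?_⟩
    change (quadPerm l m (chi (l * m)) d e u v w) ^ 3 = 1
    rw [hd, h''.1, h''.2, mul_one, map_one]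
    exact unip_pow_three e u v w
  · rintro g hg
    obtain ⟨l, m, d, e, u, v, w, h', hd, -, hw, rfl⟩ := id hg
    refine ⟨8, by norm_num, ?_⟩
    rw [Ideal.mem_bot] at hd
    subst hd
    have hmem := Subgroup.pow_mem _ hg 8
    rw [chi_of_eq_one (mem_diagSq.1 (hΛ h'))] at hmem ⊢
    obtain ⟨e', u', v', w', h⟩ := borel_pow (l := l) (m := m) (e := e) (u := u) (v := v) (w := w) 8
    rw [h, quadPerm_mem_quadSub] at hmem
    rw [h, quadPerm_mem_quadSub, unit_pow_eight, unit_pow_eight]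
    exact ⟨Subgroup.one_mem _, by rw [mul_one, map_one], hmem.2.2⟩

theorem pCore_borel {Λ : Subgroup (Kˣ × Kˣ)} (hΛ : Λ ≤ diagSq K) :
    pCore 3 (borel Λ) = borel ⊥ := pCore_quadSub hΛ ⊤

theorem pCore_scal {Λ : Subgroup (Kˣ × Kˣ)} (hΛ : Λ ≤ diagSq K) :
    pCore 3 (scal Λ) = scal ⊥ := pCore_quadSub hΛ ⊥

theorem trans_mem_scal {t : Fin 2 → K} {w : K} (hw : w ∈ (twistThree K).grp) :
    affPerm 1 1 t w ∈ scal (⊥ : Subgroup (Kˣ × Kˣ)) := by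
  rw [affPerm_trans_eq, scal, quadPerm_mem_quadSub]
  exact ⟨Subgroup.one_mem _, by rw [mul_one, map_one], Ideal.zero_mem _, Ideal.zero_mem _, hw⟩

theorem scal_bot_le_borel_bot : scal (⊥ : Subgroup (Kˣ × Kˣ)) ≤ borel ⊥ := scal_le_borel _

/-- Commuting with the translations of the plane forces trivial linear part, hence trivial twist. -/
theorem stab₁_inf_centralizer :
    stab₁ K ⊓ Subgroup.centralizer (scal (⊥ : Subgroup (Kˣ × Kˣ)) : Set (Equiv.Perm (K × K × K))) ≤
      scal ⊥ := by
  rintro _ ⟨⟨M, t, w, -, hw, rfl⟩, hc⟩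
  replace hc := Subgroup.mem_centralizer_iff.1 hc
  have key : ∀ t' : Fin 2 → K, ∀ i, t i + t' i =
      M.1 i 0 * chi (GeneralLinearGroup.det M) (t' 0) +
        M.1 i 1 * chi (GeneralLinearGroup.det M) (t' 1) + t i := by
    intro t' i
    have h := hc _ (trans_mem_scal (t := t') (AddSubgroup.zero_mem _))
    rw [affPerm_mul, affPerm_mul] at h
    have h2 := congrFun (affPerm_inj h).2.2.1 i
    have h1 : ∀ x : K, (1 : RingAut K) x = x := fun _ => rfl
    rw [← h2]
    fin_cases i <;> simp [h1]
  have k1 := key ![1, 0]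
  have k2 := key ![0, 1]
  have hM : M = 1 := by
    ext i j
    fin_cases i <;> fin_cases j
    · have := k1 0; simp at this ⊢; linear_combination -this
    · have := k2 0; simpa [add_comm] using this.symm
    · have := k1 1; simpa [add_comm] using this.symm
    · have := k2 1; simp at this ⊢; linear_combination -this
  subst hM
  rw [map_one, map_one]
  exact trans_mem_scal hw

theorem unip_mem_borel {e u v w : K} (hw : w ∈ (twistThree K).grp) :
    quadPerm 1 1 1 0 e u v w ∈ borel (⊥ : Subgroup (Kˣ × Kˣ)) := by
  rw [borel, quadPerm_mem_quadSub]
  exact ⟨Subgroup.one_mem _, by rw [mul_one, map_one], Ideal.zero_mem _, trivial, hw⟩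

theorem om_mem : (om K : K) ∈ (twistThree K).grp := mem_twistThree.2 (Or.inr (Or.inl rfl))

/-- Plane translations force l = m = 1. The translation of the third coordinate by ω forces d = 0
through the term d³c; here it matters that W is not zero. -/
theorem stab₂_inf_centralizer :
    stab₂ K ⊓ Subgroup.centralizer (borel (⊥ : Subgroup (Kˣ × Kˣ)) : Set (Equiv.Perm (K × K × K))) ≤
      borel ⊥ := by
  rintro _ ⟨⟨l, m, d, e, u, v, w, -, -, -, hw, rfl⟩, hc⟩
  replace hc := Subgroup.mem_centralizer_iff.1 hc
  have key : ∀ u' v' w', w' ∈ (twistThree K).grp →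
      u + u' = l * chi (l * m) u' + e * chi (l * m) v' + d * chi (l * m) v' ^ 2 +
        d ^ 3 * l ^ 6 * chi (l * m) w' + u ∧ v + v' = m * chi (l * m) v' + v := by
    intro u' v' w' hw'
    have h := hc _ (unip_mem_borel (e := 0) (u := u') (v := v') hw')
    rw [quadPerm_mul, quadPerm_mul] at h
    obtain ⟨-, -, -, -, -, h6, h7, -⟩ := quadPerm_inj h
    have h1 : ∀ x : K, (1 : RingAut K) x = x := fun _ => rfl
    rw [← h6, ← h7]
    constructor <;> simp [h1]
  have hm : m = 1 := by
    ext
    have := (key 0 1 0 (AddSubgroup.zero_mem _)).2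
    simpa [add_comm] using this.symm
  have hl : l = 1 := by
    ext
    have := (key 1 0 0 (AddSubgroup.zero_mem _)).1
    simpa [add_comm] using this.symm
  subst hm hl
  have hd : d = 0 := by
    have := (key 0 0 (om K) om_mem).1
    have h2 : u + 0 = u + d ^ 3 * chi (1 * 1 : Kˣ) (om K : K) := by
      rw [this]; simp [add_comm]
    have h3 : d ^ 3 * chi (1 * 1 : Kˣ) (om K : K) = 0 := (add_left_cancel h2).symm
    rcases mul_eq_zero.1 h3 with h | h
    · exact pow_eq_zero_iff three_ne_zero |>.1 h
    · exact absurd ((map_eq_zero_iff _ (RingEquiv.injective _)).1 h) (om K).ne_zero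
  subst hd
  rw [mul_one, map_one]
  exact unip_mem_borel hw

/-! ### Closures under conjugation -/

theorem conjClosure_le_of_normal {G : Type*} [Group G] {B P N : Subgroup G} (hB : B ≤ N)
    (hN : IsNormalIn N P) : conjClosure B P ≤ N := by
  refine (Subgroup.closure_le N).2 ?_
  rintro _ ⟨g, hg, b, hb, rfl⟩
  have := hN.2 g⁻¹ (P.inv_mem hg) b (hB hb)
  rwa [inv_inv] at this

theorem conj_mem_conjClosure {G : Type*} [Group G] {B P : Subgroup G} {g b : G} (hg : g ∈ P)
    (hb : b ∈ B) : g * b * g⁻¹ ∈ conjClosure B P :=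
  Subgroup.subset_closure ⟨g⁻¹, P.inv_mem hg, b, hb, by rw [inv_inv]⟩

theorem le_conjClosure {G : Type*} [Group G] (B P : Subgroup G) : B ≤ conjClosure B P := fun b hb =>
  by simpa using conj_mem_conjClosure (P := P) P.one_mem hb

theorem conjClosure_mono {G : Type*} [Group G] {B B' P : Subgroup G} (h : B ≤ B') :
    conjClosure B P ≤ conjClosure B' P := by
  refine (Subgroup.closure_le _).2 ?_
  rintro _ ⟨g, hg, b, hb, rfl⟩
  exact Subgroup.subset_closure ⟨g, hg, b, h hb, rfl⟩

theorem borel_bot_le_slPart : borel (⊥ : Subgroup (Kˣ × Kˣ)) ≤ slPart K := by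
  rintro _ ⟨l, m, d, e, u, v, w, h, hd, -, hw, rfl⟩
  have h'' := mem_bot_pair.1 h
  exact quadPerm_mem_affSub.2 ⟨Ideal.mem_bot.1 hd, by rw [h''.1, h''.2, mul_one]; exact Subgroup.one_mem _,
    rfl, hw⟩

/-- The upper transvections and their conjugates under the quarter turn generate the linear part;
the translations are already in the group. -/
theorem conjClosure_borel_bot : conjClosure (borel (⊥ : Subgroup (Kˣ × Kˣ))) (stab₁ K) = slPart K := by
  apply le_antisymm (conjClosure_le_of_normal borel_bot_le_slPart (affSub_normal bot_le))
  rintro _ ⟨M, t, w, hM, hw, rfl⟩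
  have hM' : GeneralLinearGroup.det M = 1 := hM
  rw [hM', map_one, affPerm_eq_mul]
  have hu : ∀ e : K, affPerm (tri 1 1 e) 1 0 0 ∈ borel (⊥ : Subgroup (Kˣ × Kˣ)) := by
    intro e
    have : affPerm (tri 1 1 e) 1 0 0 = quadPerm 1 1 1 0 e 0 0 0 := by
      rw [quadPerm_zero]
      congr 1
      ext i; fin_cases i <;> rfl
    rw [this]
    exact unip_mem_borel (AddSubgroup.zero_mem _)
  refine Subgroup.mul_mem _ (le_conjClosure _ _ (scal_bot_le_borel_bot (trans_mem_scal hw))) ?_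
  let S := (conjClosure (borel (⊥ : Subgroup (Kˣ × Kˣ))) (stab₁ K)).comap
    ((aglHom K).comp SemidirectProduct.inr)
  have : M ∈ S := by
    refine mem_of_det_eq_one (fun e : K => show affPerm (tri 1 1 e) 1 0 0 ∈ conjClosure _ _ from
      le_conjClosure _ _ (hu e)) (fun e => ?_) hM'
    have h := conj_mem_conjClosure (linear_mem_stab₁ det_turn) (hu (-e))
    rw [← aglHom_inr, ← aglHom_inr, ← map_inv, ← map_inv, ← map_mul, ← map_mul, ← map_mul,
      ← map_mul, turn_conj_tri] at h
    exact h
  exact this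

theorem diag_mem_borel {Λ : Subgroup (Kˣ × Kˣ)} {l m : Kˣ} (h : (l, m) ∈ Λ) (h1 : (l * m) ^ 4 = 1) :
    quadPerm l m 1 0 0 0 0 0 ∈ borel Λ := by
  rw [borel, quadPerm_mem_quadSub]
  exact ⟨h, (chi_of_eq_one h1).symm, Ideal.zero_mem _, trivial, AddSubgroup.zero_mem _⟩

theorem borel_diagSq_le_core₁ : borel (diagSq K) ≤ core₁ K :=
  core₁_inf_borel.ge.trans inf_le_right

theorem borel_diagSq_le_core₂ : borel (diagSq K) ≤ core₂ K :=
  core₂_inf_borel.ge.trans inf_le_right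

/-- Splitting off diag(det M, 1), which lies in B, leaves a factor of determinant one. -/
theorem conjClosure_borel_core₁ : conjClosure (borel (diagSq K)) (stab₁ K) = core₁ K := by
  apply le_antisymm (conjClosure_le_of_normal borel_diagSq_le_core₁ (affSub_normal le_rfl))
  rintro _ ⟨M, t, w, hM, hw, rfl⟩
  have hM4 : GeneralLinearGroup.det M ^ 4 = 1 := hM
  obtain ⟨x, hx⟩ : ∃ x, x = GeneralLinearGroup.det M := ⟨_, rfl⟩
  rw [← hx] at hM4 ⊢
  rw [chi_of_eq_one hM4]
  have h1 : ∀ x : K, (1 : RingAut K) x = x := fun _ => rfl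
  have hg : gmap (1 : RingAut K) (tri x 1 0) = tri x 1 0 := by ext i j; rfl
  have hmul : affPerm M 1 t w = affPerm (M * (tri x 1 0)⁻¹) 1 t w * quadPerm x 1 1 0 0 0 0 0 := by
    rw [quadPerm_zero, affPerm_mul, hg, inv_mul_cancel_right]
    congr 1
    · ext i; simp [h1]
    · simp
  rw [hmul]
  refine Subgroup.mul_mem _ ?_ (le_conjClosure _ _ (diag_mem_borel (mem_diagSq.2 ?_) ?_))
  · refine conjClosure_mono (borel_mono bot_le) ?_
    rw [conjClosure_borel_bot, slPart, affPerm_mem_affSub]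
    have : GeneralLinearGroup.det (M * (tri x 1 0)⁻¹) = 1 := by
      rw [map_mul, map_inv, det_tri, ← hx, mul_one, mul_inv_cancel]
    rw [this, map_one]
    exact ⟨Subgroup.one_mem _, rfl, hw⟩
  · rwa [mul_one]
  · rwa [mul_one]

theorem conjClosure_borel_core₂ : conjClosure (borel (diagSq K)) (stab₂ K) = core₂ K := by
  apply le_antisymm (conjClosure_le_of_normal borel_diagSq_le_core₂ core₂_normal)
  rintro _ ⟨l, m, d, e, u, v, w, hlm, -, -, hw, rfl⟩
  have h4 : (l * m) ^ 4 = 1 := hlm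
  have h1 : ∀ x : K, (1 : RingAut K) x = x := fun _ => rfl
  have h3 := three_eq_zero (K := K)
  rw [chi_of_eq_one h4]
  have htau : ∀ x : K, quadPerm 1 1 1 x 0 0 0 0 ∈ conjClosure (borel (diagSq K)) (stab₂ K) := by
    intro x
    -- The scalar -1 inverts τ_x. Its conjugate under τ_{-x} is therefore τ_{-2x}·(-1) = τ_x·(-1),
    -- and this exhibits τ_x.
    have hb : quadPerm (-1) (-1) 1 0 0 0 0 0 ∈ borel (diagSq K) :=
      diag_mem_borel (mem_diagSq.2 (by norm_num)) (by norm_num)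
    have hc := conj_mem_conjClosure (tau_mem_stab₂ (-x)) hb
    have hmul : quadPerm 1 1 1 (-x) 0 0 0 0 * quadPerm (-1) (-1) 1 0 0 0 0 0 *
        (quadPerm 1 1 1 (-x) 0 0 0 0)⁻¹ =
        quadPerm 1 1 1 x 0 0 0 0 * quadPerm (-1) (-1) 1 0 0 0 0 0 := by
      rw [mul_inv_eq_iff_eq_mul, quadPerm_mul, quadPerm_mul, quadPerm_mul]
      simp only [map_one, h1, one_mul, mul_one, Units.val_one, mul_zero, zero_mul, add_zero,
        Units.val_neg, zero_add, umap_one_left]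
      congr 1
      · linear_combination (-x) * h3
      · ring
    rw [hmul] at hc
    exact (Subgroup.mul_mem_cancel_right _ (le_conjClosure _ _ hb)).1 hc
  have hmul : quadPerm l m 1 d e u v w = quadPerm 1 1 1 (d * ((m : K) ^ 2)⁻¹) 0 0 0 0 *
      quadPerm l m 1 0 (e - 2 * (d * ((m : K) ^ 2)⁻¹) * m * v)
        (u - (d * ((m : K) ^ 2)⁻¹) * v ^ 2 - (d * ((m : K) ^ 2)⁻¹) ^ 3 * w) v w := by
    have hm : (m : K) ≠ 0 := m.ne_zero
    rw [quadPerm_mul]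
    simp only [h1, one_mul, mul_one, Units.val_one, mul_zero, zero_mul, add_zero,
        zero_add, one_pow]
    congr 1
    · field_simp
    · ring
    · ring
  rw [hmul]
  refine Subgroup.mul_mem _ (htau _) (le_conjClosure _ _ ?_)
  rw [borel, quadPerm_mem_quadSub]
  exact ⟨hlm, (chi_of_eq_one h4).symm, Ideal.zero_mem _, trivial, hw⟩

theorem borel_diagSq_eq_mul : (borel (diagSq K) : Set (Equiv.Perm (K × K × K))) =
    (borel (diagOne K) : Set (Equiv.Perm (K × K × K))) * (borel (diagKer K) : Set _) := by
  apply Set.Subset.antisymm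
  · rintro _ ⟨l, m, d, e, u, v, w, hlm, hd, -, hw, rfl⟩
    have h4 : (l * m) ^ 4 = 1 := hlm
    rw [Ideal.mem_bot] at hd
    subst hd
    rw [chi_of_eq_one h4]
    have h1 : ∀ x : K, (1 : RingAut K) x = x := fun _ => rfl
    -- Since (lm)⁹ = lm, this is the cube root of lm, and diag(μ², μ) has determinant μ³ = lm.
    obtain ⟨μ, hμ⟩ : ∃ μ, μ = (l * m) ^ 3 := ⟨_, rfl⟩
    have hμ3 : μ ^ 3 = l * m := by
      rw [hμ, ← pow_mul, show 3 * 3 = 8 + 1 by norm_num, pow_succ, unit_pow_eight, one_mul]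
    have hμ4 : μ ^ 4 = 1 := by rw [hμ, ← pow_mul, show 3 * 4 = 4 * 3 by norm_num, pow_mul, h4, one_pow]
    have hker : (μ ^ 2, μ) ∈ diagKer K := ⟨rfl, hμ4⟩
    refine ⟨quadPerm (l * (μ ^ 2)⁻¹) (m * μ⁻¹) 1 0 (e * ((μ⁻¹ : Kˣ) : K)) u v w, ?_,
      quadPerm (μ ^ 2) μ 1 0 0 0 0 0, diag_mem_borel hker (diagKer_le_diagSq hker), ?_⟩
    · have : l * (μ ^ 2)⁻¹ * (m * μ⁻¹) = 1 := by
        rw [mul_mul_mul_comm, ← hμ3, ← mul_inv, ← pow_succ, mul_inv_cancel]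
      refine quadPerm_mem_quadSub.2 ⟨mem_diagOne.2 this, ?_, Ideal.zero_mem _, trivial, hw⟩
      rw [this, map_one]
    · change quadPerm (l * (μ ^ 2)⁻¹) (m * μ⁻¹) 1 0 (e * ((μ⁻¹ : Kˣ) : K)) u v w *
        quadPerm (μ ^ 2) μ 1 0 0 0 0 0 = _
      rw [quadPerm_mul]
      have e1 : umap 1 (μ ^ 2) = μ ^ 2 := rfl
      have e2 : umap 1 μ = μ := rfl
      rw [e1, e2, inv_mul_cancel_right, inv_mul_cancel_right]
      simp only [h1, mul_zero, mul_one, add_zero, zero_mul, zero_add]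
      congr 1
      rw [mul_assoc, Units.inv_mul, mul_one]
  · rintro _ ⟨x, hx, y, hy, rfl⟩
    exact Subgroup.mul_mem _ (borel_mono diagOne_le_diagSq hx) (borel_mono diagKer_le_diagSq hy)

/-- For minimality, a candidate contains T₂ and so its 3-core. By the closure condition in `stab₁`
it then contains the determinant-one triangular maps, and these together with T₂ make up B. -/
theorem isCoreBase_borel : IsCoreBase (stab₁ K) (stab₂ K) (borel (diagSq K)) := by
  constructor
  · refine ⟨?_, ?_, ?_, ?_⟩
    · rw [stab_inf]; exact borel_mono le_top
    · rw [stab_inf, largestNormal_stab₁, largestNormal_stab₂]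
      exact sup_le ((scal_le_borel _).trans (borel_mono diagScalar_le_diagSq))
        (borel_mono diagKer_le_diagSq)
    · rw [stab_inf, conjClosure_borel_core₁, core₁_inf_borel]
    · rw [stab_inf, conjClosure_borel_core₂, core₂_inf_borel]
  · rintro C ⟨-, h2, h3, -⟩
    rw [stab_inf, largestNormal_stab₁, largestNormal_stab₂] at h2
    rw [stab_inf] at h3
    have hker : borel (diagKer K) ≤ C := le_sup_right.trans h2
    have hone : borel (diagOne K) ≤ C := by
      rw [h3, ← slPart_inf_borel]
      refine le_inf (inf_le_right.trans (borel_mono le_top)) (inf_le_left.trans ?_)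
      rw [← conjClosure_borel_bot]
      exact conjClosure_mono ((borel_mono bot_le).trans hker)
    intro x hx
    have hx' : x ∈ (borel (diagSq K) : Set (Equiv.Perm (K × K × K))) := hx
    rw [borel_diagSq_eq_mul] at hx'
    obtain ⟨a, ha, b, hb, rfl⟩ := hx'
    exact C.mul_mem (hone ha) (hker hb)

/-- Central elements are translations by `stab₁_inf_centralizer`, and the scalar -1 excludes any
plane component. -/
theorem centerOf_slPart : centerOf (slPart K) = thirdTrans K := by
  have h1 : ∀ x : K, (1 : RingAut K) x = x := fun _ => rfl
  apply le_antisymm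
  · rintro g ⟨hg, hc⟩
    have hg' : g ∈ scal (⊥ : Subgroup (Kˣ × Kˣ)) := by
      refine stab₁_inf_centralizer ⟨slPart_le_stab₁ hg, ?_⟩
      exact Subgroup.centralizer_le
        (scal_bot_le_borel_bot.trans borel_bot_le_slPart) hc
    obtain ⟨l, m, d, e, u, v, w, h, hd, he, hw, rfl⟩ := hg'
    have h'' := mem_bot_pair.1 h
    rw [Ideal.mem_bot] at hd he
    obtain ⟨rfl, rfl⟩ := h''
    subst hd he
    rw [mul_one, map_one] at hc ⊢
    have hneg : quadPerm (-1) (-1) 1 0 0 0 0 0 ∈ slPart K := by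
      rw [slPart, quadPerm_mem_affSub]
      have : (-1 : Kˣ) * -1 = 1 := by norm_num
      rw [this, map_one]
      exact ⟨rfl, Subgroup.one_mem _, rfl, AddSubgroup.zero_mem _⟩
    replace hc := Subgroup.mem_centralizer_iff.1 hc
    have h := hc _ hneg
    rw [quadPerm_mul, quadPerm_mul] at h
    obtain ⟨-, -, -, -, -, h6, h7, -⟩ := quadPerm_inj h
    have h3 := three_eq_zero (K := K)
    have hu : u = 0 := by
      simp [h1] at h6
      linear_combination h6 + u * h3
    have hv : v = 0 := by
      simp [h1] at h7
      linear_combination h7 + v * h3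
    subst hu hv
    refine ⟨w, hw, ?_⟩
    rw [affPerm_trans_eq]
    rfl
  · rintro _ ⟨w, hw, rfl⟩
    refine ⟨scal_bot_le_borel_bot.trans borel_bot_le_slPart (trans_mem_scal hw), ?_⟩
    refine Subgroup.mem_centralizer_iff.2 ?_
    rintro _ ⟨M, t, w', hM, -, rfl⟩
    have hM' : GeneralLinearGroup.det M = 1 := hM
    rw [hM', map_one, affPerm_mul, affPerm_mul]
    have hg : gmap (1 : RingAut K) M = M := by ext i j; rfl
    have hg' : gmap (1 : RingAut K) 1 = 1 := map_one _
    rw [hg, hg', hM', map_one]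
    simp only [mul_one, one_mul, Units.val_one, one_pow, h1, Pi.zero_apply, mul_zero, add_zero,
      zero_add]
    congr 1
    · ext i; simp only [Matrix.one_apply]; fin_cases i <;> simp
    · exact add_comm _ _

/-- Membership in T₁ ∩ T₂ makes the diagonal satisfy l = m = m² and kills e, so g and all its
conjugates are translations. The three coordinates are then eliminated in the order v, u, w. -/
theorem stab_core {g : Equiv.Perm (K × K × K)}
    (hg : ∀ h ∈ stab₁ K ⊔ stab₂ K, h⁻¹ * g * h ∈ stab₁ K ⊓ stab₂ K) : g = 1 := by
  have h1 : ∀ x : K, (1 : RingAut K) x = x := fun _ => rfl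
  rw [stab_inf] at hg
  obtain ⟨P, hP⟩ : ∃ P, P = stab₁ K ⊔ stab₂ K := ⟨_, rfl⟩
  rw [← hP] at hg
  have hP1 : stab₁ K ≤ P := hP ▸ le_sup_left
  have hP2 : stab₂ K ≤ P := hP ▸ le_sup_right
  have step : ∀ g, (∀ h ∈ P, h⁻¹ * g * h ∈ borel (⊤ : Subgroup (Kˣ × Kˣ))) →
      ∃ u v w, w ∈ (twistThree K).grp ∧ g = quadPerm 1 1 1 0 0 u v w := by
    intro g hg
    have g0 : g ∈ borel (⊤ : Subgroup (Kˣ × Kˣ)) := by simpa using hg 1 P.one_mem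
    have k1 : g ∈ scal (diagScalar K) := by
      rw [← largestNormal_stab₁, bicosetGraph.mem_largestNormal_iff]
      exact ⟨borel_le_stab₁ _ g0, fun q hq => hg q (hP1 hq)⟩
    have k2 : g ∈ borel (diagKer K) := by
      rw [← largestNormal_stab₂, bicosetGraph.mem_largestNormal_iff]
      exact ⟨borel_le_stab₂ _ g0, fun q hq => hg q (hP2 hq)⟩
    obtain ⟨l, m, d, e, u, v, w, h, hd, he, hw, rfl⟩ := k1
    rw [Ideal.mem_bot] at hd he
    have hlm : l = m := h
    have hl : l = m ^ 2 := (quadPerm_mem_quadSub.1 k2).1.1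
    have hm : m = 1 := by
      rw [hlm, pow_two] at hl
      exact left_eq_mul.1 hl
    subst hd he hlm hm
    exact ⟨u, v, w, hw, by rw [mul_one, map_one]⟩
  have conj : ∀ g, (∀ h ∈ P, h⁻¹ * g * h ∈ borel (⊤ : Subgroup (Kˣ × Kˣ))) → ∀ q ∈ P,
      ∀ h ∈ P, h⁻¹ * (q⁻¹ * g * q) * h ∈ borel (⊤ : Subgroup (Kˣ × Kˣ)) := by
    intro g hg q hq h hh
    have := hg (q * h) (P.mul_mem hq hh)
    simpa [mul_assoc] using this
  -- Conjugation by τ₁ turns a translation of b by v into a shear with coefficient 2v up to sign,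
  -- and shears are excluded by `step`.
  have step2 : ∀ u v w, (∀ h ∈ P, h⁻¹ * quadPerm 1 1 1 0 0 u v w * h ∈
      borel (⊤ : Subgroup (Kˣ × Kˣ))) → v = 0 := by
    intro u v w hg
    obtain ⟨u', v', w', -, h⟩ := step _ (conj _ hg _ (hP2 (tau_mem_stab₂ 1)))
    rw [mul_assoc, inv_mul_eq_iff_eq_mul, quadPerm_mul, quadPerm_mul] at h
    obtain ⟨-, -, -, -, h5, -, h7, -⟩ := quadPerm_inj h
    simp [h1] at h5 h7
    rcases h5 with h | h
    · exact absurd (show (-1 : K) = 1 by linear_combination -h) neg_one_ne_one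
    · rw [h7, h]
  obtain ⟨u, v, w, hw, rfl⟩ := step g hg
  have hv := step2 u v w hg
  subst hv
  have hu : u = 0 := by
    have hc := conj _ hg _ (hP1 (linear_mem_stab₁ det_turn))
    obtain ⟨u', v', w', -, h⟩ := step _ hc
    rw [h] at hc
    have hv' := step2 _ _ _ hc
    subst hv'
    rw [mul_assoc, inv_mul_eq_iff_eq_mul, quadPerm_zero, quadPerm_zero, affPerm_mul, affPerm_mul] at h
    have := congrFun (affPerm_inj h).2.2.1 0
    simpa [h1, coe_tri, coe_turn] using this
  subst hu
  -- Conjugation by τ₁ moves w into the first coordinate, and the quarter turn moves that into the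
  -- second, where `step2` applies.
  have hw0 : w = 0 := by
    have hc := conj _ hg _ (hP2 (tau_mem_stab₂ 1))
    have hc2 := conj _ hc _ (hP1 (linear_mem_stab₁ det_turn))
    obtain ⟨u', v', w', -, h⟩ := step _ hc
    rw [h] at hc hc2
    obtain ⟨u'', v'', w'', -, h2⟩ := step _ hc2
    rw [h2] at hc2
    have hv'' := step2 _ _ _ hc2
    rw [mul_assoc, inv_mul_eq_iff_eq_mul, quadPerm_zero, quadPerm_zero, affPerm_mul, affPerm_mul] at h2
    have h3 := congrFun (affPerm_inj h2).2.2.1 0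
    simp [h1, coe_tri, coe_turn, hv''] at h3
    rw [mul_assoc, inv_mul_eq_iff_eq_mul, quadPerm_mul, quadPerm_mul] at h
    obtain ⟨-, -, -, -, -, h6, h7, h8⟩ := quadPerm_inj h
    simp [h1, h3] at h6 h7 h8
    rw [← h7] at h6
    rw [h8]
    simpa using h6.symm
  rw [hw0, ← quadPerm_one]

end PermK

namespace bicosetGraph

theorem FiveArcData.subgroupOf {X : Type} [Group X] {P₁ P₂ P : Subgroup X} {s t : X}
    (h : FiveArcData P₁ P₂ s t) (h₁ : P₁ ≤ P) (h₂ : P₂ ≤ P) :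
    FiveArcData (P₁.subgroupOf P) (P₂.subgroupOf P) ⟨s, h₁ h.s_mem⟩ ⟨t, h₂ h.t_mem⟩ where
  s_mem := h.s_mem
  t_mem := h.t_mem
  move₀ x hx hx' := by
    obtain ⟨k, hk, hk'⟩ := h.move₀ x hx hx'
    exact ⟨⟨k, h₁ hk.1⟩, hk, hk'⟩
  move₃ x hx hx' := by
    obtain ⟨k, hk, hk'⟩ := h.move₃ x hx hx'
    exact ⟨⟨k, h₁ hk.1⟩, hk, hk'⟩
  move₄ x hx hx' := by
    obtain ⟨k, hk, hk'⟩ := h.move₄ x hx hx'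
    exact ⟨⟨k, h₁ hk.1⟩, hk, hk'⟩
  move₅ x hx hx' := by
    obtain ⟨k, hk, hk'⟩ := h.move₅ x hx hx'
    exact ⟨⟨k, h₁ hk.1⟩, hk, hk'⟩

end bicosetGraph

namespace PermK

open Matrix

variable {K : Type} [Field K] [Finite K] [CharP K 3] [hK : Fact (Nat.card K = 9)]

/-! ### Transitivity on arcs -/

variable (K) in
/-- The quarter turn as a permutation. -/
noncomputable def turnPerm : Equiv.Perm (K × K × K) := affPerm (turn K) 1 0 0

variable (K) in
/-- The quadratic permutation with coefficient one. -/
noncomputable def tauPerm : Equiv.Perm (K × K × K) := quadPerm 1 1 1 1 0 0 0 0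

theorem turnPerm_mem : turnPerm K ∈ stab₁ K := linear_mem_stab₁ det_turn

theorem tauPerm_mem : tauPerm K ∈ stab₂ K := tau_mem_stab₂ 1

theorem quadPerm_mem_stab₂ {l m : Kˣ} {d e u v w : K} (hw : w ∈ (twistThree K).grp) :
    quadPerm l m (chi (l * m)) d e u v w ∈ stab₂ K :=
  quadPerm_mem_quadSub.2 ⟨trivial, rfl, trivial, trivial, hw⟩

theorem quadPerm_mem_borel {l m : Kˣ} {e u v w : K} (hw : w ∈ (twistThree K).grp) :
    quadPerm l m (chi (l * m)) 0 e u v w ∈ borel (⊤ : Subgroup (Kˣ × Kˣ)) :=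
  quadPerm_mem_quadSub.2 ⟨trivial, rfl, Ideal.zero_mem _, trivial, hw⟩

/-- Left multiplication by τ₁⁻¹ subtracts m² from the quadratic coefficient. The condition d = m²
thus describes the coset of τ₁. -/
theorem tauPerm_inv_mul_mem {l m : Kˣ} {φ : RingAut K} {d e u v w : K}
    (hmem : quadPerm l m φ d e u v w ∈ stab₂ K) (hd : d = (m : K) ^ 2) :
    (tauPerm K)⁻¹ * quadPerm l m φ d e u v w ∈ stab₁ K := by
  obtain ⟨l', m', d', e', u', v', w', -, -, -, hw, h⟩ :=
    Subgroup.mul_mem _ (Subgroup.inv_mem _ tauPerm_mem) hmem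
  rw [h]
  rw [inv_mul_eq_iff_eq_mul, tauPerm, quadPerm_mul] at h
  obtain ⟨-, h2, -, h4, -⟩ := quadPerm_inj h
  rw [umap_one_left, one_mul] at h2
  subst h2
  have hd' : d' = 0 := by
    have h1 : ∀ x : K, (1 : RingAut K) x = x := fun _ => rfl
    rw [h1, h1, hd, Units.val_one] at h4
    linear_combination -h4
  subst hd'
  exact borel_le_stab₁ _ (quadPerm_mem_borel hw)

theorem affPerm_mem_borel {M : GL (Fin 2) K} {φ : RingAut K} {t : Fin 2 → K} {w : K}
    (hmem : affPerm M φ t w ∈ stab₁ K) (hM : M.1 1 0 = 0) :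
    affPerm M φ t w ∈ borel (⊤ : Subgroup (Kˣ × Kˣ)) := by
  obtain ⟨-, hφ, hw⟩ := affPerm_mem_affSub.1 hmem
  obtain ⟨l, m, e, rfl⟩ := eq_tri hM
  have : t = ![t 0, t 1] := by ext i; fin_cases i <;> rfl
  rw [this, ← quadPerm_zero, hφ, det_tri]
  exact quadPerm_mem_borel hw

/-- The inverse quarter turn moves the upper left entry of M to the lower left, up to no sign
change, so its vanishing makes the product triangular. -/
theorem turnPerm_inv_mul_mem {M : GL (Fin 2) K} {φ : RingAut K} {t : Fin 2 → K} {w : K}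
    (hmem : affPerm M φ t w ∈ stab₁ K) (hM : M.1 0 0 = 0) :
    (turnPerm K)⁻¹ * affPerm M φ t w ∈ stab₂ K := by
  have hmem' := Subgroup.mul_mem _ (Subgroup.inv_mem _ turnPerm_mem) hmem
  obtain ⟨M', t', w', -, hw, h⟩ := id hmem'
  rw [h] at hmem' ⊢
  refine borel_le_stab₂ _ (affPerm_mem_borel hmem' ?_)
  rw [inv_mul_eq_iff_eq_mul, turnPerm, affPerm_mul] at h
  have h1 := (affPerm_inj h).1
  have h2 := congrArg (fun M : GL (Fin 2) K => M.1 0 0) h1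
  simp only [hM, Units.val_mul, Matrix.mul_apply, Fin.sum_univ_two, coe_turn, coe_gmap] at h2
  simpa using h2.symm

/-- For a square take μ = x³, as x⁹ = x; for a non-square take μ = x. This solves the twisted
equation that arises for the fifth vertex of an arc. -/
theorem exists_chi_apply_eq_cube (x : Kˣ) : ∃ μ : Kˣ, chi μ (x : K) = (μ : K) ^ 3 := by
  rcases chi_apply_cases x with ⟨h, -⟩ | ⟨h, -⟩
  · refine ⟨x ^ 3, ?_⟩
    rw [map_pow, h, one_pow, Units.val_pow_eq_pow_val, ← pow_mul]
    exact (pow_nine _).symm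
  · exact ⟨x, by rw [h, frob_apply]⟩

theorem one_apply_ringAut (x : K) : (1 : RingAut K) x = x := rfl

/-- Non-base neighbours of the base vertices are described by a non-zero quadratic coefficient or by
a non-zero lower left entry. Each move normalizes such a parameter with an element that fixes the
earlier vertices. -/
theorem fiveArcData : bicosetGraph.FiveArcData (stab₁ K) (stab₂ K) (turnPerm K) (tauPerm K) where
  s_mem := turnPerm_mem
  t_mem := tauPerm_mem
  move₀ := by
    rintro _ ⟨l, m, d, e, u, v, w, -, -, -, hw, rfl⟩ hn
    have hd : d ≠ 0 := by
      rintro rfl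
      exact hn (borel_le_stab₁ _ (quadPerm_mem_borel hw))
    -- diag(ν, ν⁻¹) replaces (d, m) by (νd, ν⁻¹m); the target condition νd = (ν⁻¹m)² is solvable
    -- because cubing is bijective on K*.
    obtain ⟨ν, hν⟩ : ∃ ν : Kˣ, (ν : K) ^ 3 * d = (m : K) ^ 2 := by
      refine ⟨(m ^ 2 * (Units.mk0 d hd)⁻¹) ^ 3, ?_⟩
      rw [Units.val_pow_eq_pow_val, ← pow_mul, pow_nine]
      simp [hd]
    have hk : quadPerm ν ν⁻¹ 1 0 0 0 0 0 ∈ borel (⊤ : Subgroup (Kˣ × Kˣ)) :=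
      diag_mem_borel trivial (by simp)
    refine ⟨_, stab_inf.ge hk, ?_⟩
    have hmem := Subgroup.mul_mem _ (borel_le_stab₂ _ hk)
      (quadPerm_mem_stab₂ (l := l) (m := m) (d := d) (e := e) (u := u) (v := v) hw)
    rw [quadPerm_mul] at hmem ⊢
    refine tauPerm_inv_mul_mem hmem ?_
    have hν0 : (ν : K) ≠ 0 := ν.ne_zero
    rw [umap_one_left, one_apply_ringAut, zero_mul, add_zero, Units.val_mul, Units.val_inv_eq_inv_val]
    field_simp
    linear_combination hν
  move₃ := by
    rintro _ ⟨M, t, w, -, hw, rfl⟩ hn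
    have hg : affPerm M (chi (GeneralLinearGroup.det M)) t w ∈ stab₁ K :=
      affPerm_mem_affSub.2 ⟨trivial, rfl, hw⟩
    have hM : M.1 1 0 ≠ 0 := fun h => hn (borel_le_stab₂ _ (affPerm_mem_borel hg h))
    -- This shear clears the upper left entry of M.
    have hk : quadPerm 1 1 1 0 (-(M.1 0 0 / M.1 1 0)) 0 0 0 ∈ borel (⊤ : Subgroup (Kˣ × Kˣ)) :=
      borel_mono bot_le (unip_mem_borel (AddSubgroup.zero_mem _))
    refine ⟨_, stab_inf.ge hk, ?_, ?_⟩
    · have hmem := Subgroup.mul_mem _ (borel_le_stab₂ _ hk) tauPerm_mem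
      rw [tauPerm, quadPerm_mul] at hmem
      nth_rw 2 [tauPerm]
      rw [quadPerm_mul]
      refine tauPerm_inv_mul_mem hmem ?_
      simp
    · have hmem := Subgroup.mul_mem _ (borel_le_stab₁ _ hk) hg
      rw [quadPerm_zero, affPerm_mul] at hmem ⊢
      refine turnPerm_inv_mul_mem hmem ?_
      simp only [Units.val_mul, Matrix.mul_apply, Fin.sum_univ_two, coe_tri, coe_gmap,
        one_apply_ringAut]
      simp
      field_simp
      ring
  move₄ := by
    rintro _ ⟨l, m, d, e, u, v, w, -, -, -, hw, rfl⟩ hn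
    have hd : d ≠ 0 := by
      rintro rfl
      exact hn (borel_le_stab₁ _ (quadPerm_mem_borel hw))
    -- The twisted diag(μ², μ) fixes the coset of τ₁, and the quarter turn changes it into diag(μ,
    -- μ²). With φ = χ(μ), the latter has to satisfy μφ(d) = (μ²φ(m))², that is φ(d/m²) = μ³.
    obtain ⟨μ, hμ⟩ := exists_chi_apply_eq_cube (Units.mk0 d hd * (m ^ 2)⁻¹)
    have hchi : chi (μ ^ 2 * μ) = chi μ := by
      rw [map_mul, chi_of_eq_one (x := μ ^ 2) (by rw [← pow_mul]; exact unit_pow_eight μ), one_mul]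
    have hchi' : chi (μ * μ ^ 2) = chi μ := by rw [mul_comm, hchi]
    have hk : quadPerm (μ ^ 2) μ (chi (μ ^ 2 * μ)) 0 0 0 0 0 ∈ borel (⊤ : Subgroup (Kˣ × Kˣ)) :=
      quadPerm_mem_borel (AddSubgroup.zero_mem _)
    have hk' : quadPerm μ (μ ^ 2) (chi (μ * μ ^ 2)) 0 0 0 0 0 ∈ borel (⊤ : Subgroup (Kˣ × Kˣ)) :=
      quadPerm_mem_borel (AddSubgroup.zero_mem _)
    have hks : (turnPerm K)⁻¹ * (quadPerm (μ ^ 2) μ (chi (μ ^ 2 * μ)) 0 0 0 0 0 * turnPerm K) =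
        quadPerm μ (μ ^ 2) (chi (μ * μ ^ 2)) 0 0 0 0 0 := by
      rw [inv_mul_eq_iff_eq_mul, quadPerm_zero, quadPerm_zero, turnPerm, affPerm_mul, affPerm_mul,
        hchi, hchi', mul_one, one_mul]
      congr 1
      · ext i j
        simp only [Units.val_mul, Matrix.mul_apply, Fin.sum_univ_two, coe_tri, coe_gmap,
          coe_turn]
        fin_cases i <;> fin_cases j <;> simp
      · ext i; fin_cases i <;> simp
      · simp
    refine ⟨_, stab_inf.ge hk, ?_, ?_, ?_⟩
    · have hmem := Subgroup.mul_mem _ (borel_le_stab₂ _ hk) tauPerm_mem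
      rw [tauPerm, quadPerm_mul] at hmem
      nth_rw 2 [tauPerm]
      rw [quadPerm_mul]
      refine tauPerm_inv_mul_mem hmem ?_
      simp
    · rw [hks]
      exact borel_le_stab₂ _ hk'
    · have hmem := Subgroup.mul_mem _ (borel_le_stab₂ _ hk')
        (quadPerm_mem_stab₂ (l := l) (m := m) (d := d) (e := e) (u := u) (v := v) hw)
      have hrw : ∀ k h : Equiv.Perm (K × K × K), (turnPerm K * tauPerm K)⁻¹ * (k * (turnPerm K * h)) =
          (tauPerm K)⁻¹ * ((turnPerm K)⁻¹ * (k * turnPerm K) * h) := by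
        intro k h; group
      rw [hrw, hks]
      rw [quadPerm_mul] at hmem ⊢
      refine tauPerm_inv_mul_mem hmem ?_
      rw [hchi']
      have h5 : (chi μ) d = (μ : K) ^ 3 * chi μ m ^ 2 := by
        rw [← hμ]
        rw [← map_pow, ← map_mul]
        simp
      rw [h5]
      simp
      ring
  move₅ := by
    rintro _ ⟨M, t, w, -, hw, rfl⟩ hn
    have hg : affPerm M (chi (GeneralLinearGroup.det M)) t w ∈ stab₁ K :=
      affPerm_mem_affSub.2 ⟨trivial, rfl, hw⟩
    have hM : M.1 1 0 ≠ 0 := fun h => hn (borel_le_stab₂ _ (affPerm_mem_borel hg h))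
    -- Translation of a by x becomes translation of b under the quarter turn, and then a shear with
    -- coefficient x, up to translations, under τ₁. The value of x makes that shear clear the upper
    -- left entry of M.
    obtain ⟨x, hx⟩ : ∃ x, x = -(M.1 0 0 / M.1 1 0) := ⟨_, rfl⟩
    have hk : quadPerm 1 1 1 0 0 x 0 0 ∈ borel (⊤ : Subgroup (Kˣ × Kˣ)) :=
      borel_mono bot_le (unip_mem_borel (AddSubgroup.zero_mem _))
    have hk' : quadPerm 1 1 1 0 0 0 x 0 ∈ borel (⊤ : Subgroup (Kˣ × Kˣ)) :=
      borel_mono bot_le (unip_mem_borel (AddSubgroup.zero_mem _))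
    have hy : quadPerm 1 1 1 0 x (-x ^ 2) x 0 ∈ borel (⊤ : Subgroup (Kˣ × Kˣ)) :=
      borel_mono bot_le (unip_mem_borel (AddSubgroup.zero_mem _))
    have hks : (turnPerm K)⁻¹ * (quadPerm 1 1 1 0 0 x 0 0 * turnPerm K) =
        quadPerm 1 1 1 0 0 0 x 0 := by
      rw [inv_mul_eq_iff_eq_mul, quadPerm_zero, quadPerm_zero, turnPerm, affPerm_mul, affPerm_mul]
      congr 1
      · ext i j
        simp only [Units.val_mul, Matrix.mul_apply, Fin.sum_univ_two, coe_tri, coe_gmap,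
          coe_turn, one_apply_ringAut]
        fin_cases i <;> fin_cases j <;> simp
      · ext i
        simp only [coe_tri, coe_turn, one_apply_ringAut]
        fin_cases i <;> simp
      · simp
    have hkt : (tauPerm K)⁻¹ * (quadPerm 1 1 1 0 0 0 x 0 * tauPerm K) =
        quadPerm 1 1 1 0 x (-x ^ 2) x 0 := by
      have h3 := three_eq_zero (K := K)
      rw [inv_mul_eq_iff_eq_mul, tauPerm, quadPerm_mul, quadPerm_mul]
      simp only [one_apply_ringAut, mul_one, one_mul, mul_zero, zero_mul, add_zero, zero_add,
        Units.val_one, one_pow, umap_one_left]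
      congr 1
      · linear_combination (-x) * h3
      · ring
    refine ⟨_, stab_inf.ge hk, ?_, ?_, ?_, ?_⟩
    · have hmem := Subgroup.mul_mem _ (borel_le_stab₂ _ hk) tauPerm_mem
      rw [tauPerm, quadPerm_mul] at hmem
      nth_rw 2 [tauPerm]
      rw [quadPerm_mul]
      refine tauPerm_inv_mul_mem hmem ?_
      simp
    · rw [hks]
      exact borel_le_stab₂ _ hk'
    · have hrw : ∀ k : Equiv.Perm (K × K × K),
          (turnPerm K * tauPerm K)⁻¹ * (k * (turnPerm K * tauPerm K)) =
          (tauPerm K)⁻¹ * ((turnPerm K)⁻¹ * (k * turnPerm K) * tauPerm K) := by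
        intro k; group
      rw [hrw, hks, hkt]
      exact borel_le_stab₁ _ hy
    · have hrw : ∀ k h : Equiv.Perm (K × K × K),
          (turnPerm K * tauPerm K * turnPerm K)⁻¹ * (k * (turnPerm K * tauPerm K * h)) =
          (turnPerm K)⁻¹ * ((tauPerm K)⁻¹ * ((turnPerm K)⁻¹ * (k * turnPerm K) * tauPerm K) * h) := by
        intro k h; group
      rw [hrw, hks, hkt]
      have hmem := Subgroup.mul_mem _ (borel_le_stab₁ _ hy) hg
      rw [quadPerm_zero, affPerm_mul] at hmem ⊢
      refine turnPerm_inv_mul_mem hmem ?_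
      simp only [Units.val_mul, Matrix.mul_apply, Fin.sum_univ_two, coe_tri, coe_gmap,
        one_apply_ringAut, hx]
      simp
      field_simp
      ring

/-! ### Orders and indices -/

/-- The parameters are unique, and the twist is determined by the diagonal; 81 counts the pairs (u,
v). -/
theorem card_quadSub (Λ : Subgroup (Kˣ × Kˣ)) {I J : Ideal K} (hIJ : I ≤ J) (W : TwistInv K) :
    Nat.card (quadSub Λ hIJ W) = Nat.card Λ * Nat.card I * Nat.card J * 81 * Nat.card W.grp := by
  have e : Λ × I × J × K × K × W.grp ≃ quadSub Λ hIJ W := by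
    refine Equiv.ofBijective (fun x => ⟨quadPerm x.1.1.1 x.1.1.2 (chi (x.1.1.1 * x.1.1.2)) x.2.1
      x.2.2.1 x.2.2.2.1 x.2.2.2.2.1 x.2.2.2.2.2, quadPerm_mem_quadSub.2
        ⟨x.1.2, rfl, x.2.1.2, x.2.2.1.2, x.2.2.2.2.2.2⟩⟩) ⟨?_, ?_⟩
    · rintro ⟨⟨⟨l, m⟩, h⟩, ⟨d, hd⟩, ⟨e, he⟩, u, v, ⟨w, hw⟩⟩
        ⟨⟨⟨l', m'⟩, h'⟩, ⟨d', hd'⟩, ⟨e', he'⟩, u', v', ⟨w', hw'⟩⟩ heq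
      obtain ⟨rfl, rfl, -, rfl, rfl, rfl, rfl, rfl⟩ := quadPerm_inj (Subtype.mk.inj heq)
      rfl
    · rintro ⟨_, l, m, d, e, u, v, w, h, hd, he, hw, rfl⟩
      exact ⟨⟨⟨⟨l, m⟩, h⟩, ⟨d, hd⟩, ⟨e, he⟩, u, v, ⟨w, hw⟩⟩, rfl⟩
  rw [← Nat.card_congr e]
  simp only [Nat.card_prod, hK.out]
  ring

theorem card_affSub (D : Subgroup Kˣ) (W : TwistInv K) :
    Nat.card (affSub D W) =
      Nat.card (D.comap (GeneralLinearGroup.det : GL (Fin 2) K →* Kˣ)) * 81 * Nat.card W.grp := by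
  have e : D.comap (GeneralLinearGroup.det : GL (Fin 2) K →* Kˣ) × (Fin 2 → K) × W.grp ≃
      affSub D W := by
    refine Equiv.ofBijective (fun x => ⟨affPerm x.1.1 (chi (GeneralLinearGroup.det x.1.1)) x.2.1
      x.2.2.1, affPerm_mem_affSub.2 ⟨x.1.2, rfl, x.2.2.2⟩⟩) ⟨?_, ?_⟩
    · rintro ⟨⟨M, h⟩, t, ⟨w, hw⟩⟩ ⟨⟨M', h'⟩, t', ⟨w', hw'⟩⟩ heq
      obtain ⟨rfl, -, rfl, rfl⟩ := affPerm_inj (Subtype.mk.inj heq)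
      rfl
    · rintro ⟨_, M, t, w, h, hw, rfl⟩
      exact ⟨⟨⟨M, h⟩, t, ⟨w, hw⟩⟩, rfl⟩
  rw [← Nat.card_congr e]
  simp only [Nat.card_prod, Nat.card_fun, hK.out, Nat.card_fin]
  ring

theorem card_GL : Nat.card (GL (Fin 2) K) = 5760 := by
  cases nonempty_fintype K
  rw [Matrix.card_GL_field, ← Nat.card_eq_fintype_card, hK.out]
  simp [Fin.prod_univ_two]

theorem card_detKer :
    Nat.card ((⊥ : Subgroup Kˣ).comap (GeneralLinearGroup.det : GL (Fin 2) K →* Kˣ)) = 720 := by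
  have h1 := Subgroup.card_mul_index
    ((⊥ : Subgroup Kˣ).comap (GeneralLinearGroup.det : GL (Fin 2) K →* Kˣ))
  have hsurj : Function.Surjective (GeneralLinearGroup.det : GL (Fin 2) K →* Kˣ) := fun x =>
    ⟨tri x 1 0, by rw [det_tri, mul_one]⟩
  rw [Subgroup.index_comap_of_surjective _ hsurj, Subgroup.index_bot, card_units_eq, card_GL] at h1
  omega

theorem card_topPair : Nat.card (⊤ : Subgroup (Kˣ × Kˣ)) = 64 := by
  rw [Subgroup.card_top, Nat.card_prod, card_units_eq]

theorem card_bot_ideal : Nat.card (⊥ : Ideal K) = 1 := by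
  exact Nat.card_unique

theorem card_top_ideal : Nat.card (⊤ : Ideal K) = 9 := by
  rw [← hK.out]
  exact Nat.card_congr (Equiv.subtypeUnivEquiv fun _ => trivial)

theorem card_twistTop : Nat.card (twistTop K).grp = 9 := by
  rw [← hK.out]
  exact Nat.card_congr (Equiv.subtypeUnivEquiv fun _ => trivial)

theorem relIndex_eq_of_card {G : Type*} [Group G] [Finite G] {H P : Subgroup G} {n : ℕ}
    (h : H ≤ P) (hc : Nat.card P = Nat.card H * n) : H.relIndex P = n := by
  have h1 := Subgroup.card_mul_index (H.subgroupOf P)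
  rw [Nat.card_congr (Subgroup.subgroupOfEquivOfLe h).toEquiv, hc] at h1
  exact Nat.eq_of_mul_eq_mul_left Nat.card_pos h1

theorem card_stab₁ : Nat.card (stab₁ K) = 5760 * 81 * 3 := by
  rw [stab₁, card_affSub, Subgroup.comap_top, Subgroup.card_top, card_GL, card_twistThree]

theorem card_borel_top : Nat.card (borel (⊤ : Subgroup (Kˣ × Kˣ))) = 64 * 9 * 81 * 3 := by
  rw [borel, card_quadSub, card_topPair, card_bot_ideal, card_top_ideal, card_twistThree]

theorem card_stab₂ : Nat.card (stab₂ K) = 64 * 9 * 9 * 81 * 3 := by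
  rw [stab₂, card_quadSub, card_topPair, card_top_ideal, card_twistThree]

theorem relIndex_stab₂_stab₁ : (stab₂ K).relIndex (stab₁ K) = 10 := by
  rw [← Subgroup.inf_relIndex_left, stab_inf]
  apply relIndex_eq_of_card (borel_le_stab₁ _)
  rw [card_stab₁, card_borel_top]

theorem relIndex_stab₁_stab₂ : (stab₁ K).relIndex (stab₂ K) = 9 := by
  rw [← Subgroup.inf_relIndex_right, stab_inf]
  apply relIndex_eq_of_card (borel_le_stab₂ _)
  rw [card_stab₂, card_borel_top]

theorem card_slPart : Nat.card (slPart K) = 3 ^ 7 * 80 := by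
  rw [slPart, card_affSub, card_detKer, card_twistThree]; norm_num

theorem card_borel_bot : Nat.card (borel (⊥ : Subgroup (Kˣ × Kˣ))) = 3 ^ 7 := by
  rw [borel, card_quadSub, Subgroup.card_bot, card_bot_ideal, card_top_ideal, card_twistThree]
  norm_num

theorem card_scal_bot : Nat.card (scal (⊥ : Subgroup (Kˣ × Kˣ))) = 3 ^ 5 := by
  rw [scal, card_quadSub, Subgroup.card_bot, card_bot_ideal, card_twistThree]
  norm_num

theorem umap_om_pow_four (φ : RingAut K) : umap φ (om K) ^ 4 = -1 := by
  rw [← map_pow, om_pow_four]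
  ext; simp

/-- Multiplication by the element with linear part diag(ω, 1) changes the sign of det(M)⁴, so it
exchanges the two classes. -/
theorem relIndex_core₁ : (core₁ K).relIndex (stab₁ K) = 2 := by
  rw [Subgroup.relIndex_eq_two_iff]
  have hne := unit_neg_one_ne_one (K := K)
  refine ⟨affPerm (tri (om K) 1 0) (chi (GeneralLinearGroup.det (tri (om K) 1 0))) 0 0,
    affPerm_mem_affSub.2 ⟨trivial, rfl, AddSubgroup.zero_mem _⟩, ?_⟩
  rintro _ ⟨M, t, w, -, hw, rfl⟩
  have hb : affPerm M (chi (GeneralLinearGroup.det M)) t w ∈ core₁ K ↔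
      GeneralLinearGroup.det M ^ 4 = 1 := by
    rw [core₁, affPerm_mem_affSub]
    exact ⟨fun h => h.1, fun h => ⟨h, rfl, hw⟩⟩
  have hba : affPerm M (chi (GeneralLinearGroup.det M)) t w *
      affPerm (tri (om K) 1 0) (chi (GeneralLinearGroup.det (tri (om K) 1 0))) 0 0 ∈ core₁ K ↔
      GeneralLinearGroup.det M ^ 4 = -1 := by
    rw [core₁, affPerm_mul, affPerm_mem_affSub, mem_sqUnits]
    rw [map_mul, det_gmap, det_tri, mul_one, mul_pow, umap_om_pow_four, map_mul, chi_umap, map_zero,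
      mul_zero, zero_add, mul_neg_one, neg_eq_iff_eq_neg]
    exact ⟨fun h => h.1, fun h => ⟨h, rfl, hw⟩⟩
  rw [hb, hba]
  rcases unit_pow_four (GeneralLinearGroup.det M) with h | h <;> rw [h]
  · exact Or.inr ⟨rfl, hne.symm⟩
  · exact Or.inl ⟨rfl, hne⟩

theorem relIndex_quadSub_diagSq {I J : Ideal K} (hIJ : I ≤ J) (W : TwistInv K) :
    (quadSub (diagSq K) hIJ W).relIndex (quadSub ⊤ hIJ W) = 2 := by
  rw [Subgroup.relIndex_eq_two_iff]
  have hne := unit_neg_one_ne_one (K := K)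
  have ha : quadPerm (om K) 1 (chi (om K * 1)) 0 0 0 0 0 ∈ quadSub ⊤ hIJ W :=
    quadPerm_mem_quadSub.2
      ⟨trivial, rfl, Ideal.zero_mem _, Ideal.zero_mem _, AddSubgroup.zero_mem _⟩
  refine ⟨_, ha, ?_⟩
  intro b hbm
  have hmem := Subgroup.mul_mem _ hbm ha
  obtain ⟨l, m, d, e, u, v, w, -, hd, he, hw, rfl⟩ := hbm
  have hb : quadPerm l m (chi (l * m)) d e u v w ∈ quadSub (diagSq K) hIJ W ↔
      (l * m) ^ 4 = 1 := by
    rw [quadPerm_mem_quadSub]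
    exact ⟨fun h => h.1, fun h => ⟨h, rfl, hd, he, hw⟩⟩
  have hba : quadPerm l m (chi (l * m)) d e u v w * quadPerm (om K) 1 (chi (om K * 1)) 0 0 0 0 0 ∈
      quadSub (diagSq K) hIJ W ↔ (l * m) ^ 4 = -1 := by
    rw [quadPerm_mul, quadPerm_mem_quadSub] at hmem
    rw [quadPerm_mul, quadPerm_mem_quadSub, mem_diagSq, umap_one_right, mul_one, mul_right_comm,
      mul_pow, umap_om_pow_four, mul_neg_one, neg_eq_iff_eq_neg]
    rw [umap_one_right, mul_one, mul_right_comm] at hmem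
    exact ⟨fun h => h.1, fun h => ⟨h, hmem.2⟩⟩
  rw [hb, hba]
  rcases unit_pow_four (l * m) with h | h <;> rw [h]
  · exact Or.inr ⟨rfl, hne.symm⟩
  · exact Or.inl ⟨rfl, hne⟩

theorem relIndex_core₂ : (core₂ K).relIndex (stab₂ K) = 2 := relIndex_quadSub_diagSq _ _

theorem relIndex_borel_diagSq : (borel (diagSq K)).relIndex (borel ⊤) = 2 :=
  relIndex_quadSub_diagSq _ _

/-! ### The containing amalgam -/

variable (K)

/-- The first group of the containing amalgam. -/
noncomputable def big₁ := affSub (⊤ : Subgroup Kˣ) (twistTop K)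

/-- The second group of the containing amalgam. -/
noncomputable def big₂ := quadSub (⊤ : Subgroup (Kˣ × Kˣ)) (le_refl (⊤ : Ideal K)) (twistTop K)

/-- The intersection of the groups of the containing amalgam. -/
noncomputable def bigBorel :=
  quadSub (⊤ : Subgroup (Kˣ × Kˣ)) (bot_le : (⊥ : Ideal K) ≤ ⊤) (twistTop K)

variable {K}

theorem stab₁_le_big₁ : stab₁ K ≤ big₁ K := affSub_mono le_rfl le_top

theorem stab₂_le_big₂ : stab₂ K ≤ big₂ K := quadSub_mono le_rfl le_rfl le_rfl le_top

theorem big_inf : big₁ K ⊓ big₂ K = bigBorel K := by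
  ext g
  constructor
  · rintro ⟨h1, h2⟩
    obtain ⟨l, m, e, u, v, w, h3, -, h5, h6, -, rfl⟩ := affSub_inf_quadSub_le h1 h2
    exact quadPerm_mem_quadSub.2 ⟨h3, rfl, Ideal.zero_mem _, h5, h6⟩
  · rintro ⟨l, m, d, e, u, v, w, h1, h2, h3, h4, rfl⟩
    rw [Ideal.mem_bot] at h2
    exact ⟨quadPerm_mem_affSub.2 ⟨h2, trivial, rfl, h4⟩,
      quadPerm_mem_quadSub.2 ⟨trivial, rfl, trivial, trivial, h4⟩⟩

theorem stab₁_inf_big : stab₁ K ⊓ (big₁ K ⊓ big₂ K) = borel ⊤ := by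
  apply le_antisymm
  · rintro g ⟨h1, -, h2⟩
    obtain ⟨l, m, e, u, v, w, h3, -, h5, h6, -, rfl⟩ := affSub_inf_quadSub_le h1 h2
    exact quadPerm_mem_borel h6
  · exact le_inf (borel_le_stab₁ _) (le_inf ((borel_le_stab₁ _).trans stab₁_le_big₁)
      ((borel_le_stab₂ _).trans stab₂_le_big₂))

theorem stab₂_inf_big : stab₂ K ⊓ (big₁ K ⊓ big₂ K) = borel ⊤ := by
  apply le_antisymm
  · rintro g ⟨h2, h1, -⟩
    obtain ⟨l, m, e, u, v, w, h3, -, h5, h6, h7, rfl⟩ := affSub_inf_quadSub_le h1 h2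
    exact quadPerm_mem_borel h7
  · exact le_inf (borel_le_stab₂ _) (le_inf ((borel_le_stab₁ _).trans stab₁_le_big₁)
      ((borel_le_stab₂ _).trans stab₂_le_big₂))

theorem relIndex_stab₁_big₁ : (stab₁ K).relIndex (big₁ K) = 3 := by
  apply relIndex_eq_of_card stab₁_le_big₁
  rw [stab₁, big₁, card_affSub, card_affSub, card_twistThree, card_twistTop]; ring

theorem relIndex_stab₂_big₂ : (stab₂ K).relIndex (big₂ K) = 3 := by
  apply relIndex_eq_of_card stab₂_le_big₂
  rw [stab₂, big₂, card_quadSub, card_quadSub, card_twistThree, card_twistTop]; ring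

theorem relIndex_borel_big : (borel ⊤).relIndex (big₁ K ⊓ big₂ K) = 3 := by
  rw [big_inf]
  apply relIndex_eq_of_card (quadSub_mono le_rfl le_rfl le_rfl le_top)
  rw [card_quadSub, card_quadSub, card_twistTop, card_twistThree]; ring

end PermK

/-! ### Affine groups and their subgroups -/

instance (n : ℕ) (K : Type) [Field K] [Finite K] : Finite (AGL n K) :=
  Finite.of_equiv _ SemidirectProduct.equivProd.symm

instance (n : ℕ) (K : Type) [Field K] [Finite K] : Finite (ASL n K) :=
  Finite.of_equiv _ SemidirectProduct.equivProd.symm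

namespace PermK

open Matrix

variable {K : Type} [Field K] [Finite K] [CharP K 3] [hK : Fact (Nat.card K = 9)]

theorem affPerm_third_mul (M : GL (Fin 2) K) (φ : RingAut K) (t : Fin 2 → K) (w w' : K) :
    affPerm 1 1 0 w * affPerm M φ t w' = affPerm M φ t (w' + w) := by
  rw [affPerm_mul]
  congr 1
  · rw [one_mul]; ext i j; rfl
  · ext i; fin_cases i <;> simp
  · simp

theorem affPerm_mul_third (M : GL (Fin 2) K) (φ : RingAut K) (t : Fin 2 → K) (w w' : K) :
    affPerm M φ t w' * affPerm 1 1 0 w =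
      affPerm M φ t ((GeneralLinearGroup.det M : K) ^ 6 * φ w + w') := by
  rw [affPerm_mul]
  congr 1
  · have : gmap φ 1 = 1 := map_one _
    rw [this, mul_one]
  · ext i; simp

theorem affPerm_mem_thirdTrans {M : GL (Fin 2) K} {φ : RingAut K} {t : Fin 2 → K} {w : K} :
    affPerm M φ t w ∈ thirdTrans K ↔ M = 1 ∧ φ = 1 ∧ t = 0 ∧ w ∈ (twistThree K).grp := by
  constructor
  · rintro ⟨w', hw', h⟩
    obtain ⟨rfl, rfl, rfl, rfl⟩ := affPerm_inj h
    exact ⟨rfl, rfl, rfl, hw'⟩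
  · rintro ⟨rfl, rfl, rfl, hw⟩
    exact ⟨w, hw, rfl⟩

/-- Covers all untwisted groups of plane affine maps extended by W. Determinants that are squares
act on W without twist, so W is normalized. -/
theorem isSplit_thirdTrans {A : Type*} [Group A] {ι : A →* AGL 2 K} (hι : Function.Injective ι)
    {P : Subgroup (Equiv.Perm (K × K × K))} (hP : ∀ g, g ∈ P ↔ ∃ a, ∃ w ∈ (twistThree K).grp,
      g = affPerm (ι a).right 1 (ι a).left.toAdd w)
    (hdet : ∀ a, GeneralLinearGroup.det (ι a).right ^ 4 = 1) :
    IsSplit (thirdTrans K) P ((aglHom K).comp ι) where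
  le := by
    rintro _ ⟨w, hw, rfl⟩
    refine (hP _).2 ⟨1, w, hw, ?_⟩
    rw [map_one]; rfl
  range_le a := (hP _).2 ⟨a, 0, AddSubgroup.zero_mem _, rfl⟩
  conj_mem := by
    rintro a _ ⟨w, hw, rfl⟩
    have h := (twistThree K).inv (GeneralLinearGroup.det (ι a).right) w hw
    rw [chi_of_eq_one (hdet a)] at h
    refine ⟨_, h, ?_⟩
    change affPerm _ _ _ _ * _ * (affPerm _ _ _ _)⁻¹ = _
    rw [mul_inv_eq_iff_eq_mul, affPerm_third_mul, affPerm_mul_third, add_zero, zero_add]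
  disjoint := by
    intro a ha
    obtain ⟨h1, -, h2, -⟩ := affPerm_mem_thirdTrans.1 ha
    apply hι
    rw [map_one]
    exact SemidirectProduct.ext h2 h1
  exists_mul := by
    intro x hx
    obtain ⟨a, w, hw, rfl⟩ := (hP x).1 hx
    refine ⟨_, ⟨w, hw, rfl⟩, a, ?_⟩
    change _ = _ * affPerm _ _ _ _
    rw [affPerm_third_mul, zero_add]

/-- The third coordinate is scaled by det(M)⁶ = 1; this turns several semidirect products into
direct ones. -/
theorem commute_thirdTrans {M : GL (Fin 2) K} (hM : GeneralLinearGroup.det M ^ 2 = 1)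
    {t : Fin 2 → K} {w : K} {z} (hz : z ∈ thirdTrans K) :
    affPerm M 1 t w * z = z * affPerm M 1 t w := by
  obtain ⟨w', -, rfl⟩ := hz
  rw [affPerm_third_mul, affPerm_mul_third, ← Units.val_pow_eq_pow_val,
    show 6 = 2 * 3 by norm_num, pow_mul, hM, one_pow, Units.val_one, one_mul, add_comm]
  rfl

theorem nonempty_thirdTrans_equiv : Nonempty (thirdTrans K ≃* ElemAb 3 1) := by
  have : Fact (Nat.Prime 3) := ⟨Nat.prime_three⟩
  apply nonempty_mulEquiv_elemAb
  · rintro ⟨a, ⟨w, hw, rfl⟩⟩ ⟨b, hb⟩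
    refine Subtype.ext ?_
    exact commute_thirdTrans (by rw [map_one, one_pow]) hb
  · rintro ⟨_, ⟨w, hw, rfl⟩⟩
    refine Subtype.ext ?_
    change affPerm 1 1 0 w ^ 3 = 1
    rw [affPerm_trans_eq]
    exact unip_pow_three _ _ _ _
  · rw [pow_one, ← card_twistThree (K := K)]
    refine Nat.card_congr (Equiv.ofBijective (fun g => ⟨(g.1 (0, 0, 0)).2.2, ?_⟩) ⟨?_, ?_⟩)
    · obtain ⟨w, hw, h⟩ := g.2
      rw [h, affPerm_apply]
      simpa using hw
    · rintro ⟨_, ⟨w, hw, rfl⟩⟩ ⟨_, ⟨w', hw', rfl⟩⟩ h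
      have h' := congrArg Subtype.val h
      simp only [affPerm_apply] at h'
      have : w = w' := by simpa using h'
      subst this; rfl
    · rintro ⟨w, hw⟩
      refine ⟨⟨_, ⟨w, hw, rfl⟩⟩, ?_⟩
      refine Subtype.ext ?_
      simp [affPerm_apply]

theorem mem_scal_bot {g : Equiv.Perm (K × K × K)} : g ∈ scal (⊥ : Subgroup (Kˣ × Kˣ)) ↔
    ∃ t : Fin 2 → K, ∃ w ∈ (twistThree K).grp, g = affPerm 1 1 t w := by
  constructor
  · rintro ⟨l, m, d, e, u, v, w, h, hd, he, hw, rfl⟩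
    obtain ⟨rfl, rfl⟩ := mem_bot_pair.1 h
    rw [Ideal.mem_bot] at hd he
    subst hd he
    refine ⟨![u, v], w, hw, ?_⟩
    rw [affPerm_trans_eq, mul_one, map_one]; rfl
  · rintro ⟨t, w, hw, rfl⟩
    exact trans_mem_scal hw

theorem nonempty_scal_equiv : Nonempty (scal (⊥ : Subgroup (Kˣ × Kˣ)) ≃* ElemAb 3 5) := by
  have : Fact (Nat.Prime 3) := ⟨Nat.prime_three⟩
  apply nonempty_mulEquiv_elemAb
  · rintro ⟨a, ha⟩ ⟨b, hb⟩
    obtain ⟨t, w, hw, rfl⟩ := mem_scal_bot.1 ha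
    obtain ⟨t', w', hw', rfl⟩ := mem_scal_bot.1 hb
    refine Subtype.ext ?_
    change affPerm 1 1 t w * affPerm 1 1 t' w' = affPerm 1 1 t' w' * affPerm 1 1 t w
    rw [affPerm_mul, affPerm_mul]
    congr 1
    · ext i
      fin_cases i
      · simpa [one_apply_ringAut] using add_comm _ _
      · simpa [one_apply_ringAut] using add_comm _ _
    · simpa [one_apply_ringAut] using add_comm _ _
  · rintro ⟨a, ha⟩
    obtain ⟨t, w, hw, rfl⟩ := mem_scal_bot.1 ha
    refine Subtype.ext ?_
    change affPerm 1 1 t w ^ 3 = 1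
    rw [affPerm_trans_eq]
    exact unip_pow_three _ _ _ _
  · exact card_scal_bot

/-! ### The special affine group -/

theorem toGL_surjective_of_det {M : GL (Fin 2) K} (hM : GeneralLinearGroup.det M = 1) :
    ∃ N : SpecialLinearGroup (Fin 2) K, SpecialLinearGroup.toGL N = M := by
  refine ⟨⟨M.1, ?_⟩, ?_⟩
  · have := congrArg Units.val hM
    simpa using this
  · ext i j; rfl

theorem det_aslToAgl (x : ASL 2 K) : GeneralLinearGroup.det (aslToAgl 2 K x).right = 1 := by
  ext
  exact x.right.2

theorem aslToAgl_injective : Function.Injective (aslToAgl 2 K) := by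
  intro x y h
  have h1 := congrArg SemidirectProduct.left h
  have h2 := congrArg SemidirectProduct.right h
  exact SemidirectProduct.ext h1 (SpecialLinearGroup.toGL_injective h2)

theorem exists_aslToAgl {x : AGL 2 K} (h : GeneralLinearGroup.det x.right = 1) :
    ∃ y, aslToAgl 2 K y = x := by
  obtain ⟨N, hN⟩ := toGL_surjective_of_det h
  exact ⟨⟨x.left, N⟩, SemidirectProduct.ext rfl hN⟩

theorem isSplit_slPart :
    IsSplit (thirdTrans K) (slPart K) ((aglHom K).comp (aslToAgl 2 K)) := by
  refine isSplit_thirdTrans aslToAgl_injective (fun g => ?_) fun a => by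
    rw [det_aslToAgl, one_pow]
  constructor
  · rintro ⟨M, t, w, hM, hw, rfl⟩
    have hM' : GeneralLinearGroup.det M = 1 := hM
    obtain ⟨y, hy⟩ := exists_aslToAgl (x := ⟨Multiplicative.ofAdd t, M⟩) hM'
    refine ⟨y, w, hw, ?_⟩
    rw [hy, hM', map_one]; rfl
  · rintro ⟨a, w, hw, rfl⟩
    rw [slPart, affPerm_mem_affSub, det_aslToAgl, map_one]
    exact ⟨Subgroup.one_mem _, rfl, hw⟩

theorem nonempty_slPart_equiv : Nonempty (slPart K ≃* ElemAb 3 1 × ASL 2 K) := by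
  obtain ⟨e⟩ := nonempty_thirdTrans_equiv (K := K)
  exact isSplit_slPart.nonempty_prod
    (fun a z hz => commute_thirdTrans (by rw [det_aslToAgl, one_pow]) hz) e

theorem card_ASL : Nat.card (ASL 2 K) = 3 ^ 6 * 80 := by
  obtain ⟨e⟩ := nonempty_slPart_equiv (K := K)
  have h := Nat.card_congr e.toEquiv
  rw [card_slPart, Nat.card_prod] at h
  have h3 : Nat.card (ElemAb 3 1) = 3 := by
    change Nat.card (Fin 1 → ZMod 3) = 3
    simp
  rw [h3] at h
  omega

variable (K) in
/-- The affine maps with unitriangular linear part. -/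
noncomputable def unipAgl : Subgroup (AGL 2 K) := (borel (⊥ : Subgroup (Kˣ × Kˣ))).comap (aglHom K)

theorem mem_unipAgl {x : AGL 2 K} : x ∈ unipAgl K ↔ ∃ e, x.right = tri 1 1 e := by
  constructor
  · rintro ⟨l, m, d, e, u, v, w, h, -, -, -, hx⟩
    obtain ⟨rfl, rfl⟩ := mem_bot_pair.1 h
    exact ⟨e, (eq_of_affPerm_eq_quadPerm hx).2.1⟩
  · rintro ⟨e, he⟩
    have : aglHom K x = quadPerm 1 1 1 0 e (x.left.toAdd 0) (x.left.toAdd 1) 0 := by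
      rw [quadPerm_zero, ← he]
      change affPerm _ _ _ _ = _
      congr 1
      ext i; fin_cases i <;> rfl
    change aglHom K x ∈ borel (⊥ : Subgroup (Kˣ × Kˣ))
    rw [this]
    exact unip_mem_borel (AddSubgroup.zero_mem _)

theorem unipAgl_pow_three {x : AGL 2 K} (hx : x ∈ unipAgl K) : x ^ 3 = 1 := by
  apply aglHom_injective
  rw [map_pow, map_one]
  obtain ⟨l, m, d, e, u, v, w, h, hd, -, -, hx⟩ :=
    (show aglHom K x ∈ borel (⊥ : Subgroup (Kˣ × Kˣ)) from hx)
  obtain ⟨rfl, rfl⟩ := mem_bot_pair.1 h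
  rw [Ideal.mem_bot] at hd
  rw [hx, hd, mul_one, map_one]
  exact unip_pow_three _ _ _ _

variable (K) in
/-- The Sylow subgroup of unitriangular special affine maps. -/
noncomputable def unipAsl : Subgroup (ASL 2 K) := (unipAgl K).comap (aslToAgl 2 K)

theorem map_unipAsl : (unipAsl K).map (aslToAgl 2 K) = unipAgl K := by
  apply Subgroup.map_comap_eq_self
  intro x hx
  obtain ⟨e, he⟩ := mem_unipAgl.1 hx
  exact exists_aslToAgl (by rw [he, det_tri, one_mul])

theorem card_unipAgl : Nat.card (unipAgl K) = 3 ^ 6 := by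
  have e : unipAgl K ≃ (Fin 2 → K) × K := by
    refine (Equiv.ofBijective (fun p => ⟨⟨Multiplicative.ofAdd p.1, tri 1 1 p.2⟩,
      mem_unipAgl.2 ⟨p.2, rfl⟩⟩) ⟨?_, ?_⟩).symm
    · rintro ⟨t, e⟩ ⟨t', e'⟩ h
      have h' := congrArg Subtype.val h
      have h1 : t = t' := congrArg SemidirectProduct.left h'
      have h2 := congrArg SemidirectProduct.right h'
      exact Prod.ext h1 (tri_inj h2).2.2
    · rintro ⟨x, hx⟩
      obtain ⟨e, he⟩ := mem_unipAgl.1 hx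
      exact ⟨(x.left.toAdd, e), Subtype.ext (SemidirectProduct.ext rfl he.symm)⟩
  rw [Nat.card_congr e, Nat.card_prod, Nat.card_fun, hK.out, Nat.card_fin]
  norm_num

theorem card_unipAsl : Nat.card (unipAsl K) = 3 ^ 6 := by
  rw [← card_unipAgl (K := K), ← map_unipAsl]
  exact Nat.card_congr (Subgroup.equivMapOfInjective _ _ aslToAgl_injective).toEquiv

theorem factorization_three (n : ℕ) : (3 ^ n * 80).factorization 3 = n := by
  rw [Nat.factorization_mul (by positivity) (by norm_num), Nat.Prime.factorization_pow Nat.prime_three,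
    Finsupp.add_apply, Finsupp.single_eq_same, Nat.factorization_eq_zero_of_not_dvd (by norm_num),
    add_zero]

/-! ### Normalizers -/

theorem mul_left_apply {x y : AGL 2 K} (i : Fin 2) :
    (x * y).left.toAdd i = x.left.toAdd i + (x.right.1 i 0 * y.left.toAdd 0 +
      x.right.1 i 1 * y.left.toAdd 1) := by
  have : (x * y).left.toAdd = x.left.toAdd + x.right.1.mulVec y.left.toAdd := rfl
  rw [this]
  fin_cases i <;> simp

/-- Modulo the translations of the first coordinate, a unitriangular map has coordinates (e, v), on
which x acts by l/m and m. -/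
theorem unipAgl_conj {x y : AGL 2 K} {l m : Kˣ} {c e : K} (hx : x.right = tri l m c)
    (hy : y.right = tri 1 1 e) : (x * y * x⁻¹).right = tri 1 1 (l * e * (m⁻¹ : Kˣ)) ∧
      (x * y * x⁻¹).left.toAdd 1 = m * y.left.toAdd 1 := by
  have h1 : (x * y * x⁻¹).right = tri 1 1 (l * e * (m⁻¹ : Kˣ)) := by
    rw [SemidirectProduct.mul_right, SemidirectProduct.mul_right, SemidirectProduct.inv_right,
      mul_inv_eq_iff_eq_mul, hx, hy]
    ext i j
    fin_cases i <;> fin_cases j <;> simp [Matrix.mul_apply, Fin.sum_univ_two, coe_tri, add_comm]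
  refine ⟨h1, ?_⟩
  have h2 : (x * y * x⁻¹) * x = x * y := inv_mul_cancel_right _ _
  generalize x * y * x⁻¹ = z at h1 h2 ⊢
  have h3 := congrArg (fun z : AGL 2 K => z.left.toAdd 1) h2
  simp only [mul_left_apply (y := x), mul_left_apply (y := y), h1, hx] at h3
  simp only [coe_tri] at h3
  simp [-SemidirectProduct.mul_left] at h3
  linear_combination h3

theorem normalizer_unipAgl {x : AGL 2 K} :
    x ∈ Subgroup.normalizer (unipAgl K : Set (AGL 2 K)) ↔ x.right.1 1 0 = 0 := by
  constructor
  · intro h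
    have h1 := (Subgroup.mem_normalizer_iff.1 h (SemidirectProduct.inr (tri 1 1 1))).1
      (mem_unipAgl.2 ⟨1, rfl⟩)
    obtain ⟨e, he⟩ := mem_unipAgl.1 h1
    rw [SemidirectProduct.mul_right, SemidirectProduct.mul_right, SemidirectProduct.inv_right,
      mul_inv_eq_iff_eq_mul, SemidirectProduct.right_inr] at he
    have := congrArg (fun M : GL (Fin 2) K => M.1 1 1) he
    simpa [Matrix.mul_apply, Fin.sum_univ_two, coe_tri] using this
  · intro h
    obtain ⟨l, m, c, hx⟩ := eq_tri h
    apply Subgroup.mem_normalizer_fintype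
    intro y hy
    obtain ⟨e, he⟩ := mem_unipAgl.1 hy
    exact mem_unipAgl.2 ⟨_, (unipAgl_conj hx he).1⟩

/-- Elements of determinant other than one are conjugate only to such elements, so normalizing
within ASL or within AGL is the same condition. -/
theorem mem_normalizer_unipAsl {x : ASL 2 K} :
    x ∈ Subgroup.normalizer (unipAsl K : Set (ASL 2 K)) ↔ (aslToAgl 2 K x).right.1 1 0 = 0 := by
  rw [← normalizer_unipAgl, Subgroup.mem_normalizer_iff, Subgroup.mem_normalizer_iff]
  constructor
  · intro h y
    have key : ∀ y, GeneralLinearGroup.det (SemidirectProduct.right y) = 1 →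
        (y ∈ unipAgl K ↔ aslToAgl 2 K x * y * (aslToAgl 2 K x)⁻¹ ∈ unipAgl K) := by
      intro y hy
      obtain ⟨y, rfl⟩ := exists_aslToAgl hy
      rw [← map_mul, ← map_inv, ← map_mul]
      exact h y
    by_cases hd : GeneralLinearGroup.det y.right = 1
    · exact key y hd
    · have h1 : ∀ z : AGL 2 K, z ∈ unipAgl K → GeneralLinearGroup.det z.right = 1 := by
        intro z hz
        obtain ⟨e, he⟩ := mem_unipAgl.1 hz
        rw [he, det_tri, one_mul]
      refine ⟨fun h2 => absurd (h1 _ h2) hd, fun h2 => absurd ?_ hd⟩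
      have h3 := h1 _ h2
      rwa [SemidirectProduct.mul_right, SemidirectProduct.mul_right, SemidirectProduct.inv_right,
        map_mul, map_mul, map_inv, mul_inv_cancel_comm] at h3
  · intro h y
    have := h (aslToAgl 2 K y)
    rw [← map_mul, ← map_inv, ← map_mul] at this
    exact this

end PermK

/-! ### Kernels of the action on elementary abelian subgroups -/

section KernelTransport

variable {K : Type} [Field K]

/-- The kernel of the conjugation action of the normalizer of `T` on the elementary abelian
subgroups of order `q ^ 2` of `T`. -/
def elemAbKernel (p : ℕ) (T : Subgroup (AGL 2 K)) : Subgroup (AGL 2 K) :=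
  Subgroup.normalizer (T : Set (AGL 2 K)) ⊓
    ⨅ A ∈ elemAbSubgroups p T, Subgroup.normalizer (A : Set (AGL 2 K))

theorem kernelK2_eq (p : ℕ) (S : Subgroup (ASL 2 K)) :
    kernelK2 p S = elemAbKernel p (S.map (aslToAgl 2 K)) := rfl

theorem mem_elemAbKernel {p : ℕ} {T : Subgroup (AGL 2 K)} {x : AGL 2 K} :
    x ∈ elemAbKernel p T ↔ x ∈ Subgroup.normalizer (T : Set (AGL 2 K)) ∧
      ∀ A ∈ elemAbSubgroups p T, x ∈ Subgroup.normalizer (A : Set (AGL 2 K)) := by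
  simp only [elemAbKernel, Subgroup.mem_inf, Subgroup.mem_iInf]

theorem map_mem_normalizer {G G' : Type*} [Group G] [Group G'] (c : G ≃* G') {T : Subgroup G}
    {x : G} (hx : x ∈ Subgroup.normalizer (T : Set G)) :
    c x ∈ Subgroup.normalizer (T.map c.toMonoidHom : Set G') := by
  have := Subgroup.mem_map_of_mem c.toMonoidHom hx
  rwa [Subgroup.map_equiv_normalizer_eq] at this

theorem map_mem_elemAbSubgroups (c : AGL 2 K ≃* AGL 2 K) {p : ℕ} {T A : Subgroup (AGL 2 K)}
    (hA : A ∈ elemAbSubgroups p T) :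
    A.map c.toMonoidHom ∈ elemAbSubgroups p (T.map c.toMonoidHom) := by
  obtain ⟨h1, h2, h3, h4⟩ := hA
  refine ⟨Subgroup.map_mono h1, ?_, ?_, ?_⟩
  · rintro _ ⟨a, ha, rfl⟩ _ ⟨b, hb, rfl⟩
    rw [← map_mul, h2 a ha b hb, map_mul]
  · rintro _ ⟨a, ha, rfl⟩
    rw [← map_pow, h3 a ha, map_one]
  · rw [← h4]
    exact Nat.card_congr (Subgroup.equivMapOfInjective A _ c.injective).symm.toEquiv

theorem map_symm_map {G G' : Type*} [Group G] [Group G'] (c : G ≃* G') (T : Subgroup G) :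
    (T.map c.toMonoidHom).map c.symm.toMonoidHom = T := by
  rw [Subgroup.map_map]
  convert Subgroup.map_id T
  ext x
  exact c.symm_apply_apply x

theorem map_elemAbKernel_le (c : AGL 2 K ≃* AGL 2 K) (p : ℕ) (T : Subgroup (AGL 2 K)) :
    (elemAbKernel p T).map c.toMonoidHom ≤ elemAbKernel p (T.map c.toMonoidHom) := by
  rintro _ ⟨x, hx, rfl⟩
  obtain ⟨h1, h2⟩ := mem_elemAbKernel.1 hx
  refine mem_elemAbKernel.2 ⟨map_mem_normalizer c h1, fun A hA => ?_⟩
  have hA' := map_mem_elemAbSubgroups c.symm hA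
  rw [map_symm_map] at hA'
  have := map_mem_normalizer c (h2 _ hA')
  have h3 := map_symm_map c.symm A
  rw [MulEquiv.symm_symm] at h3
  rwa [h3] at this

/-- Allows the Sylow subgroup to be replaced by a conjugate: the construction commutes with every
automorphism of the affine group. -/
theorem map_elemAbKernel (c : AGL 2 K ≃* AGL 2 K) (p : ℕ) (T : Subgroup (AGL 2 K)) :
    (elemAbKernel p T).map c.toMonoidHom = elemAbKernel p (T.map c.toMonoidHom) := by
  refine (map_elemAbKernel_le c p T).antisymm fun x hx => ?_
  refine ⟨c.symm x, ?_, c.apply_symm_apply x⟩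
  have := map_elemAbKernel_le c.symm p _ (Subgroup.mem_map_of_mem c.symm.toMonoidHom hx)
  rwa [map_symm_map] at this

theorem map_conj_aslToAgl (g : ASL 2 K) (S : Subgroup (ASL 2 K)) :
    (S.map (MulAut.conj g).toMonoidHom).map (aslToAgl 2 K) =
      (S.map (aslToAgl 2 K)).map (MulAut.conj (aslToAgl 2 K g)).toMonoidHom := by
  rw [Subgroup.map_map, Subgroup.map_map]
  congr 1
  ext x : 1
  simp [-SemidirectProduct.mk_eq_inl_mul_inr]

end KernelTransport

namespace PermK

open Matrix

variable {K : Type} [Field K] [Finite K] [CharP K 3] [hK : Fact (Nat.card K = 9)]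

theorem exists_mulEquiv_of_sylow (S : Sylow 3 (ASL 2 K)) :
    Nonempty (Subgroup.normalizer (unipAsl K : Set (ASL 2 K)) ≃*
      Subgroup.normalizer ((S : Subgroup (ASL 2 K)) : Set (ASL 2 K))) ∧
    Nonempty (kernelK2 3 (unipAsl K) ≃* kernelK2 3 (S : Subgroup (ASL 2 K))) := by
  have : Fact (Nat.Prime 3) := ⟨Nat.prime_three⟩
  obtain ⟨S₀, hS₀⟩ : ∃ S₀ : Sylow 3 (ASL 2 K), (S₀ : Subgroup (ASL 2 K)) = unipAsl K :=
    ⟨Sylow.ofCard (unipAsl K) (by rw [card_unipAsl, card_ASL, factorization_three]), rfl⟩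
  obtain ⟨g, rfl⟩ := MulAction.exists_smul_eq (ASL 2 K) S₀ S
  have hS : ((g • S₀ : Sylow 3 (ASL 2 K)) : Subgroup (ASL 2 K)) =
      (unipAsl K).map (MulAut.conj g).toMonoidHom := by
    rw [← hS₀]; rfl
  rw [hS]
  constructor
  · rw [← Subgroup.map_equiv_normalizer_eq]
    exact ⟨Subgroup.equivMapOfInjective _ _ (MulAut.conj g).injective⟩
  · rw [kernelK2_eq, kernelK2_eq, map_conj_aslToAgl, ← map_elemAbKernel]
    exact ⟨Subgroup.equivMapOfInjective _ _ (MulAut.conj (aslToAgl 2 K g)).injective⟩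

/-- The elementary abelian subgroups of order 81 correspond to the K-lines in the plane with
coordinates (e, v) of S/Z(S). Conjugation acts there by diag(l/m, m), which fixes every line exactly
when l = m². -/
theorem mem_kernelK2_unipAsl {x : AGL 2 K} :
    x ∈ kernelK2 3 (unipAsl K) ↔ ∃ (m : Kˣ) (e : K), x.right = tri (m ^ 2) m e := by
  rw [kernelK2_eq, map_unipAsl, mem_elemAbKernel]
  constructor
  · rintro ⟨h1, h2⟩
    obtain ⟨l, m, c, hx⟩ := eq_tri (normalizer_unipAgl.1 h1)
    -- The subgroup for the line e = v; its invariance alone gives l/m = m.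
    let A : Subgroup (AGL 2 K) := subgroupOfMulClosed
      {y | y.right = tri 1 1 (y.left.toAdd 1)}
      (by
        change (1 : GL (Fin 2) K) = tri 1 1 0
        ext i j; fin_cases i <;> fin_cases j <;> simp [coe_tri])
      (by
        intro a ha b hb
        change a.right = _ at ha
        change b.right = _ at hb
        change (a * b).right = _
        rw [mul_left_apply, SemidirectProduct.mul_right, ha, hb]
        ext i j
        fin_cases i <;> fin_cases j <;>
          simp [Matrix.mul_apply, Fin.sum_univ_two, coe_tri, add_comm])
    have hA : A ∈ elemAbSubgroups 3 (unipAgl K) := by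
      refine ⟨fun y hy => mem_unipAgl.2 ⟨_, hy⟩, ?_, fun y hy =>
        unipAgl_pow_three (mem_unipAgl.2 ⟨_, hy⟩), ?_⟩
      · intro a ha b hb
        change a.right = _ at ha
        change b.right = _ at hb
        refine SemidirectProduct.ext ?_ ?_
        · have : (a * b).left.toAdd = (b * a).left.toAdd := by
            ext i
            rw [mul_left_apply, mul_left_apply, ha, hb]
            fin_cases i
            · simp [coe_tri]; ring
            · simp [coe_tri]; ring
          exact this
        · rw [SemidirectProduct.mul_right, SemidirectProduct.mul_right, ha, hb]
          ext i j
          fin_cases i <;> fin_cases j <;>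
            simp [Matrix.mul_apply, Fin.sum_univ_two, coe_tri, add_comm]
      · have e : A ≃ (Fin 2 → K) := by
          refine Equiv.ofBijective (fun y => y.1.left.toAdd) ⟨?_, ?_⟩
          · rintro ⟨y, hy⟩ ⟨z, hz⟩ h
            change y.right = _ at hy
            change z.right = _ at hz
            have h' : y.left.toAdd = z.left.toAdd := h
            refine Subtype.ext (SemidirectProduct.ext h' ?_)
            rw [hy, hz, h']
          · intro t
            exact ⟨⟨⟨Multiplicative.ofAdd t, tri 1 1 (t 1)⟩, rfl⟩, rfl⟩
        rw [Nat.card_congr e, Nat.card_fun, Nat.card_fin]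
    have h3 := h2 A hA
    let y : AGL 2 K := ⟨Multiplicative.ofAdd ![0, 1], tri 1 1 1⟩
    have hy : y ∈ A := rfl
    have h4 := (Subgroup.mem_normalizer_iff.1 h3 y).1 hy
    obtain ⟨h5, h6⟩ := unipAgl_conj hx (show y.right = tri 1 1 1 from rfl)
    have h7 : (x * y * x⁻¹).right = tri 1 1 ((x * y * x⁻¹).left.toAdd 1) := h4
    rw [h5, h6] at h7
    have h8 := (tri_inj h7).2.2
    have h9 : y.left.toAdd 1 = 1 := rfl
    rw [h9, mul_one, mul_one] at h8
    refine ⟨m, c, ?_⟩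
    rw [hx]
    congr 1
    ext
    rw [Units.val_pow_eq_pow_val, pow_two]
    nth_rw 2 [← h8]
    rw [mul_left_comm, Units.mul_inv, mul_one]
  · rintro ⟨m, c, hx⟩
    have hn : x ∈ Subgroup.normalizer (unipAgl K : Set (AGL 2 K)) := by
      rw [normalizer_unipAgl, hx, coe_tri]; rfl
    refine ⟨hn, ?_⟩
    rintro A ⟨h1, h2, -, h4⟩
    rw [hK.out] at h4
    -- `A` consists of the elements proportional to any one of its non-central elements
    have hex : ∃ a b : K, (a ≠ 0 ∨ b ≠ 0) ∧ ∀ y ∈ A, ∀ e, y.right = tri 1 1 e →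
        b * y.left.toAdd 1 = a * e := by
      by_cases hz : ∀ y ∈ A, y.right = 1
      · refine ⟨1, 0, Or.inl one_ne_zero, fun y hy e he => ?_⟩
        rw [hz y hy] at he
        have : tri (1 : Kˣ) 1 0 = (1 : GL (Fin 2) K) := by
          ext i j; fin_cases i <;> fin_cases j <;> simp [coe_tri]
        rw [← this] at he
        rw [← (tri_inj he).2.2, zero_mul, mul_zero]
      · push Not at hz
        obtain ⟨y₀, hy₀, hne⟩ := hz
        obtain ⟨e₀, he₀⟩ := mem_unipAgl.1 (h1 hy₀)
        refine ⟨y₀.left.toAdd 1, e₀, Or.inr ?_, fun y hy e he => ?_⟩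
        · rintro rfl
          apply hne
          rw [he₀]
          ext i j; fin_cases i <;> fin_cases j <;> simp [coe_tri]
        -- The commutator of two unitriangular maps is the alternating form of their coordinates (e,
        -- v), so commuting with y₀ means proportionality to it.
        · have hcomm := h2 y hy y₀ hy₀
          have h0 : (y * y₀).left.toAdd 0 = (y₀ * y).left.toAdd 0 := by rw [hcomm]
          rw [mul_left_apply, mul_left_apply, he, he₀] at h0
          simp [coe_tri] at h0
          linear_combination -h0
    obtain ⟨a, b, hab, hA⟩ := hex
    -- A lies in the group belonging to the line through (a, b), and the order 81 leaves no room for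
    -- a proper subgroup.
    have hset : (A : Set (AGL 2 K)) = Set.range fun p : K × K =>
        (⟨Multiplicative.ofAdd ![p.1, p.2 * a], tri 1 1 (p.2 * b)⟩ : AGL 2 K) := by
      apply Set.eq_of_subset_of_ncard_le
      · intro y hy
        obtain ⟨e, he⟩ := mem_unipAgl.1 (h1 hy)
        have h5 := hA y hy e he
        obtain ⟨s, hs1, hs2⟩ : ∃ s, s * a = y.left.toAdd 1 ∧ s * b = e := by
          rcases hab with h | h
          · refine ⟨y.left.toAdd 1 / a, by field_simp, ?_⟩
            field_simp
            linear_combination h5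
          · refine ⟨e / b, ?_, by field_simp⟩
            field_simp
            linear_combination -h5
        refine ⟨(y.left.toAdd 0, s), SemidirectProduct.ext ?_ ?_⟩
        · have : ![y.left.toAdd 0, s * a] = y.left.toAdd := by
            ext i; fin_cases i
            · rfl
            · exact hs1
          exact this
        · change tri 1 1 (s * b) = _
          rw [hs2, he]
      · have h5 : (A : Set (AGL 2 K)).ncard = 9 ^ 2 := h4
        rw [h5, ← Set.image_univ]
        refine (Set.ncard_image_le).trans ?_
        rw [Set.ncard_univ, Nat.card_prod, hK.out]
        norm_num
      · exact Set.toFinite _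
    apply Subgroup.mem_normalizer_fintype
    intro y hy
    obtain ⟨e, he⟩ := mem_unipAgl.1 (h1 hy)
    have hp := hA y hy e he
    obtain ⟨h5, h6⟩ := unipAgl_conj hx he
    obtain ⟨⟨r, s⟩, hrs⟩ := hset.le hy
    rw [hset]
    have hs1 : s * a = y.left.toAdd 1 := by rw [← hrs]; rfl
    have hs2 : s * b = e := by
      have : tri 1 1 (s * b) = tri 1 1 e := by rw [← he, ← hrs]
      exact (tri_inj this).2.2
    refine ⟨((x * y * x⁻¹).left.toAdd 0, m * s), SemidirectProduct.ext ?_ ?_⟩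
    · have : ![(x * y * x⁻¹).left.toAdd 0, m * s * a] = (x * y * x⁻¹).left.toAdd := by
        ext i; fin_cases i
        · rfl
        · change m * s * a = (x * y * x⁻¹).left.toAdd 1
          rw [h6, ← hs1, mul_assoc]
      exact this
    · rw [h5]
      change tri 1 1 (m * s * b) = _
      congr 1
      rw [mul_assoc, hs2, Units.val_pow_eq_pow_val, pow_two]
      rw [mul_assoc, mul_assoc, mul_comm (m : K) (e * _), mul_assoc, Units.inv_mul, mul_one]

end PermK

namespace PermK

open Matrix

variable {K : Type} [Field K] [Finite K] [CharP K 3] [hK : Fact (Nat.card K = 9)]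

/-! ### Unique normal subgroups -/

theorem mem_range_pow_two {x : Kˣ} : x ∈ (powMonoidHom 2 : Kˣ →* Kˣ).range ↔ x ^ 4 = 1 := by
  rw [← isSquare_iff, isSquare_iff_exists_sq]
  exact ⟨fun ⟨y, h⟩ => ⟨y, h.symm⟩, fun ⟨y, h⟩ => ⟨y, h.symm⟩⟩

theorem mem_range_pow_four {x : Kˣ} : x ∈ (powMonoidHom 4 : Kˣ →* Kˣ).range ↔ x ^ 2 = 1 := by
  constructor
  · rintro ⟨y, rfl⟩
    change (y ^ 4) ^ 2 = 1
    rw [← pow_mul]; exact unit_pow_eight y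
  · intro h
    have hx : ((x : K) - 1) * (x + 1) = 0 := by
      have := congrArg Units.val h
      push_cast at this
      linear_combination this
    rcases mul_eq_zero.1 hx with h | h
    · exact ⟨1, by ext; simp; linear_combination -h⟩
    · exact ⟨om K, by
        change om K ^ 4 = x
        rw [om_pow_four]; ext; push_cast; linear_combination -h⟩

theorem det_surjective : Function.Surjective (GeneralLinearGroup.det : GL (Fin 2) K →* Kˣ) :=
  fun x => ⟨tri x 1 0, by rw [det_tri, mul_one]⟩

theorem inr_tri_mem_unipAgl (e : K) : (SemidirectProduct.inr (tri 1 1 e) : AGL 2 K) ∈ unipAgl K :=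
  mem_unipAgl.2 ⟨e, rfl⟩

theorem tri_one_pow_three (e : K) : (tri 1 1 e : GL (Fin 2) K) ^ 3 = 1 := by
  have := congrArg SemidirectProduct.right (unipAgl_pow_three (inr_tri_mem_unipAgl e))
  rwa [← map_pow] at this

/-- Transvections have cube one, hence lie in N, and they generate the kernel. -/
theorem det_ker_le {N : Subgroup (GL (Fin 2) K)} (hN : N.Normal) (hd : N.index.Coprime 3) :
    (GeneralLinearGroup.det : GL (Fin 2) K →* Kˣ).ker ≤ N := by
  have hu : ∀ e, tri 1 1 e ∈ N := fun e => mem_of_pow_three_eq_one hN hd (tri_one_pow_three e)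
  exact fun M hM => mem_of_det_eq_one hu
    (fun e => by rw [← turn_conj_tri]; exact hN.conj_mem _ (hu _) _) hM

theorem isTheNormalSubgroup_GL :
    IsTheNormalSubgroup ((powMonoidHom 2 : Kˣ →* Kˣ).range.comap
      (GeneralLinearGroup.det : GL (Fin 2) K →* Kˣ)) 2 :=
  isTheNormalSubgroup_comap_pow _ det_surjective (by rw [card_units_eq]; norm_num)
    fun N hN h => det_ker_le hN (by rw [h]; norm_num)

variable (K) in
/-- The determinant of the linear part. -/
noncomputable def aglDet : AGL 2 K →* Kˣ :=
  GeneralLinearGroup.det.comp SemidirectProduct.rightHom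

theorem isTheNormalSubgroup_AGL :
    IsTheNormalSubgroup ((powMonoidHom 4 : Kˣ →* Kˣ).range.comap (aglDet K)) 4 := by
  refine isTheNormalSubgroup_comap_pow _
    (det_surjective.comp SemidirectProduct.rightHom_surjective) (by rw [card_units_eq]; norm_num)
    fun N hN h => ?_
  have hd : N.index.Coprime 3 := by rw [h]; norm_num
  have hu : ∀ x ∈ unipAgl K, x ∈ N := fun x hx =>
    mem_of_pow_three_eq_one hN hd (unipAgl_pow_three hx)
  intro x hx
  rw [← SemidirectProduct.inl_left_mul_inr_right x]
  refine N.mul_mem (hu _ (mem_unipAgl.2 ⟨0, ?_⟩)) ?_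
  · rw [SemidirectProduct.right_inl]
    ext i j; fin_cases i <;> fin_cases j <;> simp [coe_tri]
  · refine mem_of_det_eq_one (S := N.comap SemidirectProduct.inr)
      (fun e => hu _ (inr_tri_mem_unipAgl e)) (fun e => ?_) hx
    rw [← turn_conj_tri]
    exact (hN.comap SemidirectProduct.inr).conj_mem _ (hu _ (inr_tri_mem_unipAgl _)) _

/-- The determinant of an element with diagonal (m², m) is m³. As cubing is bijective on K*, the
determinant is onto, and its kernel is the unitriangular part, where all cubes are trivial. -/
theorem isTheNormalSubgroup_kernelK2 {d : ℕ} (hd : d ∣ 8) :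
    IsTheNormalSubgroup ((powMonoidHom d : Kˣ →* Kˣ).range.comap
      ((aglDet K).comp (kernelK2 3 (unipAsl K)).subtype)) d := by
  refine isTheNormalSubgroup_comap_pow _ ?_ (by rw [card_units_eq]; exact hd) fun N hN h => ?_
  · intro x
    refine ⟨⟨SemidirectProduct.inr (tri ((x ^ 3) ^ 2) (x ^ 3) 0),
      mem_kernelK2_unipAsl.2 ⟨_, _, rfl⟩⟩, ?_⟩
    change GeneralLinearGroup.det (tri _ _ _) = x
    rw [det_tri, ← pow_succ, ← pow_mul, show 3 * (2 + 1) = 8 + 1 by norm_num, pow_add,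
      unit_pow_eight, one_mul, pow_one]
  · rintro ⟨x, hx⟩ hker
    obtain ⟨m, e, he⟩ := mem_kernelK2_unipAsl.1 hx
    have hm : GeneralLinearGroup.det x.right = 1 := hker
    rw [he, det_tri, ← pow_succ] at hm
    have hm1 : m = 1 := by
      calc m = m ^ (8 + 1) := by rw [pow_add, unit_pow_eight, one_mul, pow_one]
        _ = (m ^ (2 + 1)) ^ 3 := by rw [← pow_mul]
        _ = 1 := by rw [hm, one_pow]
    apply mem_of_pow_three_eq_one hN
    · rw [h]
      exact Nat.Coprime.coprime_dvd_left hd (by norm_num)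
    · refine Subtype.ext ?_
      apply unipAgl_pow_three
      rw [mem_unipAgl]
      refine ⟨e, ?_⟩
      change x.right = _
      rw [he, hm1, one_pow]

/-! ### The structure of the groups -/

theorem exists_affPerm_of_borel {l m : Kˣ} {e u v w : K} (h : (l * m) ^ 4 = 1) :
    quadPerm l m (chi (l * m)) 0 e u v w = affPerm (tri l m e) 1 ![u, v] w := by
  rw [chi_of_eq_one h, quadPerm_zero]

theorem vec_eta (t : Fin 2 → K) : t = ![t 0, t 1] := by
  ext i; fin_cases i <;> rfl

/-- `borel Λ` is a semidirect product of the translations of the third coordinate with a group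
of affine maps of the plane. -/
theorem isSplit_borel {A : Type*} [Group A] {ι : A →* AGL 2 K} (hι : Function.Injective ι)
    {Λ : Subgroup (Kˣ × Kˣ)} (hΛ : Λ ≤ diagSq K)
    (h : ∀ x : AGL 2 K, (∃ a, ι a = x) ↔ ∃ l m e, (l, m) ∈ Λ ∧ x.right = tri l m e) :
    IsSplit (thirdTrans K) (borel Λ) ((aglHom K).comp ι) := by
  have hr : ∀ a, ∃ l m e, (l, m) ∈ Λ ∧ (ι a).right = tri l m e := fun a => (h _).1 ⟨a, rfl⟩
  refine isSplit_thirdTrans hι (fun g => ?_) fun a => ?_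
  · constructor
    · rintro ⟨l, m, d, e, u, v, w, hlm, hd, -, hw, rfl⟩
      rw [Ideal.mem_bot] at hd
      subst hd
      obtain ⟨a, ha⟩ := (h ⟨Multiplicative.ofAdd ![u, v], tri l m e⟩).2 ⟨l, m, e, hlm, rfl⟩
      refine ⟨a, w, hw, ?_⟩
      rw [ha, exists_affPerm_of_borel (mem_diagSq.1 (hΛ hlm))]
      rfl
    · rintro ⟨a, w, hw, rfl⟩
      obtain ⟨l, m, e, hlm, ha⟩ := hr a
      rw [ha, vec_eta (ι a).left.toAdd, ← exists_affPerm_of_borel (mem_diagSq.1 (hΛ hlm))]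
      exact quadPerm_mem_quadSub.2 ⟨hlm, rfl, Ideal.zero_mem _, trivial, hw⟩
  · obtain ⟨l, m, e, hlm, ha⟩ := hr a
    rw [ha, det_tri]
    exact mem_diagSq.1 (hΛ hlm)

theorem isSplit_borel_diagOne : IsSplit (thirdTrans K) (borel (diagOne K)) ((aglHom K).comp
    ((aslToAgl 2 K).comp (Subgroup.normalizer (unipAsl K : Set (ASL 2 K))).subtype)) := by
  refine isSplit_borel (fun a b h => Subtype.ext (aslToAgl_injective h)) diagOne_le_diagSq
    fun x => ?_
  constructor
  · rintro ⟨⟨a, ha⟩, rfl⟩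
    obtain ⟨l, m, e, h⟩ := eq_tri (mem_normalizer_unipAsl.1 ha)
    refine ⟨l, m, e, ?_, h⟩
    rw [mem_diagOne, ← det_tri l m e, ← h, det_aslToAgl]
  · rintro ⟨l, m, e, hlm, h⟩
    obtain ⟨a, rfl⟩ := exists_aslToAgl (x := x) (by rw [h, det_tri]; exact hlm)
    refine ⟨⟨a, mem_normalizer_unipAsl.2 ?_⟩, rfl⟩
    rw [h]; rfl

theorem nonempty_borel_diagOne_equiv : Nonempty (borel (diagOne K) ≃*
    ElemAb 3 1 × Subgroup.normalizer (unipAsl K : Set (ASL 2 K))) := by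
  obtain ⟨e⟩ := nonempty_thirdTrans_equiv (K := K)
  exact isSplit_borel_diagOne.nonempty_prod
    (fun a z hz => commute_thirdTrans (by
      change GeneralLinearGroup.det (aslToAgl 2 K a.1).right ^ 2 = 1
      rw [det_aslToAgl, one_pow]) hz) e

variable (K) in
/-- The normal subgroup of index `d` of `kernelK2 3 (unipAsl K)`. -/
noncomputable def kernelK2Sub (d : ℕ) : Subgroup (kernelK2 3 (unipAsl K)) :=
  (powMonoidHom d : Kˣ →* Kˣ).range.comap ((aglDet K).comp (kernelK2 3 (unipAsl K)).subtype)

theorem isSplit_kernelK2Sub {d : ℕ} {Λ : Subgroup (Kˣ × Kˣ)} (hΛ : Λ ≤ diagSq K)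
    (h : ∀ l m, (l, m) ∈ Λ ↔ l = m ^ 2 ∧ l * m ∈ (powMonoidHom d : Kˣ →* Kˣ).range) :
    IsSplit (thirdTrans K) (borel Λ) ((aglHom K).comp
      ((kernelK2 3 (unipAsl K)).subtype.comp (kernelK2Sub K d).subtype)) := by
  refine isSplit_borel (fun a b h => Subtype.ext (Subtype.ext h)) hΛ
    fun x => ?_
  constructor
  · rintro ⟨⟨⟨a, ha⟩, ha'⟩, rfl⟩
    obtain ⟨m, e, he⟩ := mem_kernelK2_unipAsl.1 ha
    refine ⟨_, m, e, (h _ _).2 ⟨rfl, ?_⟩, he⟩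
    have : GeneralLinearGroup.det a.right ∈ (powMonoidHom d : Kˣ →* Kˣ).range := ha'
    rwa [he, det_tri] at this
  · rintro ⟨l, m, e, hlm, hx⟩
    obtain ⟨rfl, hd⟩ := (h _ _).1 hlm
    refine ⟨⟨⟨x, mem_kernelK2_unipAsl.2 ⟨m, e, hx⟩⟩, ?_⟩, rfl⟩
    change GeneralLinearGroup.det x.right ∈ (powMonoidHom d : Kˣ →* Kˣ).range
    rwa [hx, det_tri]

theorem isSplit_borel_diagKer : IsSplit (thirdTrans K) (borel (diagKer K)) ((aglHom K).comp
    ((kernelK2 3 (unipAsl K)).subtype.comp (kernelK2Sub K 2).subtype)) := by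
  refine isSplit_kernelK2Sub diagKer_le_diagSq fun l m => ?_
  rw [mem_diagKer]
  refine and_congr_right fun h => ?_
  rw [h, mem_range_pow_two, ← pow_succ, ← pow_mul, show (2 + 1) * 4 = 8 + 4 by norm_num, pow_add,
    unit_pow_eight, one_mul]

theorem diagSign_le_diagSq : diagSign K ≤ diagSq K := by
  rintro ⟨l, m⟩ h
  obtain ⟨rfl, h2⟩ := mem_diagSign.1 h
  rw [mem_diagSq, one_mul, show 4 = 2 * 2 by norm_num, pow_mul, h2, one_pow]

theorem isSplit_borel_diagSign : IsSplit (thirdTrans K) (borel (diagSign K)) ((aglHom K).comp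
    ((kernelK2 3 (unipAsl K)).subtype.comp (kernelK2Sub K 4).subtype)) := by
  refine isSplit_kernelK2Sub diagSign_le_diagSq fun l m => ?_
  rw [mem_diagSign, mem_range_pow_four]
  constructor
  · rintro ⟨rfl, h⟩
    exact ⟨h.symm, by rw [one_mul, h]⟩
  · rintro ⟨rfl, h⟩
    -- Here h says m⁶ = 1. If m⁴ were -1, then m² = -1 and so m⁴ = 1, a contradiction; hence m⁴ = 1
    -- and m² = 1.
    have : m ^ 2 = 1 := by
      rw [← h, ← pow_succ, ← pow_mul, show (2 + 1) * 2 = 4 + 2 by norm_num, pow_add]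
      rw [← pow_succ, ← pow_mul, show (2 + 1) * 2 = 4 + 2 by norm_num, pow_add] at h
      have h8 := unit_pow_eight m
      rcases unit_pow_four m with h4 | h4
      · rw [h4, one_mul]
      · exfalso
        rw [h4] at h
        have h2 : m ^ 2 = -1 := by rw [← h]; simp
        rw [show 4 = 2 * 2 by norm_num, pow_mul, h2] at h4
        norm_num at h4
        exact unit_neg_one_ne_one h4.symm
    exact ⟨this, this⟩

theorem nonempty_borel_diagSign_equiv :
    Nonempty (borel (diagSign K) ≃* ElemAb 3 1 × kernelK2Sub K 4) := by
  obtain ⟨e⟩ := nonempty_thirdTrans_equiv (K := K)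
  refine isSplit_borel_diagSign.nonempty_prod (fun a z hz => commute_thirdTrans ?_ hz) e
  exact mem_range_pow_four.1 a.2

theorem isSplit_core₁ : IsSplit (scal (⊥ : Subgroup (Kˣ × Kˣ))) (core₁ K) ((aglHom K).comp
    (SemidirectProduct.inr.comp ((powMonoidHom 2 : Kˣ →* Kˣ).range.comap
      (GeneralLinearGroup.det : GL (Fin 2) K →* Kˣ)).subtype)) where
  le := (scal_le_borel _).trans (borel_bot_le_slPart.trans slPart_le_core₁)
  range_le a := by
    have h := mem_range_pow_two.1 a.2
    refine affPerm_mem_affSub.2 ⟨h, (chi_of_eq_one h).symm, AddSubgroup.zero_mem _⟩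
  conj_mem := by
    rintro a z hz
    obtain ⟨t, w, hw, rfl⟩ := mem_scal_bot.1 hz
    have h4 : GeneralLinearGroup.det a.1 ^ 4 = 1 := mem_range_pow_two.1 a.2
    have h := (twistThree K).inv (GeneralLinearGroup.det a.1) w hw
    rw [chi_of_eq_one h4] at h
    refine mem_scal_bot.2 ⟨fun i => a.1.1 i 0 * t 0 + a.1.1 i 1 * t 1, _, h, ?_⟩
    change affPerm a.1 1 0 0 * _ * (affPerm a.1 1 0 0)⁻¹ = _
    rw [mul_inv_eq_iff_eq_mul, ← affPerm_eq_mul, affPerm_mul]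
    congr 1
    · have : gmap 1 (1 : GL (Fin 2) K) = 1 := map_one _
      rw [this, mul_one]
    · ext i; simp
    · rw [add_zero]
  disjoint := by
    intro a ha
    obtain ⟨t, w, hw, h⟩ := mem_scal_bot.1 ha
    exact Subtype.ext (affPerm_inj (show affPerm a.1 1 0 0 = _ from h)).1
  exists_mul := by
    rintro _ ⟨M, t, w, hM, hw, rfl⟩
    refine ⟨affPerm 1 1 t w, trans_mem_scal hw, ⟨M, mem_range_pow_two.2 hM⟩, ?_⟩
    rw [chi_of_eq_one hM]
    exact affPerm_eq_mul _ _ _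

theorem pow_four_of_sq {G : Type*} [Group G] {x : G} (h : x ^ 2 = 1) : x ^ 4 = 1 := by
  rw [show 4 = 2 * 2 by norm_num, pow_mul, h, one_pow]

/-- Centralizing ω means det⁶ = 1. Together with det⁴ = 1 this is det² = 1, that is, the determinant
is a fourth power. -/
theorem isSplit_core₁_inf_centralizer :
    IsSplit (thirdTrans K) (core₁ K ⊓ Subgroup.centralizer (thirdTrans K : Set _))
      ((aglHom K).comp ((powMonoidHom 4 : Kˣ →* Kˣ).range.comap (aglDet K)).subtype) := by
  refine isSplit_thirdTrans (Subgroup.subtype_injective _) (fun g => ?_) fun a => ?_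
  · constructor
    · rintro ⟨⟨M, t, w, hM, hw, rfl⟩, hc⟩
      have hM4 : GeneralLinearGroup.det M ^ 4 = 1 := hM
      rw [chi_of_eq_one hM4] at hc ⊢
      have h1 := Subgroup.mem_centralizer_iff.1 hc _ ⟨om K, om_mem, rfl⟩
      rw [affPerm_third_mul, affPerm_mul_third] at h1
      have h2 : (GeneralLinearGroup.det M : K) ^ 6 * om K = om K := by
        have := (affPerm_inj h1).2.2.2
        rw [add_comm] at this
        exact (add_right_cancel this).symm
      have h3 : GeneralLinearGroup.det M ^ 6 = 1 := by
        ext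
        rw [Units.val_pow_eq_pow_val]
        exact (mul_eq_right₀ (om K).ne_zero).1 h2
      have h4 : GeneralLinearGroup.det M ^ 2 = 1 := by
        rwa [show 6 = 4 + 2 by norm_num, pow_add, hM4, one_mul] at h3
      exact ⟨⟨⟨Multiplicative.ofAdd t, M⟩, mem_range_pow_four.2 h4⟩, w, hw, rfl⟩
    · rintro ⟨⟨a, ha⟩, w, hw, rfl⟩
      have h2 : GeneralLinearGroup.det a.right ^ 2 = 1 := mem_range_pow_four.1 ha
      have h4 : GeneralLinearGroup.det a.right ^ 4 = 1 := pow_four_of_sq h2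
      refine ⟨affPerm_mem_affSub.2 ⟨h4, (chi_of_eq_one h4).symm, hw⟩, ?_⟩
      exact Subgroup.mem_centralizer_iff.2 fun z hz => (commute_thirdTrans h2 hz).symm
  · exact pow_four_of_sq (mem_range_pow_four.1 a.2)

theorem nonempty_core₁_inf_centralizer_equiv :
    Nonempty (↥(core₁ K ⊓ Subgroup.centralizer (thirdTrans K : Set (Equiv.Perm (K × K × K)))) ≃*
      ElemAb 3 1 × ((powMonoidHom 4 : Kˣ →* Kˣ).range.comap (aglDet K))) := by
  obtain ⟨e⟩ := nonempty_thirdTrans_equiv (K := K)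
  refine isSplit_core₁_inf_centralizer.nonempty_prod (fun a z hz => commute_thirdTrans ?_ hz) e
  exact mem_range_pow_four.1 a.2

end PermK

namespace PermK

open Matrix

variable {K : Type} [Field K] [Finite K] [CharP K 3] [hK : Fact (Nat.card K = 9)]

/-! ### The second group of the core -/

theorem coe_det_one (M : GL (Fin 1) K) : (GeneralLinearGroup.det M : K) = M.1 0 0 := by
  rw [GeneralLinearGroup.val_det_apply, Matrix.det_fin_one]

theorem det_one_injective : Function.Injective (GeneralLinearGroup.det : GL (Fin 1) K →* Kˣ) := by
  intro M N h
  have h' := congrArg Units.val h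
  rw [coe_det_one, coe_det_one] at h'
  ext i j
  rw [Subsingleton.elim i 0, Subsingleton.elim j 0]
  exact h'

theorem det_one_surjective : Function.Surjective (GeneralLinearGroup.det : GL (Fin 1) K →* Kˣ) := by
  intro x
  refine ⟨GeneralLinearGroup.mk' !![(x : K)] ?_, ?_⟩
  · rw [Matrix.det_fin_one]
    exact invertibleOfNonzero x.ne_zero
  · ext
    rw [coe_det_one]; rfl

theorem isTheNormalSubgroup_GL_one :
    IsTheNormalSubgroup ((powMonoidHom 2 : Kˣ →* Kˣ).range.comap
      (GeneralLinearGroup.det : GL (Fin 1) K →* Kˣ)) 2 :=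
  isTheNormalSubgroup_comap_pow _ det_one_surjective (by rw [card_units_eq]; norm_num)
    fun N _ _ => by
      rw [(MonoidHom.ker_eq_bot_iff _).2 det_one_injective]
      exact bot_le

theorem mul_left_apply_zero (x y : AGL 1 K) : (x * y).left.toAdd 0 =
    x.left.toAdd 0 + GeneralLinearGroup.det x.right * y.left.toAdd 0 := by
  have : (x * y).left.toAdd = x.left.toAdd + x.right.1.mulVec y.left.toAdd := rfl
  rw [this, coe_det_one]
  simp [Matrix.mulVec, dotProduct]

variable (K) in
/-- The second diagonal entry of the image of an element of `GL_1(K) × AGL_1(K)`. -/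
noncomputable def entryHom : GL (Fin 1) K × AGL 1 K →* Kˣ :=
  GeneralLinearGroup.det.coprod (((powMonoidHom 5).comp GeneralLinearGroup.det).comp
    SemidirectProduct.rightHom)

theorem entryHom_apply (x : GL (Fin 1) K × AGL 1 K) : entryHom K x =
    GeneralLinearGroup.det x.1 * GeneralLinearGroup.det x.2.right ^ 5 := rfl

variable (K) in
/-- The embedding of `GL_1(K) × AGL_1(K)` as a complement. -/
noncomputable def complHom : GL (Fin 1) K × AGL 1 K →* Equiv.Perm (K × K × K) where
  toFun x := quadPerm (entryHom K x ^ 2 * GeneralLinearGroup.det x.2.right) (entryHom K x) 1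
    (x.2.left.toAdd 0 * (entryHom K x : K) ^ 2) 0 0 0 0
  map_one' := by
    rw [map_one, ← quadPerm_one]
    congr 1
    · change (1 : Kˣ) ^ 2 * GeneralLinearGroup.det (1 : GL (Fin 1) K) = 1
      rw [map_one, one_pow, one_mul]
    · exact zero_mul _
  map_mul' x y := by
    have h1 : (x * y).2 = x.2 * y.2 := rfl
    rw [quadPerm_mul, h1, mul_left_apply_zero, SemidirectProduct.mul_right, map_mul, map_mul]
    congr 1
    · rw [umap_one_left, mul_pow, mul_mul_mul_comm]
    · simp only [one_apply_ringAut, Units.val_mul, Units.val_pow_eq_pow_val]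
      ring
    · simp
    · simp
    · simp
    · simp

theorem complHom_apply (x : GL (Fin 1) K × AGL 1 K) : complHom K x =
    quadPerm (entryHom K x ^ 2 * GeneralLinearGroup.det x.2.right) (entryHom K x) 1
      (x.2.left.toAdd 0 * (entryHom K x : K) ^ 2) 0 0 0 0 := rfl

/-- With n and t the determinants of the two factors, the diagonal is (m²t, m) for m = nt⁵, of
determinant n³t¹⁶ = n³. The exponent 5 gives the affine factor determinant one, so only n decides
squareness. The linear factor diag(n², n) centralizes every τ_d, and t scales d. -/
theorem entry_pow_four (x : GL (Fin 1) K × AGL 1 K) :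
    (entryHom K x ^ 2 * GeneralLinearGroup.det x.2.right * entryHom K x) ^ 4 =
      GeneralLinearGroup.det x.1 ^ 4 := by
  rw [entryHom_apply]
  have h : ∀ m t : Kˣ, ((m * t ^ 5) ^ 2 * t * (m * t ^ 5)) ^ 4 = m ^ 4 := by
    intro m t
    calc ((m * t ^ 5) ^ 2 * t * (m * t ^ 5)) ^ 4 = m ^ 8 * (t ^ 8) ^ 8 * m ^ 4 := by
          ext; push_cast; ring
      _ = m ^ 4 := by rw [unit_pow_eight, unit_pow_eight, one_mul, one_mul]
  exact h _ _

theorem isNormalIn_borel_bot : IsNormalIn (borel (⊥ : Subgroup (Kˣ × Kˣ))) (stab₂ K) := by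
  refine isNormalIn_of_conj_mem (borel_le_stab₂ _) ?_
  rintro _ ⟨l, m, d, e, u, v, w, -, -, -, hw, rfl⟩
    _ ⟨l', m', d', e', u', v', w', h', hd', -, hw', rfl⟩
    _ ⟨l'', m'', d'', e'', u'', v'', w'', -, -, -, hw'', rfl⟩ h
  obtain ⟨rfl, rfl⟩ := mem_bot_pair.1 h'
  rw [Ideal.mem_bot] at hd'
  subst hd'
  obtain ⟨h1, h2, h3, h4⟩ := quadPerm_conj h (by rw [mul_one, map_one])
  rw [umap_one_right] at h2 h3
  subst h2 h3
  have hd : d'' = 0 := by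
    rw [map_zero, mul_zero, zero_add, Units.val_one, map_one, one_pow, mul_one, one_mul,
      left_eq_add] at h4
    exact (mul_eq_zero.1 h4).resolve_right (pow_ne_zero 2 m.ne_zero)
  exact ⟨1, 1, d'', e'', u'', v'', w'', Subgroup.one_mem _, Ideal.mem_bot.2 hd, trivial, hw'', rfl⟩

theorem isSplit_core₂ : IsSplit (borel (⊥ : Subgroup (Kˣ × Kˣ))) (core₂ K)
    ((complHom K).comp (((powMonoidHom 2 : Kˣ →* Kˣ).range.comap
      (GeneralLinearGroup.det : GL (Fin 1) K →* Kˣ)).subtype.prodMap (MonoidHom.id (AGL 1 K)))) where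
  le := (borel_mono bot_le).trans borel_diagSq_le_core₂
  range_le x := by
    have h4 : GeneralLinearGroup.det x.1.1 ^ 4 = 1 := mem_range_pow_two.1 x.1.2
    have h := (entry_pow_four (x.1.1, x.2)).trans h4
    exact quadPerm_mem_quadSub.2 ⟨h, (chi_of_eq_one h).symm, trivial, trivial,
      AddSubgroup.zero_mem _⟩
  conj_mem := by
    intro x z hz
    refine isNormalIn_borel_bot.2 _ ?_ z hz
    have h4 : GeneralLinearGroup.det x.1.1 ^ 4 = 1 := mem_range_pow_two.1 x.1.2
    have h := (entry_pow_four (x.1.1, x.2)).trans h4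
    exact quadPerm_mem_quadSub.2 ⟨trivial, (chi_of_eq_one h).symm, trivial, trivial,
      AddSubgroup.zero_mem _⟩
  disjoint := by
    rintro ⟨⟨n, hn⟩, x⟩ h
    have h' : complHom K (n, x) ∈ borel (⊥ : Subgroup (Kˣ × Kˣ)) := h
    rw [complHom_apply] at h'
    obtain ⟨h1, -, h2, -⟩ := quadPerm_mem_quadSub.1 h'
    obtain ⟨h3, h4⟩ := mem_bot_pair.1 h1
    rw [h4, one_pow, one_mul] at h3
    rw [Ideal.mem_bot, h4, Units.val_one, one_pow, mul_one] at h2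
    have h3' : GeneralLinearGroup.det x.right = 1 := h3
    rw [entryHom_apply, h3, one_pow, mul_one] at h4
    have hx : x.right = 1 := det_one_injective (by rw [h3', map_one])
    have hn1 : n = 1 := det_one_injective (by rw [map_one]; exact h4)
    have hl : x.left.toAdd = 0 := by
      ext i
      rw [Subsingleton.elim i 0]
      exact h2
    refine Prod.ext (Subtype.ext hn1) (SemidirectProduct.ext hl hx)
  exists_mul := by
    rintro _ ⟨l, m, d, e, u, v, w, hlm, -, -, hw, rfl⟩
    have h4 : (l * m) ^ 4 = 1 := hlm
    obtain ⟨g, hg⟩ := det_one_surjective (l * (m ^ 2)⁻¹)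
    -- The affine factor must have t = l/m²; then m = nt⁵ gives n = mt³.
    obtain ⟨n, hn⟩ := det_one_surjective (m * (l * (m ^ 2)⁻¹) ^ 3)
    have hn4 : GeneralLinearGroup.det n ^ 4 = 1 := by
      have hm : m * (l * (m ^ 2)⁻¹) ^ 3 = (l * m) ^ 3 * (m ^ 8)⁻¹ := by
        ext
        push_cast
        field_simp
      rw [hn, hm, unit_pow_eight, inv_one, mul_one, ← pow_mul, mul_comm 3 4, pow_mul, h4, one_pow]
    refine ⟨quadPerm 1 1 1 0 (e * (m⁻¹ : Kˣ)) u v w, unip_mem_borel hw,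
      (⟨n, mem_range_pow_two.2 hn4⟩, ⟨Multiplicative.ofAdd ![d * ((m ^ 2)⁻¹ : Kˣ)], g⟩), ?_⟩
    change _ = _ * complHom K (n, ⟨_, g⟩)
    have he : entryHom K (n, ⟨Multiplicative.ofAdd ![d * ((m ^ 2)⁻¹ : Kˣ)], g⟩) = m := by
      rw [entryHom_apply]
      change GeneralLinearGroup.det n * GeneralLinearGroup.det g ^ 5 = m
      rw [hn, hg, mul_assoc, ← pow_add, unit_pow_eight, mul_one]
    rw [complHom_apply, he, chi_of_eq_one h4, quadPerm_mul]
    change _ = quadPerm (1 * umap 1 (m ^ 2 * GeneralLinearGroup.det g)) _ _ _ _ _ _ _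
    rw [hg, umap_one_left, umap_one_left, mul_inv_cancel_comm_assoc, one_mul, one_mul]
    congr 1
    · simp
    · simp
    · simp
    · simp
    · simp

/-- Elements commute exactly when the alternating form of their coordinates (e, v) vanishes; being
central therefore means e = v = 0. -/
theorem mem_centerOf_borel_bot {g : Equiv.Perm (K × K × K)} :
    g ∈ centerOf (borel (⊥ : Subgroup (Kˣ × Kˣ))) ↔
      ∃ u, ∃ w ∈ (twistThree K).grp, g = quadPerm 1 1 1 0 0 u 0 w := by
  constructor
  · rintro ⟨⟨l, m, d, e, u, v, w, h, hd, -, hw, rfl⟩, hc⟩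
    obtain ⟨rfl, rfl⟩ := mem_bot_pair.1 h
    rw [Ideal.mem_bot] at hd
    subst hd
    rw [mul_one, map_one] at hc ⊢
    replace hc := Subgroup.mem_centralizer_iff.1 hc
    have key : ∀ e' v', e' * v = e * v' := by
      intro e' v'
      have h := hc _ (unip_mem_borel (e := e') (u := 0) (v := v') (AddSubgroup.zero_mem _))
      rw [quadPerm_mul, quadPerm_mul] at h
      obtain ⟨-, -, -, -, -, h6, -⟩ := quadPerm_inj h
      simp at h6
      linear_combination h6
    have hv : v = 0 := by simpa using key 1 0
    have he : e = 0 := by simpa using (key 0 1).symm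
    subst hv he
    exact ⟨u, w, hw, rfl⟩
  · rintro ⟨u, w, hw, rfl⟩
    refine ⟨unip_mem_borel hw, Subgroup.mem_centralizer_iff.2 ?_⟩
    rintro _ ⟨l, m, d, e, u', v, w', h, hd, -, hw', rfl⟩
    obtain ⟨rfl, rfl⟩ := mem_bot_pair.1 h
    rw [Ideal.mem_bot] at hd
    subst hd
    rw [mul_one, map_one, quadPerm_mul, quadPerm_mul]
    simp only [one_apply_ringAut]
    congr 1
    · simp
    · simp [add_comm]
    · simp
    · simp [add_comm]

/-- An untwisted element acts on the centre by (u, w) ↦ (lu + d³l⁶w, (lm)⁶w). Trivial action gives l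
= 1, d = 0 and m⁶ = 1, and with m⁴ = 1 also m² = 1. -/
theorem core₂_inf_centralizer : core₂ K ⊓ Subgroup.centralizer
    (centerOf (borel (⊥ : Subgroup (Kˣ × Kˣ))) : Set (Equiv.Perm (K × K × K))) =
      borel (diagSign K) := by
  ext g
  constructor
  · rintro ⟨⟨l, m, d, e, u, v, w, hlm, -, -, hw, rfl⟩, hc⟩
    have h4 : (l * m) ^ 4 = 1 := hlm
    rw [chi_of_eq_one h4] at hc
    replace hc := Subgroup.mem_centralizer_iff.1 hc
    have key : ∀ u', ∀ w' ∈ (twistThree K).grp, u' = l * u' + d ^ 3 * l ^ 6 * w' ∧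
        w' = (l * m : K) ^ 6 * w' := by
      intro u' w' hw'
      have h := hc _ (mem_centerOf_borel_bot.2 ⟨u', w', hw', rfl⟩)
      rw [quadPerm_mul, quadPerm_mul] at h
      obtain ⟨-, -, -, -, -, h6, -, h8⟩ := quadPerm_inj h
      simp at h6 h8
      exact ⟨by linear_combination h6, by linear_combination h8⟩
    have hl : l = 1 := by
      have := (key 1 0 (AddSubgroup.zero_mem _)).1
      ext
      simpa using this.symm
    subst hl
    have hd : d = 0 := by
      have := (key 0 _ om_mem).1
      simpa using this.symm
    have hm6 : m ^ 6 = 1 := by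
      have := (key 0 _ om_mem).2
      rw [Units.val_one, one_mul] at this
      ext
      rw [Units.val_pow_eq_pow_val]
      exact (mul_eq_right₀ (om K).ne_zero).1 this.symm
    have hm2 : m ^ 2 = 1 := by
      rw [one_mul] at h4
      rwa [show 6 = 4 + 2 by norm_num, pow_add, h4, one_mul] at hm6
    exact ⟨1, m, d, e, u, v, w, mem_diagSign.2 ⟨rfl, hm2⟩, Ideal.mem_bot.2 hd, trivial, hw, rfl⟩
  · rintro ⟨l, m, d, e, u, v, w, hlm, hd, -, hw, rfl⟩
    refine ⟨⟨l, m, d, e, u, v, w, diagSign_le_diagSq hlm, trivial, trivial, hw, rfl⟩, ?_⟩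
    rw [Ideal.mem_bot] at hd
    subst hd
    rw [chi_of_eq_one (mem_diagSq.1 (diagSign_le_diagSq hlm))]
    obtain ⟨rfl, h2⟩ := mem_diagSign.1 hlm
    refine Subgroup.mem_centralizer_iff.2 fun z hz => ?_
    obtain ⟨u', w', -, rfl⟩ := mem_centerOf_borel_bot.1 hz
    have h6 : (m : K) ^ 6 = 1 := by
      rw [← Units.val_pow_eq_pow_val, show 6 = 2 * 3 by norm_num, pow_mul, h2, one_pow,
        Units.val_one]
    rw [quadPerm_mul, quadPerm_mul]
    congr 1
    · simp [umap_one_left]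
    · simp
    · simp
    · simp [add_comm]
    · simp
    · simp [h6, add_comm]

/-! ### The quaternion complement -/

variable (K) in
/-- The powers of the square of `om K`, indexed by `ZMod 4`. -/
noncomputable def quartic (k : ZMod 4) : Kˣ := (om K ^ 2) ^ k.val

theorem om_sq_pow_four : (om K ^ 2) ^ 4 = 1 := by rw [← pow_mul]; exact unit_pow_eight _

theorem quartic_add (a b : ZMod 4) : quartic K (a + b) = quartic K a * quartic K b := by
  rw [quartic, quartic, quartic, ← pow_add, ZMod.val_add, ← pow_eq_pow_mod _ om_sq_pow_four]

theorem quartic_zero : quartic K 0 = 1 := pow_zero _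

theorem quartic_two : quartic K 2 = om K ^ 4 := by
  rw [quartic, ← pow_mul]; rfl

theorem quartic_pow_four (a : ZMod 4) : quartic K a ^ 4 = 1 := by
  rw [quartic, ← pow_mul, mul_comm, pow_mul, om_sq_pow_four, one_pow]

theorem quartic_neg (a : ZMod 4) : quartic K (-a) = quartic K a ^ 3 := by
  have h : quartic K (-a) * quartic K a = 1 := by rw [← quartic_add, neg_add_cancel, quartic_zero]
  rw [eq_inv_of_mul_eq_one_left h, inv_eq_iff_mul_eq_one, ← pow_succ']
  exact quartic_pow_four a

theorem quartic_eq_one {a : ZMod 4} (h : quartic K a = 1) : a = 0 := by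
  have hord : orderOf (om K ^ 2) = 2 ^ (1 + 1) := by
    apply orderOf_eq_prime_pow
    · rw [pow_one, ← pow_mul, om_pow_four]
      exact unit_neg_one_ne_one
    · exact om_sq_pow_four
  have h1 := orderOf_dvd_of_pow_eq_one h
  rw [hord] at h1
  have h2 := a.val_lt
  have h3 : a.val = 0 := Nat.eq_zero_of_dvd_of_lt h1 h2
  exact (ZMod.val_eq_zero a).1 h3

/-- The semilinear permutation attached to a unit. -/
noncomputable def semiPerm (x : Kˣ) : Equiv.Perm (K × K × K) := affPerm (tri x 1 0) (chi x) 0 0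

/-- The twist replaces the product of units by x·χ(x)(y), which is xy for x a square and xy³
otherwise. -/
theorem semiPerm_mul (x y : Kˣ) : semiPerm x * semiPerm y = semiPerm (x * umap (chi x) y) := by
  rw [semiPerm, semiPerm, semiPerm, affPerm_mul, map_mul, chi_umap]
  congr 1
  · rw [gmap_tri, map_zero, umap_one_right]
    ext i j
    fin_cases i <;> fin_cases j <;> simp [Matrix.mul_apply, Fin.sum_univ_two, coe_tri]
  · ext i; simp
  · simp

theorem umap_of_pow_four {x : Kˣ} (h : x ^ 4 = 1) (y : Kˣ) : umap (chi x) y = y := by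
  rw [chi_of_eq_one h]; rfl

theorem umap_of_pow_four_ne {x : Kˣ} (h : x ^ 4 ≠ 1) (y : Kˣ) : umap (chi x) y = y ^ 3 := by
  rw [chi_of_ne_one h]
  ext
  rw [coe_umap, frob_apply, Units.val_pow_eq_pow_val]

variable (K) in
/-- The unit attached to an element of the quaternion group. -/
noncomputable def quatUnit : QuaternionGroup 2 → Kˣ
  | .a k => quartic K k
  | .xa k => om K * quartic K (-k)

theorem om_mul_quartic (k : ZMod 4) : (om K * quartic K k) ^ 4 = -1 := by
  rw [mul_pow, quartic_pow_four, mul_one, om_pow_four]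

theorem om_mul_quartic_ne (k : ZMod 4) : (om K * quartic K k) ^ 4 ≠ 1 := by
  rw [om_mul_quartic]; exact unit_neg_one_ne_one

/-- Under the twisted product the powers of ω² form a cyclic group of order 4, ω inverts it by
cubing, and the twisted square of ω is ω⁴ = -1. These are the relations of Q₈. -/
theorem quatUnit_mul (x y : QuaternionGroup 2) :
    quatUnit K x * umap (chi (quatUnit K x)) (quatUnit K y) = quatUnit K (x * y) := by
  rcases x with i | i <;> rcases y with j | j
  · rw [QuaternionGroup.a_mul_a]
    change quartic K i * umap (chi (quartic K i)) (quartic K j) = quartic K (i + j)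
    rw [umap_of_pow_four (quartic_pow_four i), quartic_add]
  · rw [QuaternionGroup.a_mul_xa]
    change quartic K i * umap (chi (quartic K i)) (om K * quartic K (-j)) =
      om K * quartic K (-(j - i))
    rw [umap_of_pow_four (quartic_pow_four i), neg_sub, sub_eq_add_neg, quartic_add, mul_left_comm]
  · rw [QuaternionGroup.xa_mul_a]
    change om K * quartic K (-i) * umap (chi (om K * quartic K (-i))) (quartic K j) =
      om K * quartic K (-(i + j))
    rw [umap_of_pow_four_ne (om_mul_quartic_ne _), neg_add, quartic_add, ← quartic_neg, mul_assoc]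
  · rw [QuaternionGroup.xa_mul_xa]
    change om K * quartic K (-i) * umap (chi (om K * quartic K (-i))) (om K * quartic K (-j)) =
      quartic K (2 + j - i)
    rw [umap_of_pow_four_ne (om_mul_quartic_ne _), mul_pow, ← quartic_neg, neg_neg,
      sub_eq_add_neg, quartic_add, quartic_add, quartic_two,
      mul_mul_mul_comm, ← pow_succ', mul_comm (quartic K (-i)), mul_assoc]

variable (K) in
/-- The complement to `slPart K` in `stab₁ K`. -/
noncomputable def quatHom : QuaternionGroup 2 →* Equiv.Perm (K × K × K) where
  toFun x := semiPerm (quatUnit K x)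
  map_one' := by
    change semiPerm (quartic K 0) = 1
    rw [quartic_zero, semiPerm, map_one, ← affPerm_one]
    congr 1
    ext i j; fin_cases i <;> fin_cases j <;> simp [coe_tri]
  map_mul' x y := by rw [semiPerm_mul, quatUnit_mul]

theorem exists_quatUnit (x : Kˣ) : ∃ a, quatUnit K a = x := by
  obtain ⟨n, rfl⟩ := exists_eq_om_pow x
  have key : ∀ k : ℕ, quartic K (k : ZMod 4) = om K ^ (2 * k) := by
    intro k
    rw [quartic, ZMod.val_natCast, ← pow_eq_pow_mod _ om_sq_pow_four, ← pow_mul]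
  rcases Nat.even_or_odd' n with ⟨k, rfl | rfl⟩
  · exact ⟨.a k, key k⟩
  · refine ⟨.xa (-k), ?_⟩
    change om K * quartic K (- -(k : ZMod 4)) = _
    rw [neg_neg, key, pow_succ']

/-- The complement contains exactly one element of each determinant. -/
theorem isSplit_stab₁ : IsSplit (slPart K) (stab₁ K) (quatHom K) where
  le := slPart_le_stab₁
  range_le a := affPerm_mem_affSub.2
    ⟨trivial, by rw [det_tri, mul_one], AddSubgroup.zero_mem _⟩
  conj_mem a z hz := (affSub_normal bot_le).2 _ (affPerm_mem_affSub.2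
    ⟨trivial, by rw [det_tri, mul_one], AddSubgroup.zero_mem _⟩) z hz
  disjoint := by
    intro a ha
    have h := (affPerm_mem_affSub.1 ha).1
    rw [det_tri, mul_one, Subgroup.mem_bot] at h
    rcases a with i | i
    · rw [quartic_eq_one h]; rfl
    · have h4 : (om K * quartic K (-i)) ^ 4 = 1 := by
        have h' : om K * quartic K (-i) = 1 := h
        rw [h', one_pow]
      exact absurd h4 (om_mul_quartic_ne _)
  exists_mul := by
    intro g hg
    obtain ⟨M, t, w, -, hw, rfl⟩ := id hg
    obtain ⟨a, ha⟩ := exists_quatUnit (GeneralLinearGroup.det M)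
    have hJ : quatHom K a ∈ stab₁ K := affPerm_mem_affSub.2
      ⟨trivial, by rw [det_tri, mul_one], AddSubgroup.zero_mem _⟩
    refine ⟨_ * (quatHom K a)⁻¹, ?_, a, (inv_mul_cancel_right _ _).symm⟩
    obtain ⟨M', t', w', -, hw', h⟩ := (stab₁ K).mul_mem hg ((stab₁ K).inv_mem hJ)
    rw [h]
    refine ⟨M', t', w', ?_, hw', rfl⟩
    rw [mul_inv_eq_iff_eq_mul] at h
    change _ = _ * affPerm (tri (quatUnit K a) 1 0) (chi (quatUnit K a)) 0 0 at h
    rw [ha, affPerm_mul] at h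
    obtain ⟨h1, h2, -⟩ := affPerm_inj h
    rw [right_eq_mul] at h2
    rw [h2] at h1
    have h3 := congrArg GeneralLinearGroup.det h1
    rw [map_mul, det_gmap, det_tri, mul_one, umap_one_left, right_eq_mul] at h3
    exact h3

end PermK

/-! ### Covers of coset graphs -/

namespace bicosetGraph

variable {G G' : Type} [Group G] [Group G'] {Q₁ Q₂ : Subgroup G} {Q₁' Q₂' : Subgroup G'}

/-- The neighbours of a coset of Q₁ correspond to Q₁/(Q₁ ∩ Q₂). The factorizations give surjectivity
on vertices and neighbours, and the last two hypotheses give injectivity on neighbours. -/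
theorem isCoverOf (f : G →* G') (h₁ : ∀ x ∈ Q₁, f x ∈ Q₁') (h₂ : ∀ x ∈ Q₂, f x ∈ Q₂')
    (hs : ∀ g : G', ∃ r, ∃ q ∈ Q₁' ⊓ Q₂', g = f r * q)
    (hs₁ : ∀ g ∈ Q₁', ∃ r ∈ Q₁, ∃ q ∈ Q₂', g = f r * q)
    (hs₂ : ∀ g ∈ Q₂', ∃ r ∈ Q₂, ∃ q ∈ Q₁', g = f r * q)
    (hi₁ : ∀ x ∈ Q₁, f x ∈ Q₂' → x ∈ Q₂) (hi₂ : ∀ x ∈ Q₂, f x ∈ Q₁' → x ∈ Q₁) :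
    IsCoverOf (bicosetGraph Q₁ Q₂) (bicosetGraph Q₁' Q₂') := by
  let π₁ : G ⧸ Q₁ → G' ⧸ Q₁' := Quotient.map' f fun a b h => by
    rw [QuotientGroup.leftRel_apply] at h ⊢
    simpa using h₁ _ h
  let π₂ : G ⧸ Q₂ → G' ⧸ Q₂' := Quotient.map' f fun a b h => by
    rw [QuotientGroup.leftRel_apply] at h ⊢
    simpa using h₂ _ h
  have e₁ : ∀ g : G, π₁ (g : G ⧸ Q₁) = ((f g : G') : G' ⧸ Q₁') := fun _ => rfl
  have e₂ : ∀ g : G, π₂ (g : G ⧸ Q₂) = ((f g : G') : G' ⧸ Q₂') := fun _ => rfl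
  have hom : ∀ g : G, ∀ y, (bicosetGraph Q₁ Q₂).Adj (Sum.inl (g : G ⧸ Q₁)) y →
      (bicosetGraph Q₁' Q₂').Adj (Sum.map π₁ π₂ (Sum.inl (g : G ⧸ Q₁))) (Sum.map π₁ π₂ y) := by
    intro g y h
    obtain ⟨q, hq, rfl⟩ := exists_of_adj_inl h
    rw [Sum.map_inl, Sum.map_inr, e₁, e₂, map_mul]
    exact adj_mk_mul_right _ (h₁ q hq)
  refine ⟨⟨Sum.map π₁ π₂, ?_⟩, ?_, ?_⟩
  · intro a b h
    rcases a with a | a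
    · obtain ⟨g, rfl⟩ := QuotientGroup.mk_surjective a
      exact hom g b h
    · obtain ⟨g, rfl⟩ := QuotientGroup.mk_surjective a
      obtain ⟨q, hq, rfl⟩ := exists_of_adj_inr h
      exact (hom _ _ h.symm).symm
  · rintro (y | y)
    · obtain ⟨g, rfl⟩ := QuotientGroup.mk_surjective y
      obtain ⟨r, q, hq, rfl⟩ := hs g
      refine ⟨Sum.inl (r : G ⧸ Q₁), ?_⟩
      change Sum.inl (π₁ r) = _
      rw [e₁]
      exact congrArg Sum.inl (QuotientGroup.eq.2 (by simpa using hq.1))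
    · obtain ⟨g, rfl⟩ := QuotientGroup.mk_surjective y
      obtain ⟨r, q, hq, rfl⟩ := hs g
      refine ⟨Sum.inr (r : G ⧸ Q₂), ?_⟩
      change Sum.inr (π₂ r) = _
      rw [e₂]
      exact congrArg Sum.inr (QuotientGroup.eq.2 (by simpa using hq.2))
  · rintro (v | v)
    · obtain ⟨g, rfl⟩ := QuotientGroup.mk_surjective v
      refine ⟨fun y hy => hom g y hy, ?_, ?_⟩
      · intro y hy z hz h
        obtain ⟨q, hq, rfl⟩ := exists_of_adj_inl hy
        obtain ⟨r, hr, rfl⟩ := exists_of_adj_inl hz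
        have h' := QuotientGroup.eq.1 (Sum.inr.inj h)
        refine congrArg Sum.inr (QuotientGroup.eq.2 ?_)
        have hqr := hi₁ (q⁻¹ * r) (Q₁.mul_mem (Q₁.inv_mem hq) hr) (by
          rw [← map_inv, ← map_mul] at h'
          simpa [mul_assoc] using h')
        simpa [mul_assoc] using hqr
      · intro y hy
        obtain ⟨q, hq, rfl⟩ := exists_of_adj_inl (g := f g) hy
        obtain ⟨r, hr, s, hs, rfl⟩ := hs₁ q hq
        refine ⟨_, adj_mk_mul_right g hr, ?_⟩
        change Sum.inr (π₂ _) = _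
        rw [e₂]
        exact congrArg Sum.inr (QuotientGroup.eq.2 (by simpa [mul_assoc] using hs))
    · obtain ⟨g, rfl⟩ := QuotientGroup.mk_surjective v
      refine ⟨?_, ?_, ?_⟩
      · intro y hy
        obtain ⟨q, hq, rfl⟩ := exists_of_adj_inr hy
        exact (hom _ _ (SimpleGraph.Adj.symm hy)).symm
      · intro y hy z hz h
        obtain ⟨q, hq, rfl⟩ := exists_of_adj_inr hy
        obtain ⟨r, hr, rfl⟩ := exists_of_adj_inr hz
        have h' := QuotientGroup.eq.1 (Sum.inl.inj h)
        refine congrArg Sum.inl (QuotientGroup.eq.2 ?_)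
        have hqr := hi₂ (q⁻¹ * r) (Q₂.mul_mem (Q₂.inv_mem hq) hr) (by
          rw [← map_inv, ← map_mul] at h'
          simpa [mul_assoc] using h')
        simpa [mul_assoc] using hqr
      · intro y hy
        obtain ⟨q, hq, rfl⟩ := exists_of_adj_inr (g := f g) hy
        obtain ⟨r, hr, s, hs, rfl⟩ := hs₂ q hq
        refine ⟨_, adj_mk_mul_left g hr, ?_⟩
        change Sum.inl (π₁ _) = _
        rw [e₁]
        exact congrArg Sum.inl (QuotientGroup.eq.2 (by simpa [mul_assoc] using hs))

end bicosetGraph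

/-- S lies in both G₁ and G₂ and completes each Rᵢ to Gᵢ, so it contributes no new cosets; normality
turns the joins into products of sets. -/
theorem isCoverOf_cosetGraph {X : Type} [Group X] {R₁ R₂ G₁ G₂ S : Subgroup X} (h₁ : R₁ ≤ G₁)
    (h₂ : R₂ ≤ G₂) (hS₁ : S ≤ G₁) (hS₂ : S ≤ G₂) (hG₁ : G₁ ≤ R₁ ⊔ S) (hG₂ : G₂ ≤ R₂ ⊔ S)
    (hn₁ : S ≤ Subgroup.normalizer (R₁ : Set X)) (hn₂ : S ≤ Subgroup.normalizer (R₂ : Set X))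
    (hi₁ : R₁ ⊓ G₂ ≤ R₂) (hi₂ : R₂ ⊓ G₁ ≤ R₁) :
    IsCoverOf (cosetGraph R₁ R₂) (cosetGraph G₁ G₂) := by
  have hle : R₁ ⊔ R₂ ≤ G₁ ⊔ G₂ := sup_le_sup h₁ h₂
  have hdec : ∀ {R : Subgroup X}, S ≤ Subgroup.normalizer (R : Set X) → ∀ g ∈ R ⊔ S,
      ∃ r ∈ R, ∃ s ∈ S, g = r * s := by
    intro R hR g hg
    have : g ∈ ((R ⊔ S : Subgroup X) : Set X) := hg
    rw [Subgroup.coe_mul_of_right_le_normalizer_left R S hR] at this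
    obtain ⟨r, hr, s, hs, rfl⟩ := this
    exact ⟨r, hr, s, hs, rfl⟩
  have hn : S ≤ Subgroup.normalizer ((R₁ ⊔ R₂ : Subgroup X) : Set X) :=
    (le_inf hn₁ hn₂).trans (Subgroup.normalizer_inf_normalizer_le_normalizer_sup R₁ R₂)
  refine bicosetGraph.isCoverOf (Subgroup.inclusion hle) (fun x hx => h₁ hx) (fun x hx => h₂ hx)
    ?_ ?_ ?_ (fun x hx hx' => hi₁ ⟨hx, hx'⟩) (fun x hx hx' => hi₂ ⟨hx, hx'⟩)
  · rintro ⟨g, hg⟩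
    obtain ⟨r, hr, s, hs, rfl⟩ := hdec hn g
      (sup_le (hG₁.trans (sup_le_sup_right le_sup_left S))
        (hG₂.trans (sup_le_sup_right le_sup_right S)) hg)
    exact ⟨⟨r, hr⟩, ⟨s, (hS₁.trans le_sup_left) hs⟩, ⟨hS₁ hs, hS₂ hs⟩, rfl⟩
  · rintro ⟨g, hg⟩ hg₁
    obtain ⟨r, hr, s, hs, rfl⟩ := hdec hn₁ g (hG₁ hg₁)
    exact ⟨⟨r, (le_sup_left : R₁ ≤ R₁ ⊔ R₂) hr⟩, hr, ⟨s, (hS₁.trans le_sup_left) hs⟩, hS₂ hs, rfl⟩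
  · rintro ⟨g, hg⟩ hg₁
    obtain ⟨r, hr, s, hs, rfl⟩ := hdec hn₂ g (hG₂ hg₁)
    exact ⟨⟨r, (le_sup_right : R₂ ≤ R₁ ⊔ R₂) hr⟩, hr, ⟨s, (hS₁.trans le_sup_left) hs⟩, hS₁ hs, rfl⟩

namespace PermK

open Matrix

variable {K : Type} [Field K] [Finite K] [CharP K 3] [hK : Fact (Nat.card K = 9)]

/-! ### Generators -/

theorem eps_eq : eps K = 3 := by
  rw [eps, hK.out]

theorem α_eq (u v w : K) : α u v w = affPerm 1 1 ![u, v] w := by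
  ext1 ⟨a, b, c⟩
  simp [α, affPerm_apply]

theorem β_eq (l m : Kˣ) : β l m = affPerm (tri l m 0) 1 0 0 := by
  ext1 ⟨a, b, c⟩
  simp [β, affPerm_apply, eps_eq, coe_tri, det_tri]

theorem γ_eq (e : K) : γ e = affPerm (tri 1 1 e) 1 0 0 := by
  ext1 ⟨a, b, c⟩
  simp [γ, affPerm_apply, coe_tri, det_tri]

theorem δ_eq : δ K = affPerm (turn K) 1 0 0 := by
  ext1 ⟨a, b, c⟩
  simp [δ, affPerm_apply, coe_turn, det_turn]

theorem τ_eq (d : K) : τ d = quadPerm 1 1 1 d 0 0 0 0 := by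
  ext1 ⟨a, b, c⟩
  simp [τ, quadPerm_apply, eps_eq, add_assoc]

theorem σ_eq : σ K = affPerm 1 (frob K) 0 0 := by
  ext1 ⟨a, b, c⟩
  simp [affPerm_apply, frob_apply]
  rfl

/-- The elements of the quaternion group `grpJ K`. -/
noncomputable def jPerm (m : Kˣ) : Equiv.Perm (K × K × K) :=
  affPerm (tri (m ^ 2) m 0) (chi m) 0 0

theorem chi_cube (m : Kˣ) : chi (m ^ 3) = chi m := by
  rw [pow_succ, map_mul, chi_of_eq_one (x := m ^ 2), one_mul]
  rw [← pow_mul]; exact unit_pow_eight m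

theorem cube_cube (m : Kˣ) : (m ^ 3) ^ 3 = m := by
  rw [← pow_mul, show 3 * 3 = 8 + 1 by norm_num, pow_add, unit_pow_eight, one_mul, pow_one]

theorem σ_mul_β {m : Kˣ} (h : ¬ IsSquare m) : σ K * β (m ^ 2) m = jPerm (m ^ 3) := by
  rw [isSquare_iff] at h
  rw [σ_eq, β_eq, affPerm_mul, jPerm, chi_cube, chi_of_ne_one h, gmap_tri, mul_one, one_mul,
    map_zero]
  congr 1
  · congr 1
    ext; simp [frob_apply, ← pow_mul]
  · ext i; simp
  · simp

theorem β_eq_jPerm {m : Kˣ} (h : IsSquare m) : β (m ^ 2) m = jPerm m := by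
  rw [isSquare_iff] at h
  rw [β_eq, jPerm, chi_of_eq_one h]

/-- Cubing permutes the non-squares, so every twisted element arises as some σβ. -/
theorem jPerm_mem_grpJ (m : Kˣ) : jPerm m ∈ grpJ K := by
  by_cases h : IsSquare m
  · exact Subgroup.subset_closure (Or.inl ⟨m, h, (β_eq_jPerm h).symm⟩)
  · have h' : ¬ IsSquare (m ^ 3) := by
      rw [isSquare_iff, ← chi_eq_one_iff, chi_cube, chi_eq_one_iff, ← isSquare_iff]
      exact h
    have := σ_mul_β h'
    rw [cube_cube] at this
    exact Subgroup.subset_closure (Or.inr ⟨_, h', this.symm⟩)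

theorem grpJ_le {P : Subgroup (Equiv.Perm (K × K × K))} (h : ∀ m, jPerm m ∈ P) : grpJ K ≤ P := by
  refine (Subgroup.closure_le P).2 ?_
  rintro _ (⟨m, hm, rfl⟩ | ⟨m, hm, rfl⟩)
  · rw [β_eq_jPerm hm]; exact h m
  · rw [σ_mul_β hm]; exact h _

theorem σ_mem : σ K ∈ grpSigma K := Subgroup.subset_closure rfl

theorem grpS_le : grpS K ≤ grpJ K ⊔ grpSigma K := by
  refine (Subgroup.closure_le _).2 ?_
  rintro _ ⟨m, rfl⟩
  by_cases h : IsSquare m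
  · rw [β_eq_jPerm h]
    exact (le_sup_left : grpJ K ≤ _) (jPerm_mem_grpJ m)
  · have h1 : σ K * β (m ^ 2) m ∈ grpJ K ⊔ grpSigma K := by
      rw [σ_mul_β h]
      exact (le_sup_left : grpJ K ≤ _) (jPerm_mem_grpJ _)
    exact (Subgroup.mul_mem_cancel_left _ ((le_sup_right : grpSigma K ≤ _) σ_mem)).1 h1

theorem grpJ_le_sup : grpJ K ≤ grpS K ⊔ grpSigma K := by
  have hβ : ∀ m : Kˣ, β (m ^ 2) m ∈ grpS K ⊔ grpSigma K := fun m =>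
    (le_sup_left : grpS K ≤ _) (Subgroup.subset_closure ⟨m, rfl⟩)
  refine (Subgroup.closure_le _).2 ?_
  rintro _ (⟨m, -, rfl⟩ | ⟨m, -, rfl⟩)
  · exact hβ m
  · exact Subgroup.mul_mem _ ((le_sup_right : grpSigma K ≤ _) σ_mem) (hβ m)

theorem α_mul (u v w : K) : α u v w = α u v 0 * α 0 0 w := by
  rw [α_eq, α_eq, α_eq, affPerm_mul]
  congr 1
  · rw [one_mul]; exact (map_one _).symm
  · ext i; fin_cases i <;> simp
  · simp

theorem grpA_le : grpA K ≤ grpV K ⊔ grpF K := by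
  refine (Subgroup.closure_le _).2 ?_
  rintro _ ⟨u, v, w, rfl⟩
  rw [α_mul]
  exact Subgroup.mul_mem_sup (Subgroup.subset_closure ⟨u, v, rfl⟩)
    (Subgroup.subset_closure ⟨w, rfl⟩)

theorem grpV_le : grpV K ≤ grpA K := by
  refine (Subgroup.closure_le _).2 ?_
  rintro _ ⟨u, v, rfl⟩
  exact Subgroup.subset_closure ⟨u, v, 0, rfl⟩

theorem grpF_le : grpF K ≤ grpA K := by
  refine (Subgroup.closure_le _).2 ?_
  rintro _ ⟨w, rfl⟩
  exact Subgroup.subset_closure ⟨0, 0, w, rfl⟩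

theorem G₁J_le_G₁ : G₁J K ≤ G₁ K := by
  have hJ : grpJ K ≤ G₁ K := grpJ_le_sup.trans
    (sup_le (le_sup_right.trans le_sup_left) le_sup_right)
  have hA : grpA K ≤ G₁ K := (le_sup_left.trans le_sup_left).trans le_sup_left
  have hM : grpM K ≤ G₁ K := (le_sup_right.trans le_sup_left).trans le_sup_left
  exact sup_le (sup_le (sup_le (grpV_le.trans hA) hM) (grpF_le.trans hA)) hJ

theorem G₁_le : G₁ K ≤ G₁J K ⊔ grpSigma K := by
  have hV : grpV K ≤ G₁J K := (le_sup_left.trans le_sup_left).trans le_sup_left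
  have hM : grpM K ≤ G₁J K := (le_sup_right.trans le_sup_left).trans le_sup_left
  have hF : grpF K ≤ G₁J K := le_sup_right.trans le_sup_left
  have hJ : grpJ K ≤ G₁J K := le_sup_right
  exact sup_le (sup_le (sup_le (grpA_le.trans ((sup_le hV hF).trans le_sup_left))
    (hM.trans le_sup_left)) (grpS_le.trans (sup_le_sup_right hJ _))) le_sup_right

theorem G₂J_le_G₂ : G₂J K ≤ G₂ K := by
  have hS : grpS K ≤ G₂ K :=
    ((le_sup_right.trans le_sup_left).trans le_sup_left).trans le_sup_left
  have hJ : grpJ K ≤ G₂ K := grpJ_le_sup.trans (sup_le hS le_sup_right)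
  have hA : grpA K ≤ G₂ K :=
    (((le_sup_left.trans le_sup_left).trans le_sup_left).trans le_sup_left).trans le_sup_left
  have hC : grpC K ≤ G₂ K :=
    (((le_sup_right.trans le_sup_left).trans le_sup_left).trans le_sup_left).trans le_sup_left
  have hE : grpE K ≤ G₂ K := (le_sup_right.trans le_sup_left).trans le_sup_left
  have hT : grpT K ≤ G₂ K := le_sup_right.trans le_sup_left
  exact sup_le (sup_le (sup_le (sup_le (sup_le (grpV_le.trans hA) hC) hE) hT) (grpF_le.trans hA)) hJ

theorem G₂_le : G₂ K ≤ G₂J K ⊔ grpSigma K := by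
  have hV : grpV K ≤ G₂J K :=
    (((le_sup_left.trans le_sup_left).trans le_sup_left).trans le_sup_left).trans le_sup_left
  have hC : grpC K ≤ G₂J K :=
    (((le_sup_right.trans le_sup_left).trans le_sup_left).trans le_sup_left).trans le_sup_left
  have hE : grpE K ≤ G₂J K := ((le_sup_right.trans le_sup_left).trans le_sup_left).trans le_sup_left
  have hT : grpT K ≤ G₂J K := (le_sup_right.trans le_sup_left).trans le_sup_left
  have hF : grpF K ≤ G₂J K := le_sup_right.trans le_sup_left
  have hJ : grpJ K ≤ G₂J K := le_sup_right
  exact sup_le (sup_le (sup_le (sup_le (sup_le (grpA_le.trans ((sup_le hV hF).trans le_sup_left))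
    (hC.trans le_sup_left)) (grpS_le.trans (sup_le_sup_right hJ _))) (hE.trans le_sup_left))
    (hT.trans le_sup_left)) le_sup_right

/-! ### Identification of the containing amalgam -/

theorem affPerm_one_mem_big₁ {M : GL (Fin 2) K} (h : GeneralLinearGroup.det M = 1) (t : Fin 2 → K)
    (w : K) : affPerm M 1 t w ∈ big₁ K :=
  affPerm_mem_affSub.2 ⟨trivial, by rw [h, map_one], trivial⟩

theorem jPerm_mem_big₁ (m : Kˣ) : jPerm m ∈ big₁ K :=
  affPerm_mem_affSub.2 ⟨trivial, by rw [det_tri, ← pow_succ, chi_cube], trivial⟩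

theorem β_inv_mem_big₁ (m : Kˣ) : β m m⁻¹ ∈ big₁ K := by
  rw [β_eq]
  exact affPerm_one_mem_big₁ (by rw [det_tri, mul_inv_cancel]) _ _

theorem G₁J_le_big₁ : G₁J K ≤ big₁ K := by
  refine sup_le (sup_le (sup_le ?_ (sup_le (sup_le ?_ ?_) ?_)) ?_) (grpJ_le jPerm_mem_big₁) <;>
    refine (Subgroup.closure_le _).2 ?_
  · rintro _ ⟨u, v, rfl⟩
    rw [α_eq]; exact affPerm_one_mem_big₁ (map_one _) _ _
  · rintro _ ⟨e, rfl⟩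
    rw [γ_eq]; exact affPerm_one_mem_big₁ (by rw [det_tri, one_mul]) _ _
  · rintro _ rfl
    rw [δ_eq]; exact affPerm_one_mem_big₁ det_turn _ _
  · rintro _ ⟨m, rfl⟩
    exact β_inv_mem_big₁ m
  · rintro _ ⟨w, rfl⟩
    rw [α_eq]; exact affPerm_one_mem_big₁ (map_one _) _ _

theorem affPerm_mem_grpM {M : GL (Fin 2) K} (h : GeneralLinearGroup.det M = 1) :
    affPerm M 1 0 0 ∈ grpM K := by
  let N : Subgroup (GL (Fin 2) K) := (grpM K).comap ((aglHom K).comp SemidirectProduct.inr)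
  have hu : ∀ e, tri 1 1 e ∈ N := by
    intro e
    change affPerm (tri 1 1 e) 1 0 0 ∈ grpM K
    rw [← γ_eq]
    exact (le_sup_left.trans le_sup_left : grpC K ≤ grpM K) (Subgroup.subset_closure ⟨e, rfl⟩)
  have ht : turn K ∈ N := by
    change affPerm (turn K) 1 0 0 ∈ grpM K
    rw [← δ_eq]
    exact (le_sup_right.trans le_sup_left : grpD K ≤ grpM K) (Subgroup.subset_closure rfl)
  exact mem_of_det_eq_one (S := N) hu (fun x => by
    rw [← turn_conj_tri]
    exact N.mul_mem (N.mul_mem ht (hu _)) (N.inv_mem ht)) h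

theorem trans_mem_sup (t : Fin 2 → K) (w : K) : affPerm 1 1 t w ∈ grpV K ⊔ grpF K := by
  rw [vec_eta t, ← α_eq]
  exact grpA_le (Subgroup.subset_closure ⟨_, _, _, rfl⟩)

/-- Every determinant is μ³ = det diag(μ², μ) for some μ, so a suitable element of J absorbs both
determinant and twist, leaving a factor of determinant one. -/
theorem G₁J_eq : G₁J K = big₁ K := by
  refine G₁J_le_big₁.antisymm ?_
  have hV : grpV K ≤ G₁J K := (le_sup_left.trans le_sup_left).trans le_sup_left
  have hM : grpM K ≤ G₁J K := (le_sup_right.trans le_sup_left).trans le_sup_left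
  have hF : grpF K ≤ G₁J K := le_sup_right.trans le_sup_left
  have hJ : grpJ K ≤ G₁J K := le_sup_right
  rintro _ ⟨M, t, w, -, -, rfl⟩
  obtain ⟨μ, hμ⟩ : ∃ μ : Kˣ, μ ^ 3 = GeneralLinearGroup.det M := ⟨_, cube_cube _⟩
  have h1 : affPerm M (chi (GeneralLinearGroup.det M)) t w =
      affPerm 1 1 t w * (affPerm (M * (tri (μ ^ 2) μ 0)⁻¹) 1 0 0 * jPerm μ) := by
    rw [← hμ, chi_cube, jPerm, affPerm_mul, affPerm_mul]
    congr 1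
    · rw [one_mul]
      change M = M * (tri (μ ^ 2) μ 0)⁻¹ * tri (μ ^ 2) μ 0
      rw [inv_mul_cancel_right]
    · ext i; simp
    · simp
  rw [h1]
  refine Subgroup.mul_mem _ (sup_le hV hF (trans_mem_sup t w)) (Subgroup.mul_mem _ (hM ?_)
    (hJ (jPerm_mem_grpJ μ)))
  apply affPerm_mem_grpM
  rw [map_mul, map_inv, det_tri, ← pow_succ, hμ, mul_inv_cancel]

theorem affPerm_tri_mem_big₂ {l m : Kˣ} {φ : RingAut K} (h : φ = chi (l * m)) (e : K)
    (t : Fin 2 → K) (w : K) : affPerm (tri l m e) φ t w ∈ big₂ K := by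
  rw [vec_eta t, ← quadPerm_zero]
  exact quadPerm_mem_quadSub.2 ⟨trivial, h, trivial, trivial, trivial⟩

theorem tri_one_one_zero : tri 1 1 0 = (1 : GL (Fin 2) K) := by
  ext i j; fin_cases i <;> fin_cases j <;> simp [coe_tri]

theorem G₂J_le_big₂ : G₂J K ≤ big₂ K := by
  have hα : ∀ u v w : K, α u v w ∈ big₂ K := fun u v w => by
    rw [α_eq, ← tri_one_one_zero]
    exact affPerm_tri_mem_big₂ (by rw [mul_one, map_one]) _ _ _
  refine sup_le (sup_le (sup_le (sup_le (sup_le ?_ ?_) ?_) ?_) ?_) (grpJ_le fun m =>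
      affPerm_tri_mem_big₂ (by rw [← pow_succ, chi_cube]) _ _ _) <;>
    refine (Subgroup.closure_le _).2 ?_
  · rintro _ ⟨u, v, rfl⟩
    exact hα _ _ _
  · rintro _ ⟨e, rfl⟩
    rw [γ_eq]
    exact affPerm_tri_mem_big₂ (by rw [mul_one, map_one]) _ _ _
  · rintro _ ⟨d, rfl⟩
    rw [τ_eq]
    exact stab₂_le_big₂ (tau_mem_stab₂ d)
  · rintro _ ⟨m, rfl⟩
    rw [β_eq]
    exact affPerm_tri_mem_big₂ (by rw [mul_inv_cancel, map_one]) _ _ _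
  · rintro _ ⟨w, rfl⟩
    exact hα _ _ _

theorem G₂J_eq : G₂J K = big₂ K := by
  refine G₂J_le_big₂.antisymm ?_
  have hV : grpV K ≤ G₂J K :=
    (((le_sup_left.trans le_sup_left).trans le_sup_left).trans le_sup_left).trans le_sup_left
  have hC : grpC K ≤ G₂J K :=
    (((le_sup_right.trans le_sup_left).trans le_sup_left).trans le_sup_left).trans le_sup_left
  have hE : grpE K ≤ G₂J K := ((le_sup_right.trans le_sup_left).trans le_sup_left).trans le_sup_left
  have hT : grpT K ≤ G₂J K := (le_sup_right.trans le_sup_left).trans le_sup_left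
  have hF : grpF K ≤ G₂J K := le_sup_right.trans le_sup_left
  have hJ : grpJ K ≤ G₂J K := le_sup_right
  rintro _ ⟨l, m, d, e, u, v, w, -, -, -, -, rfl⟩
  obtain ⟨μ, hμ⟩ : ∃ μ : Kˣ, μ ^ 3 = l * m := ⟨_, cube_cube _⟩
  -- diag(l, m) is an element of T times diag(μ², μ); the second entry fixes the parameter μ/m, and
  -- lm = μ³ settles the first.
  have h2 : quadPerm l m (chi (l * m)) 0 0 0 0 0 = β (μ * m⁻¹) (μ * m⁻¹)⁻¹ * jPerm μ := by
    rw [← hμ, chi_cube, β_eq, jPerm, affPerm_mul, quadPerm_zero]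
    congr 1
    · change tri l m 0 = tri (μ * m⁻¹) (μ * m⁻¹)⁻¹ 0 * tri (μ ^ 2) μ 0
      have hl : (l : K) = μ * m⁻¹ * μ ^ 2 := by
        have := congrArg Units.val (eq_mul_inv_of_mul_eq hμ.symm)
        rw [Units.val_mul, Units.val_pow_eq_pow_val] at this
        linear_combination this
      ext i j
      fin_cases i <;> fin_cases j <;> simp [Matrix.mul_apply, Fin.sum_univ_two, coe_tri, hl]
    · ext i; fin_cases i <;> simp
    · simp
  have h1 : quadPerm l m (chi (l * m)) d e u v w = affPerm 1 1 ![u, v] w *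
      (γ (e * (m⁻¹ : Kˣ)) * (τ (d * ((m ^ 2)⁻¹ : Kˣ)) * quadPerm l m (chi (l * m)) 0 0 0 0 0)) := by
    rw [affPerm_trans_eq, γ_eq, τ_eq, show (0 : Fin 2 → K) = ![0, 0] from vec_eta 0, ← quadPerm_zero,
      quadPerm_mul, quadPerm_mul, quadPerm_mul]
    simp [umap_one_left]
  rw [h1, h2]
  refine Subgroup.mul_mem _ (sup_le hV hF (trans_mem_sup _ w)) (Subgroup.mul_mem _
    (hC (Subgroup.subset_closure ⟨_, rfl⟩)) (Subgroup.mul_mem _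
    (hE (Subgroup.subset_closure ⟨_, rfl⟩)) (Subgroup.mul_mem _
    (hT (Subgroup.subset_closure ⟨_, rfl⟩)) (hJ (jPerm_mem_grpJ μ)))))

theorem frob_mul_chi (x : Kˣ) : frob K * chi x = chi x * frob K := by
  rcases chi_apply_cases x with ⟨h, -⟩ | ⟨h, -⟩ <;> rw [h]
  rw [one_mul, mul_one]

theorem grpSigma_le_normalizer₁ :
    grpSigma K ≤ Subgroup.normalizer (big₁ K : Set (Equiv.Perm (K × K × K))) := by
  refine (Subgroup.closure_le _).2 ?_
  rintro _ rfl
  apply Subgroup.mem_normalizer_fintype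
  rintro _ ⟨M, t, w, -, -, rfl⟩
  refine ⟨gmap (frob K) M, fun i => frob K (t i), frob K w, trivial, trivial, ?_⟩
  rw [mul_inv_eq_iff_eq_mul, det_gmap, chi_umap, σ_eq, affPerm_mul, affPerm_mul, frob_mul_chi]
  congr 1
  · rw [one_mul]
    have : gmap (chi (GeneralLinearGroup.det M)) (1 : GL (Fin 2) K) = 1 := map_one _
    rw [this, mul_one]
  · ext i; fin_cases i <;> simp
  · simp

theorem σ_eq_quadPerm : σ K = quadPerm 1 1 (frob K) 0 0 0 0 0 := by
  rw [σ_eq, quadPerm_zero, tri_one_one_zero]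
  exact congrArg (fun t => affPerm 1 (frob K) t 0) (vec_eta 0)

theorem grpSigma_le_normalizer₂ :
    grpSigma K ≤ Subgroup.normalizer (big₂ K : Set (Equiv.Perm (K × K × K))) := by
  refine (Subgroup.closure_le _).2 ?_
  rintro _ rfl
  apply Subgroup.mem_normalizer_fintype
  rintro _ ⟨l, m, d, e, u, v, w, -, -, -, -, rfl⟩
  refine ⟨umap (frob K) l, umap (frob K) m, frob K d, frob K e, frob K u, frob K v, frob K w,
    trivial, trivial, trivial, trivial, ?_⟩
  rw [mul_inv_eq_iff_eq_mul, ← map_mul, chi_umap, σ_eq_quadPerm, quadPerm_mul, quadPerm_mul,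
    frob_mul_chi]
  simp

theorem mem_grpSigma {s : Equiv.Perm (K × K × K)} (h : s ∈ grpSigma K) : s = 1 ∨ s = σ K := by
  have hσ : σ K * σ K = 1 := by
    rw [σ_eq_quadPerm, quadPerm_mul, frob_mul_frob, ← quadPerm_one]
    simp
  have hle : grpSigma K ≤ subgroupOfMulClosed {1, σ K} (Or.inl rfl) (by
      rintro _ (rfl | rfl) _ (rfl | rfl)
      · exact Or.inl (one_mul 1)
      · exact Or.inr (one_mul _)
      · exact Or.inr (mul_one _)
      · exact Or.inl hσ) :=
    (Subgroup.closure_le _).2 fun x hx => Or.inr hx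
  exact hle h

theorem mul_frob_ne (φ : RingAut K) : φ ≠ φ * frob K := fun h => frob_ne_one (left_eq_mul.1 h)

/-- An element of G₂ outside R₂ is rσ with r ∈ R₂. Its twist differs from χ of its diagonal by the
Frobenius, so it cannot lie in R₁. -/
theorem big₁_inf_G₂ : big₁ K ⊓ G₂ K ≤ big₂ K := by
  rintro g ⟨h1, h2⟩
  have h3 : g ∈ ((big₂ K ⊔ grpSigma K : Subgroup (Equiv.Perm (K × K × K))) : Set _) := by
    rw [← G₂J_eq]; exact G₂_le h2
  rw [Subgroup.coe_mul_of_right_le_normalizer_left _ _ grpSigma_le_normalizer₂] at h3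
  obtain ⟨r, hr, s, hs, rfl⟩ := h3
  rcases mem_grpSigma hs with rfl | rfl
  · simpa using hr
  · exfalso
    obtain ⟨l, m, d, e, u, v, w, -, -, -, -, rfl⟩ := hr
    change quadPerm _ _ _ _ _ _ _ _ * σ K ∈ big₁ K at h1
    rw [σ_eq_quadPerm, quadPerm_mul] at h1
    have h4 := (quadPerm_mem_affSub.1 h1).2.2.1
    rw [umap_one_right, mul_one, mul_one] at h4
    exact mul_frob_ne _ h4.symm

theorem big₂_inf_G₁ : big₂ K ⊓ G₁ K ≤ big₁ K := by
  rintro g ⟨h1, h2⟩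
  have h3 : g ∈ ((big₁ K ⊔ grpSigma K : Subgroup (Equiv.Perm (K × K × K))) : Set _) := by
    rw [← G₁J_eq]; exact G₁_le h2
  rw [Subgroup.coe_mul_of_right_le_normalizer_left _ _ grpSigma_le_normalizer₁] at h3
  obtain ⟨r, hr, s, hs, rfl⟩ := h3
  rcases mem_grpSigma hs with rfl | rfl
  · simpa using hr
  · exfalso
    obtain ⟨M, t, w, -, -, rfl⟩ := hr
    change affPerm _ _ _ _ * σ K ∈ big₂ K at h1
    rw [σ_eq, affPerm_mul] at h1
    obtain ⟨l, m, d, e, u, v, w, -, -, -, -, h⟩ := h1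
    obtain ⟨-, h5, h6, -⟩ := eq_of_affPerm_eq_quadPerm h
    have h7 : gmap (chi (GeneralLinearGroup.det M)) (1 : GL (Fin 2) K) = 1 := map_one _
    rw [h7, mul_one] at h5
    rw [h5, det_tri] at h6
    exact mul_frob_ne _ h6.symm

theorem isCoverOf_G : IsCoverOf (cosetGraph (G₁J K) (G₂J K)) (cosetGraph (G₁ K) (G₂ K)) := by
  refine isCoverOf_cosetGraph (S := grpSigma K) G₁J_le_G₁ G₂J_le_G₂ le_sup_right le_sup_right
    G₁_le G₂_le ?_ ?_ ?_ ?_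
  · rw [G₁J_eq]; exact grpSigma_le_normalizer₁
  · rw [G₂J_eq]; exact grpSigma_le_normalizer₂
  · rw [G₁J_eq, G₂J_eq]; exact big₁_inf_G₂
  · rw [G₁J_eq, G₂J_eq]; exact big₂_inf_G₁

end PermK

namespace PermK

variable {K : Type} [Field K] [Finite K] [CharP K 3] [hK : Fact (Nat.card K = 9)]

/-! ### The graph -/

variable (K) in
/-- The group generated by the two stabilizers. -/
noncomputable abbrev ambient : Subgroup (Equiv.Perm (K × K × K)) := stab₁ K ⊔ stab₂ K

variable (K) in
/-- The coset graph of the two stabilizers. -/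
noncomputable abbrev graph : SimpleGraph ((ambient K ⧸ (stab₁ K).subgroupOf (ambient K)) ⊕
    (ambient K ⧸ (stab₂ K).subgroupOf (ambient K))) :=
  bicosetGraph ((stab₁ K).subgroupOf (ambient K)) ((stab₂ K).subgroupOf (ambient K))

variable (K) in
/-- The action of the ambient group on the graph. -/
noncomputable abbrev graphAct : ambient K →* (graph K ≃g graph K) := bicosetGraph.act _ _

theorem stab₁_le : stab₁ K ≤ ambient K := le_sup_left
theorem stab₂_le : stab₂ K ≤ ambient K := le_sup_right

theorem borel_le (Λ : Subgroup (Kˣ × Kˣ)) : borel Λ ≤ ambient K :=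
  (borel_le_stab₁ Λ).trans stab₁_le

theorem scal_le (Λ : Subgroup (Kˣ × Kˣ)) : scal Λ ≤ ambient K :=
  (scal_le_borel Λ).trans (borel_le Λ)

theorem slPart_le : slPart K ≤ ambient K := slPart_le_stab₁.trans stab₁_le
theorem core₁_le : core₁ K ≤ ambient K := core₁_le_stab₁.trans stab₁_le
theorem core₂_le : core₂ K ≤ ambient K := core₂_le_stab₂.trans stab₂_le
theorem thirdTrans_le : thirdTrans K ≤ ambient K := isSplit_slPart.le.trans slPart_le

theorem graphAct_injective : Function.Injective (graphAct K) := by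
  apply bicosetGraph.act_injective
  intro g hg
  exact Subtype.ext (stab_core fun h hh => hg ⟨h, hh⟩)

/-- Restriction to a subgroup is transport along the identity, so the lemmas on `partialMap` apply
to it as well. -/
theorem subgroupOf_eq_partialMap {X : Type*} [Group X] (P S : Subgroup X) :
    S.subgroupOf P = partialMap (MonoidHom.id P) S := (Subgroup.map_id _).symm

theorem pCore_largestNormal_subgroupOf₁ :
    pCore 3 (largestNormal ((stab₁ K).subgroupOf (ambient K) ⊓ (stab₂ K).subgroupOf (ambient K))
      ((stab₁ K).subgroupOf (ambient K))) = (scal ⊥).subgroupOf (ambient K) := by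
  have hid : Function.Injective (MonoidHom.id (ambient K)) := fun _ _ h => h
  rw [subgroupOf_eq_partialMap _ (stab₁ K), subgroupOf_eq_partialMap _ (stab₂ K),
    subgroupOf_eq_partialMap _ (scal ⊥), ← partialMap.inf hid, stab_inf,
    partialMap.largestNormal hid (borel_le _) stab₁_le, largestNormal_stab₁,
    partialMap.pCore hid 3 (scal_le _), pCore_scal diagScalar_le_diagSq]

theorem pCore_largestNormal_subgroupOf₂ :
    pCore 3 (largestNormal ((stab₁ K).subgroupOf (ambient K) ⊓ (stab₂ K).subgroupOf (ambient K))
      ((stab₂ K).subgroupOf (ambient K))) = (borel ⊥).subgroupOf (ambient K) := by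
  have hid : Function.Injective (MonoidHom.id (ambient K)) := fun _ _ h => h
  rw [subgroupOf_eq_partialMap _ (stab₁ K), subgroupOf_eq_partialMap _ (stab₂ K),
    subgroupOf_eq_partialMap _ (borel ⊥), ← partialMap.inf hid, stab_inf,
    partialMap.largestNormal hid (borel_le _) stab₂_le, largestNormal_stab₂,
    partialMap.pCore hid 3 (borel_le _), pCore_borel diagKer_le_diagSq]

theorem graph_connected : (graph K).Connected := by
  apply bicosetGraph.connected
  rw [← Subgroup.subgroupOf_sup stab₁_le stab₂_le]
  exact Subgroup.subgroupOf_self _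

theorem graph_locallyArcTransitive : LocallyArcTransitive (graphAct K).range 5 :=
  (bicosetGraph.FiveArcData.subgroupOf fiveArcData stab₁_le stab₂_le).locallyArcTransitive

variable (K) in
/-- The first base vertex. -/
noncomputable abbrev vertex₁ : (ambient K ⧸ (stab₁ K).subgroupOf (ambient K)) ⊕
    (ambient K ⧸ (stab₂ K).subgroupOf (ambient K)) := Sum.inl ((1 : ambient K) : _ ⧸ _)

variable (K) in
/-- The second base vertex. -/
noncomputable abbrev vertex₂ : (ambient K ⧸ (stab₁ K).subgroupOf (ambient K)) ⊕
    (ambient K ⧸ (stab₂ K).subgroupOf (ambient K)) := Sum.inr ((1 : ambient K) : _ ⧸ _)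

theorem graph_pushingUpType :
    PushingUpType (graphAct K).range 3 (vertex₁ K) (vertex₂ K) := by
  refine ⟨Nat.prime_three, bicosetGraph.adj_mk 1, ?_, ?_⟩
  · have hid : Function.Injective (MonoidHom.id (ambient K)) := fun _ _ h => h
    apply bicosetGraph.localChar graphAct_injective
    · rw [pCore_largestNormal_subgroupOf₁, subgroupOf_eq_partialMap, subgroupOf_eq_partialMap,
        partialMap.inf_centralizer hid stab₁_le (scal_le _)]
      exact partialMap.mono stab₁_inf_centralizer
    · rw [pCore_largestNormal_subgroupOf₂, subgroupOf_eq_partialMap, subgroupOf_eq_partialMap,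
        partialMap.inf_centralizer hid stab₂_le (borel_le _)]
      exact partialMap.mono stab₂_inf_centralizer
  · rw [bicosetGraph.localKernel_inl, bicosetGraph.localKernel_inr, pCore_map graphAct_injective,
      pCore_map graphAct_injective, pCore_largestNormal_subgroupOf₁,
      pCore_largestNormal_subgroupOf₂]
    exact partialMap.mono scal_bot_le_borel_bot

theorem graph_groupL :
    groupL (graphAct K).range 3 (vertex₁ K) = partialMap (graphAct K) (slPart K) := by
  have h : conjClosure ((borel ⊥).subgroupOf (ambient K)) ((stab₁ K).subgroupOf (ambient K)) =
      (slPart K).subgroupOf (ambient K) := by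
    rw [subgroupOf_eq_partialMap, subgroupOf_eq_partialMap, partialMap.conjClosure (borel_le _)
      stab₁_le, conjClosure_borel_bot, subgroupOf_eq_partialMap]
  rw [bicosetGraph.groupL_inl graphAct_injective, pCore_largestNormal_subgroupOf₁,
    pCore_largestNormal_subgroupOf₂, h, sup_eq_left.2]
  · rfl
  · exact Subgroup.comap_mono (scal_bot_le_borel_bot.trans borel_bot_le_slPart)

theorem graph_ncard₁ : ((graph K).neighborSet (vertex₁ K)).ncard = 10 := by
  rw [bicosetGraph.ncard_neighborSet_inl, Subgroup.relIndex_subgroupOf stab₁_le]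
  exact relIndex_stab₂_stab₁

theorem graph_ncard₂ : ((graph K).neighborSet (vertex₂ K)).ncard = 9 := by
  rw [bicosetGraph.ncard_neighborSet_inr, Subgroup.relIndex_subgroupOf stab₂_le]
  exact relIndex_stab₁_stab₂

theorem graph_largestNormal : partialMap (graphAct K) (borel (diagKer K)) =
    largestNormal (partialMap (graphAct K) (borel ⊤)) (partialMap (graphAct K) (stab₂ K)) := by
  rw [partialMap.largestNormal graphAct_injective (borel_le _) stab₂_le, largestNormal_stab₂]

theorem graph_centerOf :
    centerOf (partialMap (graphAct K) (slPart K)) = partialMap (graphAct K) (thirdTrans K) := by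
  rw [partialMap.centerOf graphAct_injective slPart_le, centerOf_slPart]

theorem graph_pCore {Λ : Subgroup (Kˣ × Kˣ)} (hΛ : Λ ≤ diagSq K) :
    pCore 3 (partialMap (graphAct K) (borel Λ)) = partialMap (graphAct K) (borel ⊥) := by
  rw [partialMap.pCore graphAct_injective 3 (borel_le _), pCore_borel hΛ]

theorem graph_inf : partialMap (graphAct K) (slPart K) ⊓ partialMap (graphAct K) (borel (diagSq K)) =
    partialMap (graphAct K) (borel (diagOne K)) := by
  rw [← partialMap.inf graphAct_injective, slPart_inf_borel]

/-- An isomorphism onto the image, composed with an isomorphism. -/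
theorem nonempty_partialMap_equiv {S : Subgroup (Equiv.Perm (K × K × K))} (hS : S ≤ ambient K)
    {G : Type*} [Group G] (h : Nonempty (S ≃* G)) :
    Nonempty (partialMap (graphAct K) S ≃* G) :=
  h.map fun e => (partialMap.equiv graphAct_injective hS).symm.trans e

/-- The orders are 3⁷ and 3⁷·80. -/
theorem graph_sylow : ∃ P : Sylow 3 (partialMap (graphAct K) (slPart K)),
    (P : Subgroup (partialMap (graphAct K) (slPart K))).map (Subgroup.subtype _) =
      partialMap (graphAct K) (borel ⊥) := by
  have : Fact (Nat.Prime 3) := ⟨Nat.prime_three⟩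
  have hle : partialMap (graphAct K) (borel ⊥) ≤ partialMap (graphAct K) (slPart K) :=
    partialMap.mono borel_bot_le_slPart
  have : Finite (partialMap (graphAct K) (slPart K)) :=
    Finite.of_equiv _ (partialMap.equiv graphAct_injective slPart_le).toEquiv
  refine ⟨Sylow.ofCard ((partialMap (graphAct K) (borel ⊥)).subgroupOf
    (partialMap (graphAct K) (slPart K))) ?_, Subgroup.map_subgroupOf_eq_of_le hle⟩
  rw [Nat.card_congr (Subgroup.subgroupOfEquivOfLe hle).toEquiv,
    ← Nat.card_congr (partialMap.equiv graphAct_injective (borel_le _)).toEquiv,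
    ← Nat.card_congr (partialMap.equiv graphAct_injective slPart_le).toEquiv,
    card_borel_bot, card_slPart, factorization_three]

theorem graph_part_two (S : Sylow 3 (ASL 2 K)) :
    Nonempty (↥(partialMap (graphAct K) (slPart K) ⊓ partialMap (graphAct K) (borel (diagSq K))) ≃*
      ElemAb 3 1 × Subgroup.normalizer (S : Set (ASL 2 K))) ∧
    ∃ N : Subgroup (kernelK2 3 (S : Subgroup (ASL 2 K))), IsTheNormalSubgroup N 2 ∧
      QuotientIso (partialMap (graphAct K) (borel (diagKer K)))
        (centerOf (partialMap (graphAct K) (slPart K))) N := by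
  obtain ⟨⟨e₁⟩, ⟨e₂⟩⟩ := exists_mulEquiv_of_sylow S
  constructor
  · rw [graph_inf]
    exact nonempty_partialMap_equiv (borel_le _) (nonempty_borel_diagOne_equiv.map fun e =>
      e.trans ((MulEquiv.refl _).prodCongr e₁))
  · have hN := (isTheNormalSubgroup_kernelK2 (K := K) (d := 2) (by norm_num)).map_equiv e₂
    refine ⟨_, hN, ?_⟩
    rw [graph_centerOf]
    obtain ⟨g, hg, hker⟩ := isSplit_borel_diagKer (K := K).quotientIso.exists_hom
    refine partialMap.quotientIso graphAct_injective (borel_le _)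
      (quotientIso_of_hom isSplit_borel_diagKer.le
        ((Subgroup.equivMapOfInjective (kernelK2Sub K 2) e₂.toMonoidHom e₂.injective).toMonoidHom.comp g)
        ((Subgroup.equivMapOfInjective (kernelK2Sub K 2) e₂.toMonoidHom e₂.injective).surjective.comp hg)
      fun x => ?_)
    rw [← hker]
    exact MulEquiv.map_eq_one_iff
      (Subgroup.equivMapOfInjective (kernelK2Sub K 2) e₂.toMonoidHom e₂.injective)

theorem graph_part_three :
    ∃ φ : ((powMonoidHom 2 : Kˣ →* Kˣ).range.comap
        (Matrix.GeneralLinearGroup.det : GL (Fin 2) K →* Kˣ)) →* MulAut (ElemAb 3 5),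
      Nonempty (partialMap (graphAct K) (core₁ K) ≃* ElemAb 3 5 ⋊[φ] _) := by
  obtain ⟨e⟩ := nonempty_scal_equiv (K := K)
  obtain ⟨φ, h⟩ := isSplit_core₁.nonempty_semidirect_of_equiv e
  exact ⟨φ, nonempty_partialMap_equiv core₁_le h⟩

theorem graph_part_three_centralizer :
    Nonempty (↥(partialMap (graphAct K) (core₁ K) ⊓ Subgroup.centralizer
      (centerOf (partialMap (graphAct K) (slPart K)) : Set (graph K ≃g graph K))) ≃*
      ElemAb 3 1 × ((powMonoidHom 4 : Kˣ →* Kˣ).range.comap (aglDet K))) := by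
  rw [graph_centerOf, partialMap.inf_centralizer graphAct_injective core₁_le thirdTrans_le]
  exact nonempty_partialMap_equiv (inf_le_left.trans core₁_le) nonempty_core₁_inf_centralizer_equiv

theorem graph_part_four :
    ∃ φ : ((powMonoidHom 2 : Kˣ →* Kˣ).range.comap
        (Matrix.GeneralLinearGroup.det : GL (Fin 1) K →* Kˣ)) × AGL 1 K →*
        MulAut (partialMap (graphAct K) (borel (⊥ : Subgroup (Kˣ × Kˣ)))),
      Nonempty (partialMap (graphAct K) (core₂ K) ≃* partialMap (graphAct K) (borel ⊥) ⋊[φ] _) := by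
  obtain ⟨φ, h⟩ := isSplit_core₂ (K := K).nonempty_semidirect_of_equiv
    (partialMap.equiv graphAct_injective (borel_le _))
  exact ⟨φ, nonempty_partialMap_equiv core₂_le h⟩

theorem graph_part_four_centralizer (S : Sylow 3 (ASL 2 K)) :
    ∃ N : Subgroup (kernelK2 3 (S : Subgroup (ASL 2 K))), IsTheNormalSubgroup N 4 ∧
      Nonempty (↥(partialMap (graphAct K) (core₂ K) ⊓ Subgroup.centralizer
        (centerOf (partialMap (graphAct K) (borel ⊥)) : Set (graph K ≃g graph K))) ≃*
        ElemAb 3 1 × N) := by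
  obtain ⟨-, ⟨e⟩⟩ := exists_mulEquiv_of_sylow S
  refine ⟨_, (isTheNormalSubgroup_kernelK2 (K := K) (d := 4) (by norm_num)).map_equiv e, ?_⟩
  rw [partialMap.centerOf graphAct_injective (borel_le _),
    partialMap.inf_centralizer (T := centerOf (borel ⊥)) graphAct_injective core₂_le
      ((inf_le_left : centerOf (borel ⊥) ≤ borel ⊥).trans (borel_le _)), core₂_inf_centralizer]
  exact nonempty_partialMap_equiv (borel_le _) (nonempty_borel_diagSign_equiv.map fun e' =>
    e'.trans ((MulEquiv.refl _).prodCongr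
      (Subgroup.equivMapOfInjective (kernelK2Sub K 4) e.toMonoidHom e.injective)))

/-! ### The subamalgam of index three -/

/-- The inverse of `partialMap.equiv`, as a homomorphism to the ambient group. -/
noncomputable def partialInv {S : Subgroup (Equiv.Perm (K × K × K))} (hS : S ≤ ambient K) :
    partialMap (graphAct K) S →* Equiv.Perm (K × K × K) :=
  S.subtype.comp (partialMap.equiv graphAct_injective hS).symm.toMonoidHom

theorem partialInv_apply {S : Subgroup (Equiv.Perm (K × K × K))} (hS : S ≤ ambient K)
    {x : Equiv.Perm (K × K × K)} (hx : x ∈ ambient K)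
    (h : graphAct K ⟨x, hx⟩ ∈ partialMap (graphAct K) S) : partialInv hS ⟨_, h⟩ = x := by
  have hxS : x ∈ S := (partialMap.apply_mem_iff graphAct_injective hx).1 h
  have : (⟨_, h⟩ : partialMap (graphAct K) S) = partialMap.equiv graphAct_injective hS ⟨x, hxS⟩ :=
    rfl
  rw [this, partialInv]
  simp

theorem partialInv_injective {S : Subgroup (Equiv.Perm (K × K × K))} (hS : S ≤ ambient K) :
    Function.Injective (partialInv hS) :=
  S.subtype_injective.comp (MulEquiv.injective _)

theorem range_partialInv {S : Subgroup (Equiv.Perm (K × K × K))} (hS : S ≤ ambient K) :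
    (partialInv hS).range = S := by
  rw [partialInv, MonoidHom.range_comp, MonoidHom.range_eq_top.2 (MulEquiv.surjective _),
    ← MonoidHom.range_eq_map, Subgroup.range_subtype]

theorem map_partialInv {S T : Subgroup (Equiv.Perm (K × K × K))} (hS : S ≤ ambient K)
    (hT : T ≤ S) : ((partialMap (graphAct K) T).subgroupOf (partialMap (graphAct K) S)).map
      (partialInv hS) = T := by
  ext y
  constructor
  · rintro ⟨⟨x, hx⟩, hxT, rfl⟩
    obtain ⟨z, hz, hzT, rfl⟩ := partialMap.mem.1 hxT
    rwa [partialInv_apply]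
  · intro hy
    have hya : y ∈ ambient K := hS (hT hy)
    have hyS : graphAct K ⟨y, hya⟩ ∈ partialMap (graphAct K) S :=
      (partialMap.apply_mem_iff graphAct_injective hya).2 (hT hy)
    exact ⟨⟨_, hyS⟩, (partialMap.apply_mem_iff graphAct_injective hya).2 hy,
      partialInv_apply _ _ _⟩

theorem graph_subamalgam : IsSubamalgamOfIndex 3 (partialMap (graphAct K) (stab₁ K))
    (partialMap (graphAct K) (stab₂ K)) (G₁J K) (G₂J K) := by
  refine ⟨partialInv stab₁_le, partialInv stab₂_le, borel ⊤, partialInv_injective _,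
    partialInv_injective _, ?_, ?_, ?_, ?_, ?_, ?_, ?_, ?_, ?_⟩
  · intro g h₁ h₂
    obtain ⟨x, hx, hxS, rfl⟩ := partialMap.mem.1 h₁
    rw [partialInv_apply, partialInv_apply]
  · rw [← partialMap.inf graphAct_injective, stab_inf, map_partialInv _ (borel_le_stab₁ _)]
  · rw [range_partialInv, G₁J_eq]; exact stab₁_le_big₁
  · rw [range_partialInv, G₂J_eq]; exact stab₂_le_big₂
  · rw [range_partialInv, G₁J_eq, G₂J_eq]; exact stab₁_inf_big
  · rw [range_partialInv, G₁J_eq, G₂J_eq]; exact stab₂_inf_big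
  · rw [range_partialInv, G₁J_eq]; exact relIndex_stab₁_big₁
  · rw [range_partialInv, G₂J_eq]; exact relIndex_stab₂_big₂
  · rw [G₁J_eq, G₂J_eq]; exact relIndex_borel_big

end PermK

/-! ### The theorem for the field with nine elements -/

theorem theorem1p3 :
    ∃ (V : Type) (_ : Finite V) (Γ : SimpleGraph V) (H : Subgroup (Γ ≃g Γ)) (x₁ x₂ : V)
      (H₁ H₂ H₁₂ T₂ L₁ B H₁' H₂' : Subgroup (Γ ≃g Γ)),
      -- the graph and its vertex stabilizer amalgam `(H₁, H₂; H₁₂)` with core `(H₁', H₂'; B)`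
      Γ.Connected ∧ LocallyArcTransitive H 5 ∧ PushingUpType H 3 x₁ x₂ ∧
      (Γ.neighborSet x₁).ncard = 10 ∧ (Γ.neighborSet x₂).ncard = 9 ∧
      H₁ = vertexStab H x₁ ∧ H₂ = vertexStab H x₂ ∧ H₁₂ = H₁ ⊓ H₂ ∧
      T₂ = largestNormal H₁₂ H₂ ∧ L₁ = groupL H 3 x₁ ∧
      IsCoreBase H₁ H₂ B ∧ H₁' = conjClosure B H₁ ∧ H₂' = conjClosure B H₂ ∧
      -- part 1
      Nonempty (L₁ ≃* ElemAb 3 1 × ASL 2 (GaloisField 3 2)) ∧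
      Nonempty (centerOf L₁ ≃* ElemAb 3 1) ∧
      pCore 3 B = pCore 3 (L₁ ⊓ B) ∧ pCore 3 (L₁ ⊓ B) = pCore 3 T₂ ∧
      (∃ P : Sylow 3 L₁, (P : Subgroup L₁).map L₁.subtype = pCore 3 T₂) ∧
      -- part 2
      (B : Set (Γ ≃g Γ)) = ((L₁ ⊓ B : Subgroup (Γ ≃g Γ)) : Set (Γ ≃g Γ)) * (T₂ : Set (Γ ≃g Γ)) ∧
      (∀ S : Sylow 3 (ASL 2 (GaloisField 3 2)),
        Nonempty (↥(L₁ ⊓ B) ≃* ElemAb 3 1 ×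
          Subgroup.normalizer (S : Set (ASL 2 (GaloisField 3 2)))) ∧
        ∃ N : Subgroup (kernelK2 3 (S : Subgroup (ASL 2 (GaloisField 3 2)))),
          IsTheNormalSubgroup N 2 ∧ QuotientIso T₂ (centerOf L₁) N) ∧
      -- part 3
      (∃ N : Subgroup (GL (Fin 2) (GaloisField 3 2)), IsTheNormalSubgroup N 2 ∧
        ∃ φ : N →* MulAut (ElemAb 3 5), Nonempty (H₁' ≃* ElemAb 3 5 ⋊[φ] N)) ∧
      (∃ N : Subgroup (AGL 2 (GaloisField 3 2)), IsTheNormalSubgroup N 4 ∧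
        Nonempty (↥(H₁' ⊓ Subgroup.centralizer (centerOf L₁ : Set (Γ ≃g Γ))) ≃*
          ElemAb 3 1 × N)) ∧
      -- part 4
      (∃ N : Subgroup (GL (Fin 1) (GaloisField 3 2)), IsTheNormalSubgroup N 2 ∧
        ∃ φ : N × AGL 1 (GaloisField 3 2) →* MulAut (pCore 3 T₂),
          Nonempty (H₂' ≃* pCore 3 T₂ ⋊[φ] (N × AGL 1 (GaloisField 3 2)))) ∧
      (∀ S : Sylow 3 (ASL 2 (GaloisField 3 2)),
        ∃ N : Subgroup (kernelK2 3 (S : Subgroup (ASL 2 (GaloisField 3 2)))),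
          IsTheNormalSubgroup N 4 ∧
          Nonempty (↥(H₂' ⊓ Subgroup.centralizer (centerOf (pCore 3 T₂) : Set (Γ ≃g Γ))) ≃*
            ElemAb 3 1 × N)) ∧
      -- part 5
      H₁' ≤ H₁ ∧ H₁'.relIndex H₁ = 2 ∧ H₂' ≤ H₂ ∧ H₂'.relIndex H₂ = 2 ∧
      B ≤ H₁₂ ∧ B.relIndex H₁₂ = 2 ∧
      QuotientIso H₁ L₁ (QuaternionGroup 2) ∧
      -- the amalgam is a subamalgam of index `3` of the amalgam of a cover
      IsSubamalgamOfIndex 3 H₁ H₂ (PermK.G₁J (GaloisField 3 2)) (PermK.G₂J (GaloisField 3 2)) ∧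
      IsCoverOf (cosetGraph (PermK.G₁J (GaloisField 3 2)) (PermK.G₂J (GaloisField 3 2)))
        (cosetGraph (PermK.G₁ (GaloisField 3 2)) (PermK.G₂ (GaloisField 3 2))) := by
  have hK : Fact (Nat.card (GaloisField 3 2) = 9) := ⟨by rw [GaloisField.card 3 2 two_ne_zero]; rfl⟩
  have hinf : partialMap (PermK.graphAct (GaloisField 3 2)) (PermK.borel ⊤) =
      partialMap (PermK.graphAct _) (PermK.stab₁ (GaloisField 3 2)) ⊓
        partialMap (PermK.graphAct _) (PermK.stab₂ (GaloisField 3 2)) := by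
    rw [← partialMap.inf PermK.graphAct_injective, PermK.stab_inf]
  have hinj := PermK.graphAct_injective (K := GaloisField 3 2)
  refine ⟨_, inferInstance, PermK.graph (GaloisField 3 2), (PermK.graphAct _).range,
    PermK.vertex₁ _, PermK.vertex₂ _, partialMap (PermK.graphAct _) (PermK.stab₁ _),
    partialMap (PermK.graphAct _) (PermK.stab₂ _), partialMap (PermK.graphAct _) (PermK.borel ⊤),
    partialMap (PermK.graphAct _) (PermK.borel (PermK.diagKer _)),
    partialMap (PermK.graphAct _) (PermK.slPart _),
    partialMap (PermK.graphAct _) (PermK.borel (PermK.diagSq _)),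
    partialMap (PermK.graphAct _) (PermK.core₁ _), partialMap (PermK.graphAct _) (PermK.core₂ _),
    PermK.graph_connected, PermK.graph_locallyArcTransitive, PermK.graph_pushingUpType,
    PermK.graph_ncard₁, PermK.graph_ncard₂, bicosetGraph.vertexStab_inl.symm,
    bicosetGraph.vertexStab_inr.symm, hinf, PermK.graph_largestNormal, PermK.graph_groupL.symm,
    partialMap.isCoreBase hinj PermK.stab₁_le PermK.stab₂_le PermK.isCoreBase_borel,
    ?_, ?_, ?_, ?_, ?_, ?_, ?_, ?_, PermK.graph_part_two, ?_, ?_, ?_, ?_, ?_, ?_, ?_, ?_, ?_, ?_, ?_,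
    PermK.graph_subamalgam, PermK.isCoverOf_G⟩
  · rw [partialMap.conjClosure (PermK.borel_le _) PermK.stab₁_le, PermK.conjClosure_borel_core₁]
  · rw [partialMap.conjClosure (PermK.borel_le _) PermK.stab₂_le, PermK.conjClosure_borel_core₂]
  · exact PermK.nonempty_partialMap_equiv PermK.slPart_le PermK.nonempty_slPart_equiv
  · rw [PermK.graph_centerOf]
    exact PermK.nonempty_partialMap_equiv PermK.thirdTrans_le PermK.nonempty_thirdTrans_equiv
  · rw [PermK.graph_inf, PermK.graph_pCore le_rfl, PermK.graph_pCore PermK.diagOne_le_diagSq]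
  · rw [PermK.graph_inf, PermK.graph_pCore PermK.diagOne_le_diagSq,
      PermK.graph_pCore PermK.diagKer_le_diagSq]
  · rw [PermK.graph_pCore PermK.diagKer_le_diagSq]
    exact PermK.graph_sylow
  · rw [PermK.graph_inf]
    exact partialMap.coe_mul (PermK.borel_le _) (PermK.borel_le _) PermK.borel_diagSq_eq_mul
  · exact ⟨_, PermK.isTheNormalSubgroup_GL, PermK.graph_part_three⟩
  · exact ⟨_, PermK.isTheNormalSubgroup_AGL, PermK.graph_part_three_centralizer⟩
  · rw [PermK.graph_pCore PermK.diagKer_le_diagSq]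
    exact ⟨_, PermK.isTheNormalSubgroup_GL_one, PermK.graph_part_four⟩
  · rw [PermK.graph_pCore PermK.diagKer_le_diagSq]
    exact PermK.graph_part_four_centralizer
  · exact partialMap.mono PermK.core₁_le_stab₁
  · rw [partialMap.relIndex hinj PermK.core₁_le PermK.stab₁_le, PermK.relIndex_core₁]
  · exact partialMap.mono PermK.core₂_le_stab₂
  · rw [partialMap.relIndex hinj PermK.core₂_le PermK.stab₂_le, PermK.relIndex_core₂]
  · exact partialMap.mono (PermK.borel_mono le_top)
  · rw [partialMap.relIndex hinj (PermK.borel_le _) (PermK.borel_le _),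
      PermK.relIndex_borel_diagSq]
  · exact partialMap.quotientIso hinj PermK.stab₁_le PermK.isSplit_stab₁.quotientIso
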